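/- Let $k,\lambda>0$ and let $X_1,\dots,X_n$ be i.i.d. from the Weibull density $f(x\mid k,\lambda)=\frac{k}{\lambda}(x/\lambda)^{k-1}e^{-(x/\lambda)^k}$, $x>0$, with parameter $\theta=(k,\lambda)\in\Theta=(0,\infty)^2$. Let $I(\theta)$ be the expected per-observation Fisher information, let $\pi(k,\lambda)=\frac{2}{\pi(1+k^2)}\cdot\frac{2}{\pi(1+\lambda^2)}$ be the product of two half-Cauchy priors, put $\operatorname{pen}(\theta)=-\log\pi(\theta)+\frac12\log|I(\theta)|$ and $a(\theta)=-\nabla\operatorname{pen}(\theta)$. A maximum likelihood estimator $\hat\theta_{\rm MLE}$ is a measurable function of the data that picks a global maximiser over $\Theta$ of the likelihood whenever one exists; a Wallace--Freeman estimator $\hat\theta_{\rm MML}$ is a measurable function of the data that picks a global minimiser over $\Theta$ of $\frac1n\sum_{i=1}^n[-\log f(x_i\mid\theta)]+\frac1n\operatorname{pen}(\theta)$ whenever one exists. For an estimator $T$, $\operatorname{Bias}(T)=\mathbb E_\theta[T]-\theta$. Let $\gamma$ be the Euler--Mascheroni constant, and put $$b(k,\lambda)=\begin{pmatrix}\dfrac{18k(\pi^2-2\zeta(3))}{\pi^4}\\[2ex]\dfrac{\lambda\{72(\gamma-1)k\zeta(3)+6\pi^2(5k+\gamma(-4k+\gamma-2)+1)+\pi^4(1-2k)\}}{2\pi^4k^2}\end{pmatrix},$$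 $$c(k,\lambda)=\begin{pmatrix}\dfrac{6}{\pi^2}\Bigl\{\dfrac{(\gamma-1)(\lambda^2-1)}{\lambda^2+1}-\dfrac{2k^3}{k^2+1}\Bigr\}\\[2ex]\dfrac{\lambda}{\pi^2k^2}\Bigl\{\dfrac{12(\gamma-1)k^3}{k^2+1}-\dfrac{\{6(\gamma-1)^2+\pi^2\}(\lambda^2-1)}{\lambda^2+1}\Bigr\}\end{pmatrix}.$$ Then the following hold. 1. $$I(\theta)=\begin{pmatrix}\frac{6(\gamma-1)^2+\pi^2}{6k^2}&\frac{\gamma-1}{\lambda}\\ \frac{\gamma-1}{\lambda}&\frac{k^2}{\lambda^2}\end{pmatrix},\qquad |I(\theta)|=\frac{\pi^2}{6\lambda^2},\qquad a(\theta)=\begin{pmatrix}-\frac{2k}{k^2+1}\\ \frac{1-\lambda^2}{\lambda(\lambda^2+1)}\end{pmatrix},$$ and $I(\theta)^{-1}a(\theta)=c(k,\lambda)$. 2. With $\ell$ the log-likelihood of the sample of size $n\ge1$, $\kappa_{ij}=\mathbb E_\theta[\partial_i\partial_j\ell]$, $\kappa_{ijl}=\mathbb E_\theta[\partial_i\partial_j\partial_l\ell]$,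 $\{\kappa^{ij}\}=\{-\kappa_{ij}\}^{-1}$, the Cox--Snell expression $\sum_{i,j,l}\kappa^{si}\kappa^{jl}\bigl(\frac{\partial\kappa_{ij}}{\partial\theta_l}-\frac12\kappa_{ijl}\bigr)$, $s=1,2$, equals $\frac1n b(k,\lambda)$. 3. For every sequence of maximum likelihood estimators, $\hat\theta_{\rm MLE}$ has a finite expectation for all large $n$, and $\operatorname{Bias}(\hat\theta_{\rm MLE})=\frac1n b(k,\lambda)+O(n^{-2})$. 4. For all sequences of maximum likelihood and of Wallace--Freeman estimators, $\hat\theta_{\rm MML}$ has a finite expectation for all large $n$, and $\operatorname{Bias}(\hat\theta_{\rm MML})=\operatorname{Bias}(\hat\theta_{\rm MLE})+\frac1n c(k,\lambda)+o(n^{-1})$. 5. Let $R(k,\lambda)=b_1(k,\lambda)/(b_1(k,\lambda)+c_1(k,\lambda))$ be the ratio of the order-$n^{-1}$ shape bias of the maximum likelihood estimator to that of the Wallace--Freeman estimator. For all $k>0$, $b_1(k,1)+c_1(k,1)>0$ and $$R(k,1)=\frac{3(k^2+1)(\pi^2-2\zeta(3))}{\pi^2(k^2+3)-6(k^2+1)\zeta(3)}>1.$$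 -/

import Mathlib

open MeasureTheory Filter Asymptotics

noncomputable section

namespace WallaceFreeman

/-! ### Parametric families of densities on `ℝ`, with parameter in `Fin d → ℝ` -/

variable {d : ℕ}

/-- Partial derivative `∂f/∂θᵢ` at `θ`. -/
def partialDeriv (i : Fin d) (f : (Fin d → ℝ) → ℝ) (θ : Fin d → ℝ) : ℝ :=
  deriv (fun t : ℝ => f (Function.update θ i t)) (θ i)

/-- The law on `ℝ` with Lebesgue density `p θ`. -/
def obsLaw (p : (Fin d → ℝ) → ℝ → ℝ) (θ : Fin d → ℝ) : Measure ℝ :=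
  volume.withDensity (fun x => ENNReal.ofReal (p θ x))

/-- The law of `n` independent observations with density `p θ`. -/
def sampleLaw (p : (Fin d → ℝ) → ℝ → ℝ) (n : ℕ) (θ : Fin d → ℝ) : Measure (Fin n → ℝ) :=
  Measure.pi (fun _ => obsLaw p θ)

/-- Full-sample log-likelihood `ℓ(θ) = ∑ log p(xᵢ | θ)`. -/
def logLik (p : (Fin d → ℝ) → ℝ → ℝ) {n : ℕ} (x : Fin n → ℝ) (θ : Fin d → ℝ) : ℝ :=
  ∑ i, Real.log (p θ (x i))

/-- Expected per-observation Fisher information `I(θ) = E_θ[(∂ log p)(∂ log p)ᵀ]`. -/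
def fisherInfo (p : (Fin d → ℝ) → ℝ → ℝ) (θ : Fin d → ℝ) : Matrix (Fin d) (Fin d) ℝ :=
  Matrix.of fun i j =>
    ∫ x, partialDeriv i (fun τ => Real.log (p τ x)) θ *
      partialDeriv j (fun τ => Real.log (p τ x)) θ ∂(obsLaw p θ)

/-- The Wallace–Freeman penalty `pen(θ) = -log π(θ) + ½ log |I(θ)|`. -/
def wfPen (p : (Fin d → ℝ) → ℝ → ℝ) (prior : (Fin d → ℝ) → ℝ) (θ : Fin d → ℝ) : ℝ :=
  -Real.log (prior θ) + (1 / 2) * Real.log (fisherInfo p θ).det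

/-- The penalised criterion `(1/n) ∑ (-log p(xᵢ | θ)) + (1/n) pen(θ)`, which is the
Wallace–Freeman codelength divided by `n`, up to constants that do not depend on `θ`. -/
def wfCriterion (p : (Fin d → ℝ) → ℝ → ℝ) (prior : (Fin d → ℝ) → ℝ) {n : ℕ}
    (x : Fin n → ℝ) (θ : Fin d → ℝ) : ℝ :=
  (1 / (n : ℝ)) * ∑ i, (-Real.log (p θ (x i))) + (1 / (n : ℝ)) * wfPen p prior θ

/-- `a(θ) = -∇ pen(θ)`. -/
def wfGrad (p : (Fin d → ℝ) → ℝ → ℝ) (prior : (Fin d → ℝ) → ℝ) (θ : Fin d → ℝ) : Fin d → ℝ :=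
  fun i => -partialDeriv i (wfPen p prior) θ

/-- A measurable function of the data (from the sample space `𝒳ⁿ`) is a maximum likelihood
estimator over `Θ` if it picks a global maximiser of the likelihood for every sample that
has one. -/
def IsMLE (p : (Fin d → ℝ) → ℝ → ℝ) (𝒳 : Set ℝ) (Θ : Set (Fin d → ℝ)) {n : ℕ}
    (T : (Fin n → ℝ) → Fin d → ℝ) : Prop :=
  Measurable T ∧ ∀ x : Fin n → ℝ, (∀ i, x i ∈ 𝒳) →
    (∃ θ ∈ Θ, IsMaxOn (logLik p x) Θ θ) → T x ∈ Θ ∧ IsMaxOn (logLik p x) Θ (T x)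

/-- A measurable function of the data is a Wallace–Freeman estimator over `Θ` if it picks a
global minimiser of the penalised criterion for every sample that has one. -/
def IsWFEstimator (p : (Fin d → ℝ) → ℝ → ℝ) (prior : (Fin d → ℝ) → ℝ) (𝒳 : Set ℝ)
    (Θ : Set (Fin d → ℝ)) {n : ℕ} (T : (Fin n → ℝ) → Fin d → ℝ) : Prop :=
  Measurable T ∧ ∀ x : Fin n → ℝ, (∀ i, x i ∈ 𝒳) →
    (∃ θ ∈ Θ, IsMinOn (wfCriterion p prior x) Θ θ) →
      T x ∈ Θ ∧ IsMinOn (wfCriterion p prior x) Θ (T x)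

/-- `T` has a finite expectation when the data are `n` independent observations from `p θ`. -/
def HasMean (p : (Fin d → ℝ) → ℝ → ℝ) {n : ℕ} (T : (Fin n → ℝ) → Fin d → ℝ)
    (θ : Fin d → ℝ) : Prop :=
  ∀ s, Integrable (fun x => T x s) (sampleLaw p n θ)

/-- The bias vector `E_θ[T] - θ`. -/
def bias (p : (Fin d → ℝ) → ℝ → ℝ) {n : ℕ} (T : (Fin n → ℝ) → Fin d → ℝ)
    (θ : Fin d → ℝ) : Fin d → ℝ :=
  fun s => (∫ x, T x s ∂(sampleLaw p n θ)) - θ s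

/-- `κᵢⱼ(θ) = E_θ[∂²ℓ/∂θᵢ∂θⱼ]` for a sample of size `n`. -/
def cumulant₂ (p : (Fin d → ℝ) → ℝ → ℝ) (n : ℕ) (i j : Fin d) (θ : Fin d → ℝ) : ℝ :=
  ∫ x, partialDeriv i (partialDeriv j (logLik p x)) θ ∂(sampleLaw p n θ)

/-- `κᵢⱼₗ(θ) = E_θ[∂³ℓ/∂θᵢ∂θⱼ∂θₗ]` for a sample of size `n`. -/
def cumulant₃ (p : (Fin d → ℝ) → ℝ → ℝ) (n : ℕ) (i j l : Fin d) (θ : Fin d → ℝ) : ℝ :=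
  ∫ x, partialDeriv i (partialDeriv j (partialDeriv l (logLik p x))) θ ∂(sampleLaw p n θ)

/-- `K(θ) = {-κᵢⱼ(θ)}`, the expected information of the sample. -/
def sampleInfo (p : (Fin d → ℝ) → ℝ → ℝ) (n : ℕ) (θ : Fin d → ℝ) : Matrix (Fin d) (Fin d) ℝ :=
  Matrix.of fun i j => -cumulant₂ p n i j θ

/-- The Cox–Snell expression
`∑ᵢ ∑ⱼ ∑ₗ κ^{si} κ^{jl} (∂κᵢⱼ/∂θₗ - ½ κᵢⱼₗ)`, where `{κ^{ij}} = K⁻¹`. -/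
def coxSnell (p : (Fin d → ℝ) → ℝ → ℝ) (n : ℕ) (θ : Fin d → ℝ) : Fin d → ℝ :=
  fun s => ∑ i, ∑ j, ∑ l, (sampleInfo p n θ)⁻¹ s i * (sampleInfo p n θ)⁻¹ j l *
    (partialDeriv l (cumulant₂ p n i j) θ - (1 / 2) * cumulant₃ p n i j l θ)

/-! ### The Weibull model with independent half-Cauchy priors; `θ = (k, λ)` -/

/-- The Weibull density with shape `θ 0` and scale `θ 1`. -/
def weibullPDF (θ : Fin 2 → ℝ) (x : ℝ) : ℝ :=
  if 0 < x then
    θ 0 / θ 1 * (x / θ 1) ^ (θ 0 - 1) * Real.exp (-(x / θ 1) ^ θ 0)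
  else 0

/-- The Weibull parameter space: `k > 0` and `λ > 0`. -/
def weibullParams : Set (Fin 2 → ℝ) := {θ | 0 < θ 0 ∧ 0 < θ 1}

/-- The standard half-Cauchy density. -/
def halfCauchyPDF (t : ℝ) : ℝ := if 0 < t then 2 / (Real.pi * (1 + t ^ 2)) else 0

/-- The prior density `π(k, λ) = π_k(k) π_λ(λ)`. -/
def weibullPrior (θ : Fin 2 → ℝ) : ℝ := halfCauchyPDF (θ 0) * halfCauchyPDF (θ 1)

/-- Apéry's constant `ζ(3)`. -/
def apery : ℝ := (riemannZeta 3).re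

/-- The explicit coefficient of `1/n` in the bias of the Weibull maximum likelihood estimator. -/
def weibullMLECoeff (k lam : ℝ) : Fin 2 → ℝ :=
  let γ := Real.eulerMascheroniConstant
  let π := Real.pi
  ![18 * k * (π ^ 2 - 2 * apery) / π ^ 4,
    lam * (72 * (γ - 1) * k * apery + 6 * π ^ 2 * (5 * k + γ * (-4 * k + γ - 2) + 1)
        + π ^ 4 * (1 - 2 * k)) / (2 * π ^ 4 * k ^ 2)]

/-- The explicit Wallace–Freeman correction to the coefficient of `1/n`. -/
def weibullWFCorrection (k lam : ℝ) : Fin 2 → ℝ :=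
  let γ := Real.eulerMascheroniConstant
  let π := Real.pi
  ![6 / π ^ 2 * ((γ - 1) * (lam ^ 2 - 1) / (lam ^ 2 + 1) - 2 * k ^ 3 / (k ^ 2 + 1)),
    lam / (π ^ 2 * k ^ 2) * (12 * (γ - 1) * k ^ 3 / (k ^ 2 + 1)
        - (6 * (γ - 1) ^ 2 + π ^ 2) * (lam ^ 2 - 1) / (lam ^ 2 + 1))]

/-- The coefficient of `1/n` in the bias of the Wallace–Freeman estimator. -/
def weibullWFCoeff (k lam : ℝ) : Fin 2 → ℝ := weibullMLECoeff k lam + weibullWFCorrection k lam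

/-- `R(k, λ)`: the ratio of the order-`1/n` shape bias of the maximum likelihood estimator to
that of the Wallace–Freeman estimator. -/
def shapeBiasRatio (k lam : ℝ) : ℝ := weibullMLECoeff k lam 0 / weibullWFCoeff k lam 0

end WallaceFreeman

end

open WallaceFreeman

/-! Under `x ↦ (x/λ)^k` a Weibull observation becomes standard exponential, so every expectation
that occurs reduces to `gmom m j = E[Xᵐ (log X)ʲ]` for `X` exponential. Integration by parts
(`gmom_succ`) lowers `m` to `0`. The values at `m = 0` come from Gamma laws of growing shape `N +
1`: the cumulants of `log X` change by harmonic-type sums, while `log (X/N)` concentrates at zero,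
so the initial cumulants are `-γ`, `π²/6` and `-2ζ(3)`. Information matrix, Cox–Snell expression and
correction term are then finite algebra, and the statement on the ratio needs only `ζ(3) ≤ ζ(2)`.

The bias is not deduced from the Cox–Snell formula: it is computed independently and found to agree.
In the coordinates `shapeDev` (relative error of the shape) and `scaleDev` (shape times logarithmic
error of the scale) the equation for the scale can be solved explicitly, which leaves one profile
equation for the shape, with slope near `π²/6`. Its Taylor coefficients are built from sample
averages. Let `ξ` be the vector of centred averages. Along the filter of large samples with small
`ξ`, the maximum likelihood estimator is a cubic polynomial in `ξ` up to `O(|ξ|⁴)`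
(`HasExpansion.implicit`). Of that polynomial only the constant, the linear part and the contraction
of the quadratic part with the covariance matrix need to be tracked: the linear part has mean zero,
the quadratic part has mean contraction over `n`, and the cubic part and the remainder contribute
`O(n⁻²)`.

To pass from this pointwise expansion to expectations (`integral_sub_isBigO`), the samples with
large `ξ` must be negligible. Their probability decays faster than any power of `n`, so it suffices
that the `3/2`-th moments of the estimators grow polynomially (`Tame`). The scale is at most `1 + ∑
xₐ`. The shape is at most `2(n+1)/|log xₐ - log x_b|` for every pair of distinct observations. The
reciprocal gap itself is not integrable, but its power `3/4` is, and two disjoint pairs together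
give the power `3/2`.

The Wallace–Freeman estimator solves the same profile equation with a right-hand side of order
`1/n`. Subtracting the two equations and linearising gives the limit of `n` times the difference of
the estimators, and the same truncation transfers that limit to the expectations
(`tendsto_integral_sub`). -/

noncomputable section

namespace WallaceFreeman

open Set Real Topology ProbabilityTheory

/-! ### Functions with absolute moments of all orders -/

section AllMoments

variable {α : Type*} [MeasurableSpace α] {μ : Measure α}

/-- `f` has absolute moments of every order. -/
def AllMoments (f : α → ℝ) (μ : Measure α) : Prop :=
  AEStronglyMeasurable f μ ∧ ∀ p : ℕ, Integrable (fun x => |f x| ^ p) μ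

lemma AllMoments.integrable_pow {f : α → ℝ} (hf : AllMoments f μ) (p : ℕ) :
    Integrable (fun x => f x ^ p) μ :=
  (hf.2 p).mono' (hf.1.pow p) (Eventually.of_forall fun x => by simp)

lemma AllMoments.integrable {f : α → ℝ} (hf : AllMoments f μ) : Integrable f μ := by
  simpa using hf.integrable_pow 1

lemma AllMoments.mono {f g : α → ℝ} (hg : AllMoments g μ) (hf : AEStronglyMeasurable f μ)
    (h : ∀ᵐ x ∂μ, |f x| ≤ |g x|) : AllMoments f μ := by
  refine ⟨hf, fun p => (hg.2 p).mono' (hf.norm.pow p) ?_⟩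
  filter_upwards [h] with x hx
  simpa using pow_le_pow_left₀ (abs_nonneg _) hx p

/-- `2uv ≤ u² + v²` with `u = |f|ᵖ`, `v = |g|ᵖ` trades a product for moments of doubled order; no
Hölder inequality is needed. -/
lemma AllMoments.mul {f g : α → ℝ} (hf : AllMoments f μ) (hg : AllMoments g μ) :
    AllMoments (fun x => f x * g x) μ := by
  refine ⟨hf.1.mul hg.1, fun p => ((hf.2 (2 * p)).add (hg.2 (2 * p))).mono'
    ((hf.1.mul hg.1).norm.pow p) (Eventually.of_forall fun x => ?_)⟩
  simp only [norm_pow, Pi.add_apply, norm_mul, Real.norm_eq_abs, abs_abs,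
    abs_mul, mul_pow]
  have h := two_mul_le_add_sq (|f x| ^ p) (|g x| ^ p)
  have h1 : 0 ≤ |f x| ^ p * |g x| ^ p := by positivity
  rw [mul_comm 2 p, pow_mul, pow_mul]
  linarith

lemma AllMoments.add {f g : α → ℝ} (hf : AllMoments f μ) (hg : AllMoments g μ) :
    AllMoments (fun x => f x + g x) μ := by
  refine ⟨hf.1.add hg.1, fun p => (((hf.2 p).add (hg.2 p)).const_mul (2 ^ (p - 1))).mono'
    ((hf.1.add hg.1).norm.pow p) (Eventually.of_forall fun x => ?_)⟩
  simp only [norm_pow, Real.norm_eq_abs, Pi.add_apply, abs_abs]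
  exact (pow_le_pow_left₀ (abs_nonneg _) (abs_add_le _ _) p).trans
    (add_pow_le (abs_nonneg _) (abs_nonneg _) p)

lemma allMoments_const [IsFiniteMeasure μ] (c : ℝ) : AllMoments (fun _ => c) μ :=
  ⟨aestronglyMeasurable_const, fun _ => integrable_const _⟩

lemma AllMoments.const_mul {f : α → ℝ} (hf : AllMoments f μ) (c : ℝ) :
    AllMoments (fun x => c * f x) μ := by
  refine ⟨hf.1.const_mul c, fun p => ?_⟩
  simpa only [abs_mul, mul_pow] using (hf.2 p).const_mul (|c| ^ p)

lemma AllMoments.sub {f g : α → ℝ} (hf : AllMoments f μ) (hg : AllMoments g μ) :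
    AllMoments (fun x => f x - g x) μ := by
  simpa [sub_eq_add_neg] using hf.add (hg.const_mul (-1))

lemma AllMoments.pow [IsFiniteMeasure μ] {f : α → ℝ} (hf : AllMoments f μ) (n : ℕ) :
    AllMoments (fun x => f x ^ n) μ := by
  induction n with
  | zero => simpa using allMoments_const 1
  | succ n ih => simpa only [pow_succ] using ih.mul hf

lemma AllMoments.sum [IsFiniteMeasure μ] {ι : Type*} (s : Finset ι) {f : ι → α → ℝ}
    (hf : ∀ i ∈ s, AllMoments (f i) μ) : AllMoments (fun x => ∑ i ∈ s, f i x) μ := by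
  classical
  induction s using Finset.induction_on with
  | empty => simpa using allMoments_const 0
  | insert a s ha ih =>
    simp only [Finset.sum_insert ha]
    exact (hf a (Finset.mem_insert_self _ _)).add
      (ih fun i hi => hf i (Finset.mem_insert_of_mem hi))

lemma AllMoments.comp {β : Type*} [MeasurableSpace β] {ν : Measure β} {v : α → β}
    {f : β → ℝ} (hf : AllMoments f ν) (hv : MeasurePreserving v μ ν) :
    AllMoments (fun x => f (v x)) μ :=
  ⟨hf.1.comp_measurePreserving hv, fun p => hv.integrable_comp_of_integrable (hf.2 p)⟩

end AllMoments

/-! ### The standard exponential law and its logarithmic moments -/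

/-- The standard exponential law on `ℝ`. -/
def stdExp : Measure ℝ :=
  (volume.restrict (Ioi 0)).withDensity (fun x => ENNReal.ofReal (exp (-x)))

lemma integral_stdExp (f : ℝ → ℝ) : ∫ x, f x ∂stdExp = ∫ x in Ioi 0, exp (-x) * f x := by
  rw [stdExp, integral_withDensity_eq_integral_toReal_smul (by fun_prop) (by simp)]
  simp [ENNReal.toReal_ofReal (exp_nonneg _)]

lemma integrable_stdExp_iff (f : ℝ → ℝ) :
    Integrable f stdExp ↔ IntegrableOn (fun x => exp (-x) * f x) (Ioi 0) := by
  rw [stdExp, integrable_withDensity_iff_integrable_smul' (by fun_prop) (by simp), IntegrableOn]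
  simp [ENNReal.toReal_ofReal (exp_nonneg _)]

lemma ae_stdExp_pos : ∀ᵐ x ∂stdExp, 0 < x :=
  (withDensity_absolutelyContinuous _ _).ae_le (ae_restrict_mem measurableSet_Ioi)

lemma integrable_rpow_stdExp {s : ℝ} (hs : -1 < s) : Integrable (fun x => x ^ s) stdExp := by
  rw [integrable_stdExp_iff]
  simpa using GammaIntegral_convergent (s := s + 1) (by linarith)

lemma integrable_pow_stdExp (n : ℕ) : Integrable (fun x => x ^ n) stdExp := by
  simpa using integrable_rpow_stdExp (s := n) (by linarith [(Nat.cast_nonneg n : (0 : ℝ) ≤ n)])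

lemma integral_pow_stdExp (n : ℕ) : ∫ x, x ^ n ∂stdExp = n.factorial := by
  rw [integral_stdExp, ← Gamma_nat_eq_factorial, Gamma_eq_integral (by positivity)]
  simp

instance : IsProbabilityMeasure stdExp := by
  have h := integral_pow_stdExp 0
  have hi := integrable_pow_stdExp 0
  simp only [pow_zero, integral_const, smul_eq_mul, mul_one, Nat.factorial_zero, Nat.cast_one] at h
  constructor
  rw [Measure.real, ENNReal.toReal_eq_one_iff] at h
  exact h

lemma allMoments_id_stdExp : AllMoments (fun x => x) stdExp := by
  refine ⟨by fun_prop, fun p => (integrable_pow_stdExp p).congr ?_⟩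
  filter_upwards [ae_stdExp_pos] with x hx
  rw [abs_of_pos hx]

/-- Powers of `log` are dominated by small powers at both ends of the half-line. Both exponents
exceed `-1`, so the bound is integrable against `e⁻ˣ`; it also controls boundary terms at `0`. -/
lemma abs_log_pow_le (p : ℕ) :
    ∃ C : ℝ, ∀ x : ℝ, 0 < x → |log x| ^ p ≤ C * (x ^ (1 / 2 : ℝ) + x ^ (-1 / 2 : ℝ)) := by
  rcases Nat.eq_zero_or_pos p with rfl | hp
  · refine ⟨1, fun x hx => ?_⟩
    rcases le_total 1 x with h | h
    · have := one_le_rpow h (by norm_num : (0 : ℝ) ≤ 1 / 2)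
      have := rpow_pos_of_pos hx (-1 / 2)
      simp; linarith
    · have := one_le_rpow_of_pos_of_le_one_of_nonpos hx h (by norm_num : (-1 / 2 : ℝ) ≤ 0)
      have := rpow_pos_of_pos hx (1 / 2)
      simp; linarith
  have key : ∀ y : ℝ, 0 < y → 0 ≤ log y → (log y) ^ p ≤ (2 * p) ^ p * y ^ (1 / 2 : ℝ) := by
    intro y hy hl
    -- In `log y ≤ y^ε / ε` the choice `ε = 1/(2p)` makes the `p`-th power a multiple of `y^{1/2}`.
    have hε : (0 : ℝ) < 1 / (2 * p) := by positivity
    have h := log_le_rpow_div hy.le hε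
    calc (log y) ^ p ≤ (y ^ (1 / (2 * p : ℝ)) / (1 / (2 * p))) ^ p := pow_le_pow_left₀ hl h p
      _ = (2 * p) ^ p * y ^ (1 / 2 : ℝ) := by
        rw [div_pow, one_div_pow, div_div_eq_mul_div, div_one, mul_comm, ← rpow_mul_natCast hy.le]
        congr 2
        field_simp
  refine ⟨(2 * p) ^ p, fun x hx => ?_⟩
  have h1 := rpow_pos_of_pos hx (1 / 2)
  have h2 := rpow_pos_of_pos hx (-1 / 2)
  rcases le_total 0 (log x) with h | h
  · rw [abs_of_nonneg h]
    refine (key x hx h).trans (mul_le_mul_of_nonneg_left (by linarith) (by positivity))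
  · rw [abs_of_nonpos h, ← log_inv]
    refine (key x⁻¹ (by positivity) (by rw [log_inv]; linarith)).trans
      (mul_le_mul_of_nonneg_left ?_ (by positivity))
    rw [inv_rpow hx.le, ← rpow_neg hx.le]
    norm_num at *
    linarith

lemma allMoments_log_stdExp : AllMoments log stdExp := by
  refine ⟨measurable_log.aestronglyMeasurable, fun p => ?_⟩
  obtain ⟨C, hC⟩ := abs_log_pow_le p
  refine (((integrable_rpow_stdExp (s := 1 / 2) (by norm_num)).add
    (integrable_rpow_stdExp (s := -1 / 2) (by norm_num))).const_mul C).mono'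
    (measurable_log.norm.pow_const p).aestronglyMeasurable ?_
  filter_upwards [ae_stdExp_pos] with x hx
  simpa using hC x hx

lemma allMoments_pow_log_pow_stdExp (m j : ℕ) : AllMoments (fun x => x ^ m * log x ^ j) stdExp :=
  (allMoments_id_stdExp.pow m).mul (allMoments_log_stdExp.pow j)

/-- The mixed moments `E[Xᵐ (log X)ʲ]` of a standard exponential variable. -/
def gmom (m j : ℕ) : ℝ := ∫ x, x ^ m * log x ^ j ∂stdExp

lemma gmom_zero_right (m : ℕ) : gmom m 0 = m.factorial := by
  simpa [gmom] using integral_pow_stdExp m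

/-- Integration by parts: the derivative of `e⁻ˣ xᵐ⁺¹ (log x)ʲ` integrates to zero over the
half-line. For `j = 0` the truncated `j - 1` is harmless, since its coefficient vanishes. -/
lemma gmom_succ (m j : ℕ) :
    gmom (m + 1) j = (m + 1) * gmom m j + j * gmom m (j - 1) := by
  set F : ℝ → ℝ := fun x => exp (-x) * (x ^ (m + 1) * log x ^ j) with hF
  set F' : ℝ → ℝ := fun x => exp (-x) * ((m + 1) * (x ^ m * log x ^ j) +
    j * (x ^ m * log x ^ (j - 1)) - x ^ (m + 1) * log x ^ j) with hF'
  have hd : ∀ x ∈ Ioi (0 : ℝ), HasDerivAt F (F' x) x := by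
    intro x hx
    have hx0 : x ≠ 0 := (mem_Ioi.1 hx).ne'
    have h1 : HasDerivAt (fun x : ℝ => exp (-x)) (-exp (-x)) x := by
      simpa using (hasDerivAt_neg x).exp
    have h2 := (hasDerivAt_pow (m + 1) x).mul ((hasDerivAt_log hx0).pow j)
    refine (h1.mul h2).congr_deriv ?_
    simp only [hF', Pi.mul_apply, Pi.pow_apply]
    push_cast
    field_simp
    ring
  have hI := fun m j => (allMoments_pow_log_pow_stdExp m j).integrable
  have hG : Integrable (fun x => (m + 1) * (x ^ m * log x ^ j) +
      j * (x ^ m * log x ^ (j - 1)) - x ^ (m + 1) * log x ^ j) stdExp :=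
    (((hI m j).const_mul _).add ((hI m (j - 1)).const_mul _)).sub (hI (m + 1) j)
  have hF'i : IntegrableOn F' (Ioi 0) := (integrable_stdExp_iff _).1 hG
  have hFi : IntegrableOn F (Ioi 0) := (integrable_stdExp_iff _).1 (hI (m + 1) j)
  have htop := tendsto_zero_of_hasDerivAt_of_integrableOn_Ioi hd hF'i hFi
  have hF0 : F 0 = 0 := by simp [hF]
  -- The boundary value at `0` vanishes because one factor `x` absorbs the `x^{-1/2}` in the bound
  -- for `|log x|ʲ`.
  have hc : ContinuousWithinAt F (Ici 0) 0 := by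
    rw [← continuousWithinAt_Ioi_iff_Ici, ContinuousWithinAt, hF0]
    obtain ⟨C, hC⟩ := abs_log_pow_le j
    have hlim : Tendsto (fun x : ℝ => x ^ m * (C * (x * x ^ (1 / 2 : ℝ) + x ^ (1 / 2 : ℝ))))
        (𝓝[>] 0) (𝓝 0) := by
      have h3 : Continuous fun x : ℝ => x ^ (1 / 2 : ℝ) := continuous_rpow_const (by norm_num)
      have h4 : Continuous fun x : ℝ => x ^ m * (C * (x * x ^ (1 / 2 : ℝ) + x ^ (1 / 2 : ℝ))) := by
        fun_prop
      have := (h4.tendsto 0).mono_left (nhdsWithin_le_nhds (s := Ioi 0))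
      rwa [zero_rpow (by norm_num), mul_zero, add_zero, mul_zero, mul_zero] at this
    refine squeeze_zero_norm' ?_ hlim
    filter_upwards [self_mem_nhdsWithin] with x (hx : 0 < x)
    have h5 : x ^ (1 / 2 : ℝ) = x * x ^ (-1 / 2 : ℝ) := by
      rw [← rpow_one_add' hx.le (by norm_num)]; norm_num
    have h6 : exp (-x) ≤ 1 := by rw [exp_le_one_iff]; linarith
    have h7 := hC x hx
    simp only [hF, norm_mul, norm_pow, Real.norm_eq_abs, abs_of_pos hx, abs_of_pos (exp_pos _)]
    calc exp (-x) * (x ^ (m + 1) * |log x| ^ j) ≤ 1 * (x ^ (m + 1) *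
          (C * (x ^ (1 / 2 : ℝ) + x ^ (-1 / 2 : ℝ)))) := by gcongr
      _ = x ^ m * (C * (x * x ^ (1 / 2 : ℝ) + x * x ^ (-1 / 2 : ℝ))) := by ring
      _ = _ := by rw [← h5]
  have h := integral_Ioi_of_hasDerivAt_of_tendsto hc hd hF'i htop
  rw [hF0, sub_zero, hF', ← integral_stdExp, integral_sub, integral_add, integral_const_mul,
    integral_const_mul] at h
  · simp only [gmom]
    linarith
  · exact (hI m j).const_mul _
  · exact (hI m (j - 1)).const_mul _
  · exact ((hI m j).const_mul _).add ((hI m (j - 1)).const_mul _)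
  · exact hI (m + 1) j

/-! ### Log-cumulants of Gamma laws and their limit for large shape -/

/-- The logarithmic moments of the Gamma law with shape `N + 1`. -/
def gammaLogMoment (j N : ℕ) : ℝ := gmom N j / N.factorial

lemma gammaLogMoment_zero (N : ℕ) : gammaLogMoment 0 N = 1 := by
  rw [gammaLogMoment, gmom_zero_right, div_self (by positivity)]

lemma gammaLogMoment_succ (j N : ℕ) :
    gammaLogMoment j (N + 1) = gammaLogMoment j N + j / (N + 1) * gammaLogMoment (j - 1) N := by
  have h : (N.factorial : ℝ) ≠ 0 := by positivity
  have h' : (N : ℝ) + 1 ≠ 0 := by positivity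
  simp only [gammaLogMoment, gmom_succ, Nat.factorial_succ, Nat.cast_mul, Nat.cast_add,
    Nat.cast_one]
  field_simp

lemma gammaLogMoment_one (N : ℕ) :
    gammaLogMoment 1 N = gammaLogMoment 1 0 + harmonic N := by
  induction N with
  | zero => simp
  | succ N ih =>
    rw [gammaLogMoment_succ, ih, harmonic_succ]
    simp [gammaLogMoment_zero, add_assoc]

/-- The second cumulant of the logarithm of a Gamma variable. -/
def gammaLogVar (N : ℕ) : ℝ := gammaLogMoment 2 N - gammaLogMoment 1 N ^ 2

/-- The third cumulant of the logarithm of a Gamma variable. -/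
def gammaLogSkew (N : ℕ) : ℝ :=
  gammaLogMoment 3 N - 3 * gammaLogMoment 2 N * gammaLogMoment 1 N + 2 * gammaLogMoment 1 N ^ 3

/-- When the shape grows by one, the lower moments cancel out of the cumulant and only a rational
increment is left: `-1/(N+1)²` here, `2/(N+1)³` for the third cumulant. These are the polygamma
recurrences. -/
lemma gammaLogVar_eq (N : ℕ) :
    gammaLogVar N = gammaLogVar 0 - ∑ i ∈ Finset.range N, 1 / ((i : ℝ) + 1) ^ 2 := by
  induction N with
  | zero => simp
  | succ N ih =>
    rw [Finset.sum_range_succ, ← sub_sub, ← ih]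
    have h' : (N : ℝ) + 1 ≠ 0 := by positivity
    simp only [gammaLogVar, gammaLogMoment_succ]
    norm_num [gammaLogMoment_zero]
    field_simp
    ring

lemma gammaLogSkew_eq (N : ℕ) :
    gammaLogSkew N = gammaLogSkew 0 + 2 * ∑ i ∈ Finset.range N, 1 / ((i : ℝ) + 1) ^ 3 := by
  induction N with
  | zero => simp
  | succ N ih =>
    rw [Finset.sum_range_succ, mul_add, ← add_assoc, ← ih]
    have h' : (N : ℝ) + 1 ≠ 0 := by positivity
    simp only [gammaLogSkew, gammaLogMoment_succ]
    norm_num [gammaLogMoment_zero]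
    field_simp
    ring

/-- Moments of `log (X / N)` for a Gamma variable `X` with shape `N + 1`. -/
def gammaLogMoment' (j N : ℕ) : ℝ :=
  (∫ x, x ^ N * (log x - log N) ^ j ∂stdExp) / N.factorial

lemma integrable_pow_mul_log_sub (m j : ℕ) (c : ℝ) :
    Integrable (fun x => x ^ m * (log x - c) ^ j) stdExp :=
  ((allMoments_id_stdExp.pow m).mul
    ((allMoments_log_stdExp.sub (allMoments_const c)).pow j)).integrable

lemma gammaLogMoment'_one (N : ℕ) : gammaLogMoment' 1 N = gammaLogMoment 1 N - log N := by
  have hI := fun m j => (allMoments_pow_log_pow_stdExp m j).integrable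
  have h : (N.factorial : ℝ) ≠ 0 := by positivity
  have : (fun x : ℝ => x ^ N * (log x - log N) ^ 1) =
      fun x => x ^ N * log x ^ 1 - log N * (x ^ N * log x ^ 0) := by ext; ring
  rw [gammaLogMoment', this, integral_sub (hI _ _) ((hI _ _).const_mul _), integral_const_mul]
  change (gmom N 1 - log N * gmom N 0) / _ = _
  rw [gmom_zero_right, gammaLogMoment]
  field_simp

lemma gammaLogMoment'_two (N : ℕ) : gammaLogMoment' 2 N =
    gammaLogMoment 2 N - 2 * log N * gammaLogMoment 1 N + log N ^ 2 := by
  have hI := fun m j => (allMoments_pow_log_pow_stdExp m j).integrable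
  have h : (N.factorial : ℝ) ≠ 0 := by positivity
  have : (fun x : ℝ => x ^ N * (log x - log N) ^ 2) = fun x => x ^ N * log x ^ 2 +
      (-(2 * log N) * (x ^ N * log x ^ 1) + log N ^ 2 * (x ^ N * log x ^ 0)) := by ext; ring
  rw [gammaLogMoment', this, integral_add (hI _ _), integral_add ((hI _ _).const_mul _)
    ((hI _ _).const_mul _), integral_const_mul, integral_const_mul]
  · change (gmom N 2 + (_ * gmom N 1 + _ * gmom N 0)) / _ = _
    rw [gmom_zero_right, gammaLogMoment, gammaLogMoment]
    field_simp
    ring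
  · exact ((hI _ _).const_mul _).add ((hI _ _).const_mul _)

lemma gammaLogMoment'_three (N : ℕ) : gammaLogMoment' 3 N =
    gammaLogMoment 3 N - 3 * log N * gammaLogMoment 2 N + 3 * log N ^ 2 * gammaLogMoment 1 N
      - log N ^ 3 := by
  have hI := fun m j => (allMoments_pow_log_pow_stdExp m j).integrable
  have h : (N.factorial : ℝ) ≠ 0 := by positivity
  have : (fun x : ℝ => x ^ N * (log x - log N) ^ 3) = fun x =>
      (x ^ N * log x ^ 3 + (-(3 * log N)) * (x ^ N * log x ^ 2)) +
      (3 * log N ^ 2 * (x ^ N * log x ^ 1) + (-log N ^ 3) * (x ^ N * log x ^ 0)) := by ext; ring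
  rw [gammaLogMoment', this, integral_add, integral_add (hI _ _) ((hI _ _).const_mul _),
    integral_add ((hI _ _).const_mul _) ((hI _ _).const_mul _), integral_const_mul,
    integral_const_mul, integral_const_mul]
  · change (gmom N 3 + _ * gmom N 2 + (_ * gmom N 1 + _ * gmom N 0)) / _ = _
    rw [gmom_zero_right, gammaLogMoment, gammaLogMoment, gammaLogMoment]
    field_simp
    ring
  · exact (hI _ _).add ((hI _ _).const_mul _)
  · exact ((hI _ _).const_mul _).add ((hI _ _).const_mul _)

/-- Jensen's inequality, in the form that the variance of `(log (X/N))ʲ` under the Gamma law is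
nonnegative. -/
lemma gammaLogMoment'_sq_le (j N : ℕ) : gammaLogMoment' j N ^ 2 ≤ gammaLogMoment' (2 * j) N := by
  have h : (0 : ℝ) < N.factorial := by positivity
  set c := gammaLogMoment' j N with hc
  have hI := fun j => integrable_pow_mul_log_sub N j (log N)
  have h0 : 0 ≤ ∫ x, x ^ N * ((log x - log N) ^ j - c) ^ 2 ∂stdExp := by
    refine integral_nonneg_of_ae ?_
    filter_upwards [ae_stdExp_pos] with x hx
    simp only [Pi.zero_apply]
    positivity
  have : (fun x : ℝ => x ^ N * ((log x - log N) ^ j - c) ^ 2) = fun x =>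
      x ^ N * (log x - log N) ^ (2 * j) + (-(2 * c) * (x ^ N * (log x - log N) ^ j)
        + c ^ 2 * (x ^ N * (log x - log N) ^ 0)) := by ext; ring
  rw [this, integral_add (hI _), integral_add ((hI _).const_mul _) ((hI _).const_mul _),
    integral_const_mul, integral_const_mul] at h0
  · have h1 : ∫ x, x ^ N * (log x - log N) ^ 0 ∂stdExp = N.factorial := by
      simpa using integral_pow_stdExp N
    have h2 : ∫ x, x ^ N * (log x - log N) ^ j ∂stdExp = c * N.factorial := by
      rw [hc, gammaLogMoment']; field_simp
    rw [h1, h2] at h0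
    rw [gammaLogMoment', le_div_iff₀ h]
    linarith
  · exact ((hI _).const_mul _).add ((hI _).const_mul _)

/-- `log y ≤ y - 1`, applied to `y` and to `1/y` according to the sign of `log y`. The right-hand
side involves only integer powers, whose Gamma moments are factorial ratios. -/
lemma log_pow_four_le {y : ℝ} (hy : 0 < y) : log y ^ 4 ≤ (y - 1) ^ 4 + (1 / y - 1) ^ 4 := by
  have h1 := log_le_sub_one_of_pos hy
  have h2 := log_le_sub_one_of_pos (inv_pos.2 hy)
  rw [log_inv] at h2
  rw [one_div]
  have p1 : 0 ≤ (y - 1) ^ 4 := by positivity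
  have p2 : 0 ≤ (y⁻¹ - 1) ^ 4 := by positivity
  rcases le_total 0 (log y) with h | h
  · have := pow_le_pow_left₀ h h1 4
    linarith
  · have := pow_le_pow_left₀ (neg_nonneg.2 h) h2 4
    rw [Even.neg_pow (by decide)] at this
    linarith

/-- The ratio is `E[(X/N)ⁱ]` for a Gamma variable `X` of shape `N + 1`. -/
lemma tendsto_factorial_ratio (i : ℕ) :
    Tendsto (fun N : ℕ => ((N + i).factorial : ℝ) / (N.factorial * (N : ℝ) ^ i)) atTop (𝓝 1) := by
  induction i with
  | zero =>
    refine tendsto_const_nhds.congr fun N => ?_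
    have : (N.factorial : ℝ) ≠ 0 := by positivity
    simp [this]
  | succ i ih =>
    have h : Tendsto (fun N : ℕ => 1 + ((i : ℝ) + 1) / N) atTop (𝓝 (1 + 0)) :=
      tendsto_const_nhds.add (tendsto_const_div_atTop_nhds_zero_nat _)
    have := ih.mul h
    simp only [add_zero, mul_one] at this
    refine this.congr' ?_
    filter_upwards [eventually_gt_atTop 0] with N hN
    have h1 : (N.factorial : ℝ) ≠ 0 := by positivity
    have h2 : (N : ℝ) ≠ 0 := by positivity
    rw [← add_assoc, Nat.factorial_succ]
    push_cast
    field_simp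
    ring

/-- Put `y = X/N`. By `log_pow_four_le` the fourth moment of `log y` is at most `E(y-1)⁴ +
E(1/y-1)⁴`. All positive and negative integer moments of `y` up to order four tend to `1`, so after
binomial expansion both terms tend to `(1-1)⁴ = 0`. -/
lemma tendsto_gammaLogMoment'_four : Tendsto (gammaLogMoment' 4) atTop (𝓝 0) := by
  set a : ℕ → ℕ → ℝ := fun i N => ((N + i).factorial : ℝ) / (N.factorial * (N : ℝ) ^ i) with ha
  have hat : ∀ i, Tendsto (a i) atTop (𝓝 1) := tendsto_factorial_ratio
  have hr : Tendsto (fun M : ℕ => 1 + (4 : ℝ) / M) atTop (𝓝 1) := by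
    have h : Tendsto (fun M : ℕ => 1 + (4 : ℝ) / M) atTop (𝓝 (1 + 0)) :=
      tendsto_const_nhds.add (tendsto_const_div_atTop_nhds_zero_nat _)
    rwa [add_zero] at h
  -- With `N = M + 4` the weight `x^N` absorbs up to four negative powers, so only natural powers of
  -- `x` are integrated.
  rw [← tendsto_add_atTop_iff_nat 4]
  have hb : Tendsto (fun M => ((((a 4 (M + 4) + -4 * a 3 (M + 4)) + 6 * a 2 (M + 4))
        + -4 * a 1 (M + 4)) + a 0 (M + 4)) +
      (((((a 0 M / a 4 M * (1 + 4 / (M : ℝ)) ^ 4) + -4 * (a 1 M / a 4 M * (1 + 4 / (M : ℝ)) ^ 3))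
        + 6 * (a 2 M / a 4 M * (1 + 4 / (M : ℝ)) ^ 2)) + -4 * (a 3 M / a 4 M * (1 + 4 / (M : ℝ))))
        + a 4 M / a 4 M)) atTop
      (𝓝 (((((1 + -4 * 1) + 6 * 1) + -4 * 1) + 1) +
        ((((1 / 1 * 1 ^ 4 + -4 * (1 / 1 * 1 ^ 3)) + 6 * (1 / 1 * 1 ^ 2)) + -4 * (1 / 1 * 1))
          + 1 / 1))) := by
    have h1 := fun i => (hat i).comp (tendsto_add_atTop_nat 4)
    have h2 := fun i => (hat i).div (hat 4) one_ne_zero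
    exact (((((h1 4).add ((h1 3).const_mul (-4))).add ((h1 2).const_mul 6)).add
      ((h1 1).const_mul (-4))).add (h1 0)).add
      ((((((h2 0).mul (hr.pow 4)).add (((h2 1).mul (hr.pow 3)).const_mul (-4))).add
      (((h2 2).mul (hr.pow 2)).const_mul 6)).add (((h2 3).mul hr).const_mul (-4))).add (h2 4))
  norm_num at hb
  refine squeeze_zero' (Eventually.of_forall fun M => ?_) ?_ hb
  · refine div_nonneg (integral_nonneg_of_ae ?_) (by positivity)
    filter_upwards [ae_stdExp_pos] with x hx
    simp only [Pi.zero_apply]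
    positivity
  filter_upwards [eventually_gt_atTop 0] with M hM
  have hM' : (0 : ℝ) < M := by positivity
  set N := M + 4 with hN
  have hN' : (0 : ℝ) < N := by positivity
  have hNM : (N : ℝ) = M + 4 := by simp [hN]
  have hf : (0 : ℝ) < N.factorial := by positivity
  have hI := fun m => integrable_pow_stdExp m
  have hle : ∫ x, x ^ N * (log x - log N) ^ 4 ∂stdExp ≤ ∫ x,
      (((x ^ (N + 4) / N ^ 4 + -4 / N ^ 3 * x ^ (N + 3)) + (6 / N ^ 2 * x ^ (N + 2)
        + -4 / N * x ^ (N + 1))) + x ^ N) +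
      (((N ^ 4 * x ^ M + -4 * N ^ 3 * x ^ (M + 1)) + (6 * N ^ 2 * x ^ (M + 2)
        + -4 * N * x ^ (M + 3))) + x ^ (M + 4)) ∂stdExp := by
    refine integral_mono_ae (integrable_pow_mul_log_sub _ _ _) ?_ ?_
    · exact ((((((hI _).div_const _).add ((hI _).const_mul _)).add
        (((hI _).const_mul _).add ((hI _).const_mul _))).add (hI _))).add
        (((((hI _).const_mul _).add ((hI _).const_mul _)).add
        (((hI _).const_mul _).add ((hI _).const_mul _))).add (hI _))
    · filter_upwards [ae_stdExp_pos] with x hx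
      have h := log_pow_four_le (div_pos hx hN')
      rw [log_div hx.ne' hN'.ne'] at h
      refine (mul_le_mul_of_nonneg_left h (by positivity)).trans_eq ?_
      have : x ^ N = x ^ M * x ^ 4 := by rw [hN, pow_add]
      simp only [pow_add, this]
      field_simp
      ring
  rw [integral_add, integral_add, integral_add, integral_add, integral_add, integral_add,
    integral_add, integral_add, integral_add] at hle
  rotate_left
  · exact (hI _).const_mul _
  · exact (hI _).const_mul _
  · exact (hI _).const_mul _
  · exact (hI _).const_mul _
  · exact ((hI _).const_mul _).add ((hI _).const_mul _)
  · exact ((hI _).const_mul _).add ((hI _).const_mul _)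
  · exact (((hI _).const_mul _).add ((hI _).const_mul _)).add
      (((hI _).const_mul _).add ((hI _).const_mul _))
  · exact hI _
  · exact (hI _).const_mul _
  · exact (hI _).const_mul _
  · exact (hI _).div_const _
  · exact (hI _).const_mul _
  · exact ((hI _).div_const _).add ((hI _).const_mul _)
  · exact ((hI _).const_mul _).add ((hI _).const_mul _)
  · exact ((((hI _).div_const _).add ((hI _).const_mul _))).add
        (((hI _).const_mul _).add ((hI _).const_mul _))
  · exact (hI _)
  · exact (((((hI _).div_const _).add ((hI _).const_mul _)).add
        (((hI _).const_mul _).add ((hI _).const_mul _))).add (hI _))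
  · exact (((((hI _).const_mul _).add ((hI _).const_mul _)).add
        (((hI _).const_mul _).add ((hI _).const_mul _))).add (hI _))
  simp only [integral_const_mul, integral_div, integral_pow_stdExp] at hle
  rw [gammaLogMoment', div_le_iff₀ hf]
  refine hle.trans_eq ?_
  have hMf : (M.factorial : ℝ) ≠ 0 := by positivity
  have e4 : (N.factorial : ℝ) = (M + 4).factorial := by rw [hN]
  have ef : ((M + 4).factorial : ℝ) ≠ 0 := by positivity
  have hq : (1 : ℝ) + 4 / M = N / M := by rw [hNM]; field_simp
  simp only [ha, hq, e4, add_zero]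
  field_simp
  ring

lemma tendsto_zero_of_sq_le {a b : ℕ → ℝ} (h : ∀ N, a N ^ 2 ≤ b N)
    (hb : Tendsto b atTop (𝓝 0)) : Tendsto a atTop (𝓝 0) := by
  have hs := (continuous_sqrt.tendsto 0).comp hb
  rw [sqrt_zero] at hs
  exact squeeze_zero_norm (fun N => abs_le_sqrt (h N)) hs

lemma tendsto_gammaLogMoment'_two : Tendsto (gammaLogMoment' 2) atTop (𝓝 0) := by
  exact tendsto_zero_of_sq_le (gammaLogMoment'_sq_le 2) tendsto_gammaLogMoment'_four

lemma tendsto_gammaLogMoment'_one : Tendsto (gammaLogMoment' 1) atTop (𝓝 0) := by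
  exact tendsto_zero_of_sq_le (gammaLogMoment'_sq_le 1) tendsto_gammaLogMoment'_two

/-- Jensen would call for a sixth moment; `|y|³ ≤ y² + y⁴` needs only those at hand. -/
lemma tendsto_gammaLogMoment'_three : Tendsto (gammaLogMoment' 3) atTop (𝓝 0) := by
  have h := tendsto_gammaLogMoment'_two.add tendsto_gammaLogMoment'_four
  rw [add_zero] at h
  refine squeeze_zero_norm (fun N => ?_) h
  have hf : (0 : ℝ) < N.factorial := by positivity
  have hI := fun j => integrable_pow_mul_log_sub N j (log N)
  simp only [gammaLogMoment', norm_div, Real.norm_eq_abs, Nat.abs_cast, ← add_div]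
  gcongr
  rw [← integral_add (hI _) (hI _)]
  refine (abs_integral_le_integral_abs).trans (integral_mono_ae (hI 3).abs
    ((hI 2).add (hI 4)) ?_)
  filter_upwards [ae_stdExp_pos] with x hx
  have hx' : 0 < x ^ N := by positivity
  set y := log x - log N
  simp only [abs_mul, abs_of_pos hx', abs_pow, ← mul_add]
  gcongr
  rw [← sq_abs y, ← (by decide : Even 4).pow_abs y]
  nlinarith [sq_nonneg (|y| ^ 2 - |y|), sq_nonneg |y|, sq_nonneg (|y| ^ 2)]

/-- Cumulants of order at least two ignore the shift by `log N`, so they may be computed from the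
moments of `log (X/N)`, which all tend to zero. -/
lemma tendsto_gammaLogVar : Tendsto gammaLogVar atTop (𝓝 0) := by
  have h := tendsto_gammaLogMoment'_two.sub (tendsto_gammaLogMoment'_one.pow 2)
  simp only [ne_eq, OfNat.ofNat_ne_zero, not_false_eq_true, zero_pow, sub_zero] at h
  refine h.congr fun N => ?_
  rw [gammaLogMoment'_two, gammaLogMoment'_one, gammaLogVar]
  ring

lemma tendsto_gammaLogSkew : Tendsto gammaLogSkew atTop (𝓝 0) := by
  have h := (tendsto_gammaLogMoment'_three.sub
    ((tendsto_gammaLogMoment'_two.const_mul 3).mul tendsto_gammaLogMoment'_one)).add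
    ((tendsto_gammaLogMoment'_one.pow 3).const_mul 2)
  norm_num at h
  refine h.congr fun N => ?_
  rw [gammaLogMoment'_three, gammaLogMoment'_two, gammaLogMoment'_one, gammaLogSkew]
  ring

/-! ### Zeta values and the logarithmic moments of the exponential law -/

lemma hasSum_apery : HasSum (fun n : ℕ => 1 / ((n : ℝ) + 1) ^ 3) apery := by
  have hs : Summable (fun n : ℕ => 1 / (n : ℝ) ^ 3) :=
    summable_one_div_nat_pow.2 (by norm_num)
  have h : apery = ∑' n : ℕ, 1 / (n : ℝ) ^ 3 := by
    have := zeta_nat_eq_tsum_of_gt_one (k := 3) (by norm_num)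
    rw [apery]
    push_cast at this
    rw [this, ← Complex.ofReal_re (∑' n : ℕ, 1 / (n : ℝ) ^ 3)]
    push_cast
    rfl
  have h2 := (hasSum_nat_add_iff' 1).2 hs.hasSum
  simp only [Finset.range_one, Finset.sum_singleton, ← h] at h2
  simpa using h2

lemma hasSum_inv_sq : HasSum (fun n : ℕ => 1 / ((n : ℝ) + 1) ^ 2) (π ^ 2 / 6) := by
  have h2 := (hasSum_nat_add_iff' 1).2 hasSum_zeta_two
  simpa using h2

lemma apery_le : apery ≤ π ^ 2 / 6 := by
  refine hasSum_le (fun n => ?_) hasSum_apery hasSum_inv_sq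
  gcongr <;> linarith [(Nat.cast_nonneg n : (0 : ℝ) ≤ n)]

/-- The increments telescope and the cumulant tends to zero, so its initial value is the sum of the
whole series. -/
lemma gammaLogVar_zero : gammaLogVar 0 = π ^ 2 / 6 := by
  refine tendsto_nhds_unique ?_ hasSum_inv_sq.tendsto_sum_nat
  have h := tendsto_gammaLogVar.const_sub (gammaLogVar 0)
  rw [sub_zero] at h
  refine h.congr fun N => ?_
  rw [gammaLogVar_eq N]; ring

lemma gammaLogSkew_zero : gammaLogSkew 0 = -2 * apery := by
  refine tendsto_nhds_unique ?_ (hasSum_apery.tendsto_sum_nat.const_mul (-2))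
  have h := tendsto_gammaLogSkew.const_sub (gammaLogSkew 0)
  rw [sub_zero] at h
  refine h.congr fun N => ?_
  rw [gammaLogSkew_eq N]; ring

lemma gmom_zero_zero : gmom 0 0 = 1 := by simp [gmom_zero_right]

/-- The mean of `log X` at shape `N + 1` is the initial mean plus the harmonic number, and it
differs from `log N` by `o(1)`; hence the initial mean is minus the limit of `H_N - log N`. -/
lemma gmom_zero_one : gmom 0 1 = -eulerMascheroniConstant := by
  have h0 : gammaLogMoment 1 0 = gmom 0 1 := by simp [gammaLogMoment]
  have h := tendsto_gammaLogMoment'_one.sub tendsto_harmonic_sub_log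
  refine tendsto_nhds_unique (tendsto_const_nhds.congr fun N => ?_) (h.trans_eq ?_)
  · rw [gammaLogMoment'_one, gammaLogMoment_one, h0]; ring
  · rw [zero_sub]

lemma gmom_zero_two : gmom 0 2 = eulerMascheroniConstant ^ 2 + π ^ 2 / 6 := by
  have h := gammaLogVar_zero
  simp only [gammaLogVar, gammaLogMoment, Nat.factorial_zero, Nat.cast_one, div_one,
    gmom_zero_one] at h
  linarith

lemma gmom_zero_three : gmom 0 3 = -(eulerMascheroniConstant ^ 3 +
    eulerMascheroniConstant * π ^ 2 / 2 + 2 * apery) := by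
  have h := gammaLogSkew_zero
  simp only [gammaLogSkew, gammaLogMoment, Nat.factorial_zero, Nat.cast_one, div_one,
    gmom_zero_one, gmom_zero_two] at h
  linarith

/-! ### The Weibull law as a transform of the standard exponential law -/

/-- The map `x ↦ (x / λ)ᵏ`, which turns a Weibull variable into a standard exponential one. -/
def weibullStd (θ : Fin 2 → ℝ) (x : ℝ) : ℝ := (x / θ 1) ^ θ 0

@[fun_prop]
lemma measurable_weibullStd (θ : Fin 2 → ℝ) : Measurable (weibullStd θ) := by
  unfold weibullStd
  fun_prop

lemma measurable_weibullPDF (θ : Fin 2 → ℝ) : Measurable (weibullPDF θ) := by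
  unfold weibullPDF
  exact Measurable.ite measurableSet_Ioi (by fun_prop) measurable_const

variable {θ : Fin 2 → ℝ}

lemma weibullStd_pos (hθ : θ ∈ weibullParams) {x : ℝ} (hx : 0 < x) : 0 < weibullStd θ x :=
  rpow_pos_of_pos (div_pos hx hθ.2) _

lemma log_weibullStd (hθ : θ ∈ weibullParams) {x : ℝ} (hx : 0 < x) :
    log (weibullStd θ x) = θ 0 * (log x - log (θ 1)) := by
  rw [weibullStd, log_rpow (div_pos hx hθ.2), log_div hx.ne' hθ.2.ne']

/-- The Weibull density is the derivative of the increasing map `x ↦ (x/λ)^k` times `e^{-(x/λ)^k}`: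
exactly the change-of-variables formula for the exponential density. -/
lemma measurePreserving_weibullStd (hθ : θ ∈ weibullParams) :
    MeasurePreserving (weibullStd θ) (obsLaw weibullPDF θ) stdExp := by
  obtain ⟨hk, hl⟩ := hθ
  have hmeas := measurable_weibullStd θ
  refine ⟨hmeas, Measure.ext fun s hs => ?_⟩
  rw [Measure.map_apply hmeas hs, obsLaw, withDensity_apply _ (hmeas hs), stdExp,
    withDensity_apply _ hs, Measure.restrict_restrict hs]
  have himg : weibullStd θ '' (Ioi 0 ∩ weibullStd θ ⁻¹' s) = s ∩ Ioi 0 := by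
    ext y
    constructor
    · rintro ⟨x, ⟨hx, hxs⟩, rfl⟩
      exact ⟨hxs, rpow_pos_of_pos (div_pos hx hl) _⟩
    · rintro ⟨hys, hy⟩
      have hy' : weibullStd θ (θ 1 * y ^ (1 / θ 0)) = y := by
        rw [weibullStd, mul_div_cancel_left₀ _ hl.ne', ← rpow_mul (le_of_lt hy),
          one_div_mul_cancel hk.ne', rpow_one]
      exact ⟨θ 1 * y ^ (1 / θ 0), ⟨mul_pos hl (rpow_pos_of_pos hy _), by rwa [mem_preimage, hy']⟩,
        hy'⟩
  have hinj : InjOn (weibullStd θ) (Ioi 0 ∩ weibullStd θ ⁻¹' s) := by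
    rintro x ⟨hx, -⟩ y ⟨hy, -⟩ hxy
    have := (rpow_left_inj (div_pos hx hl).le (div_pos hy hl).le hk.ne').1 hxy
    field_simp at this
    exact this
  have hder : ∀ x ∈ Ioi 0 ∩ weibullStd θ ⁻¹' s, HasDerivWithinAt (weibullStd θ)
      (θ 0 / θ 1 * (x / θ 1) ^ (θ 0 - 1)) (Ioi 0 ∩ weibullStd θ ⁻¹' s) x := by
    rintro x ⟨hx, -⟩
    have h := (((hasDerivAt_id x).div_const (θ 1)).rpow_const (p := θ 0)
      (Or.inl (div_pos hx hl).ne'))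
    refine (h.congr_deriv ?_).hasDerivWithinAt
    simp only [id]
    ring
  rw [← himg, lintegral_image_eq_lintegral_abs_deriv_mul
    (measurableSet_Ioi.inter (hmeas hs)) hder hinj]
  have hpdf : ∀ x, ENNReal.ofReal (weibullPDF θ x) = (Ioi 0).indicator (fun x => ENNReal.ofReal
      |θ 0 / θ 1 * (x / θ 1) ^ (θ 0 - 1)| * ENNReal.ofReal (exp (-weibullStd θ x))) x := by
    intro x
    by_cases hx : 0 < x
    · have h0 : 0 ≤ θ 0 / θ 1 * (x / θ 1) ^ (θ 0 - 1) :=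
        mul_nonneg (div_pos hk hl).le (rpow_nonneg (div_pos hx hl).le _)
      rw [indicator_of_mem (mem_Ioi.2 hx), abs_of_nonneg h0, ← ENNReal.ofReal_mul h0, weibullPDF,
        if_pos hx, weibullStd]
    · rw [indicator_of_notMem (by simpa using hx), weibullPDF, if_neg hx, ENNReal.ofReal_zero]
  simp_rw [hpdf]
  rw [lintegral_indicator measurableSet_Ioi, Measure.restrict_restrict measurableSet_Ioi]

lemma isProbabilityMeasure_weibull (hθ : θ ∈ weibullParams) :
    IsProbabilityMeasure (obsLaw weibullPDF θ) := by
  have h := measurePreserving_weibullStd hθ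
  exact ⟨by rw [← preimage_univ (f := weibullStd θ), h.measure_preimage nullMeasurableSet_univ,
    measure_univ]⟩

lemma ae_weibull_pos : ∀ᵐ x ∂(obsLaw weibullPDF θ), 0 < x := by
  rw [obsLaw, ae_withDensity_iff (measurable_weibullPDF θ).ennreal_ofReal]
  refine Eventually.of_forall fun x hx => ?_
  by_contra h
  simp [weibullPDF, h] at hx

lemma integral_comp_weibullStd (hθ : θ ∈ weibullParams) {f : ℝ → ℝ}
    (hf : AEStronglyMeasurable f stdExp) :
    ∫ x, f (weibullStd θ x) ∂(obsLaw weibullPDF θ) = ∫ x, f x ∂stdExp := by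
  have h := measurePreserving_weibullStd hθ
  rw [← h.map_eq, integral_map h.aemeasurable (h.map_eq.symm ▸ hf)]

lemma integrable_poly_stdExp (c : Fin 3 → Fin 4 → ℝ) :
    Integrable (fun x => ∑ m, ∑ j, c m j * (x ^ (m : ℕ) * log x ^ (j : ℕ))) stdExp :=
  integrable_finsetSum _ fun _ _ => integrable_finsetSum _ fun _ _ =>
    (allMoments_pow_log_pow_stdExp _ _).integrable.const_mul _

lemma integral_poly_stdExp (c : Fin 3 → Fin 4 → ℝ) :
    ∫ x, ∑ m, ∑ j, c m j * (x ^ (m : ℕ) * log x ^ (j : ℕ)) ∂stdExp = ∑ m, ∑ j, c m j * gmom m j := by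
  have hI : ∀ m j : ℕ, ∀ c : ℝ, Integrable (fun x => c * (x ^ m * log x ^ j)) stdExp :=
    fun m j c => (allMoments_pow_log_pow_stdExp m j).integrable.const_mul c
  rw [integral_finsetSum _ fun m _ => integrable_finsetSum _ fun j _ => hI _ _ _]
  refine Finset.sum_congr rfl fun m _ => ?_
  rw [integral_finsetSum _ fun j _ => hI _ _ _]
  refine Finset.sum_congr rfl fun j _ => ?_
  rw [integral_const_mul, gmom]

/-- The degrees suffice for everything below: products of two scores have degree at most two in the
standardised variable, and third derivatives of the log-density have degree at most three in its
logarithm. -/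
lemma weibull_expect (hθ : θ ∈ weibullParams) (c : Fin 3 → Fin 4 → ℝ) {f : ℝ → ℝ}
    (hf : ∀ x, 0 < x → f x =
      ∑ m, ∑ j, c m j * (weibullStd θ x ^ (m : ℕ) * log (weibullStd θ x) ^ (j : ℕ))) :
    Integrable f (obsLaw weibullPDF θ) ∧
      ∫ x, f x ∂(obsLaw weibullPDF θ) = ∑ m, ∑ j, c m j * gmom m j := by
  have hi := integrable_poly_stdExp c
  have hae : (fun x => ∑ m, ∑ j, c m j *
      (weibullStd θ x ^ ((m : Fin 3) : ℕ) * log (weibullStd θ x) ^ ((j : Fin 4) : ℕ)))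
      =ᵐ[obsLaw weibullPDF θ] f := by
    filter_upwards [ae_weibull_pos] with x hx using (hf x hx).symm
  constructor
  · exact ((measurePreserving_weibullStd hθ).integrable_comp_of_integrable hi).congr hae
  · rw [← integral_congr_ae hae, ← integral_poly_stdExp]
    exact integral_comp_weibullStd hθ hi.1

lemma gmom_table :
    gmom 0 0 = 1 ∧ gmom 0 1 = -eulerMascheroniConstant ∧
    gmom 0 2 = eulerMascheroniConstant ^ 2 + π ^ 2 / 6 ∧
    gmom 1 0 = 1 ∧ gmom 1 1 = 1 - eulerMascheroniConstant ∧
    gmom 1 2 = eulerMascheroniConstant ^ 2 + π ^ 2 / 6 - 2 * eulerMascheroniConstant ∧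
    gmom 1 3 = 3 * (eulerMascheroniConstant ^ 2 + π ^ 2 / 6) - (eulerMascheroniConstant ^ 3 +
      eulerMascheroniConstant * π ^ 2 / 2 + 2 * apery) ∧
    gmom 2 0 = 2 ∧ gmom 2 1 = 3 - 2 * eulerMascheroniConstant ∧
    gmom 2 2 = 2 * (eulerMascheroniConstant ^ 2 + π ^ 2 / 6 - 2 * eulerMascheroniConstant)
      + 2 * (1 - eulerMascheroniConstant) ∧
    gmom 2 3 = 2 * (3 * (eulerMascheroniConstant ^ 2 + π ^ 2 / 6) - (eulerMascheroniConstant ^ 3 +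
      eulerMascheroniConstant * π ^ 2 / 2 + 2 * apery)) +
      3 * (eulerMascheroniConstant ^ 2 + π ^ 2 / 6 - 2 * eulerMascheroniConstant) := by
  have h0 := gmom_zero_zero
  have h1 := gmom_zero_one
  have h2 := gmom_zero_two
  have h3 := gmom_zero_three
  have a0 := gmom_succ 0 0
  have a1 := gmom_succ 0 1
  have a2 := gmom_succ 0 2
  have a3 := gmom_succ 0 3
  have b0 := gmom_succ 1 0
  have b1 := gmom_succ 1 1
  have b2 := gmom_succ 1 2
  have b3 := gmom_succ 1 3
  norm_num at a0 a1 a2 a3 b0 b1 b2 b3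
  refine ⟨h0, h1, h2, ?_, ?_, ?_, ?_, ?_, ?_, ?_, ?_⟩ <;> linarith

/-! ### Partial derivatives on the Weibull parameter space -/

lemma update_zero_mem (hθ : θ ∈ weibullParams) {t : ℝ} (ht : 0 < t) :
    Function.update θ 0 t ∈ weibullParams := ⟨by simpa using ht, by simpa using hθ.2⟩

lemma update_one_mem (hθ : θ ∈ weibullParams) {t : ℝ} (ht : 0 < t) :
    Function.update θ 1 t ∈ weibullParams := ⟨by simpa using hθ.1, by simpa using ht⟩

/-- The closed formula `F` is only required on the parameter space. Since that set is open in each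
coordinate, the derivative does not see the default values outside it. -/
lemma partialDeriv_zero_eq (hθ : θ ∈ weibullParams) {f : (Fin 2 → ℝ) → ℝ} {F : ℝ → ℝ → ℝ} {d : ℝ}
    (hf : ∀ τ ∈ weibullParams, f τ = F (τ 0) (τ 1))
    (hF : HasDerivAt (fun t => F t (θ 1)) d (θ 0)) : partialDeriv 0 f θ = d := by
  rw [partialDeriv, ← hF.deriv]
  refine EventuallyEq.deriv_eq ?_
  filter_upwards [Ioi_mem_nhds hθ.1] with t ht
  rw [hf _ (update_zero_mem hθ ht)]
  simp

lemma partialDeriv_one_eq (hθ : θ ∈ weibullParams) {f : (Fin 2 → ℝ) → ℝ} {F : ℝ → ℝ → ℝ} {d : ℝ}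
    (hf : ∀ τ ∈ weibullParams, f τ = F (τ 0) (τ 1))
    (hF : HasDerivAt (fun t => F (θ 0) t) d (θ 1)) : partialDeriv 1 f θ = d := by
  rw [partialDeriv, ← hF.deriv]
  refine EventuallyEq.deriv_eq ?_
  filter_upwards [Ioi_mem_nhds hθ.2] with t ht
  rw [hf _ (update_one_mem hθ ht)]
  simp

/-- The Weibull log-density as a function of shape, scale and log-observation. -/
def weibullLog (k l y : ℝ) : ℝ :=
  log k - log l + (k - 1) * (y - log l) - exp (k * (y - log l))

/-- First-order partial derivatives of `weibullLog`. -/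
def weibullLog₁ (i : Fin 2) (k l y : ℝ) : ℝ :=
  ![1 / k + (y - log l) - (y - log l) * exp (k * (y - log l)),
    (k * exp (k * (y - log l)) - k) / l] i

/-- Second-order partial derivatives of `weibullLog`. -/
def weibullLog₂ (i j : Fin 2) (k l y : ℝ) : ℝ :=
  ![![-1 / k ^ 2 - (y - log l) ^ 2 * exp (k * (y - log l)),
      (-1 + exp (k * (y - log l)) + k * (y - log l) * exp (k * (y - log l))) / l],
    ![(-1 + exp (k * (y - log l)) + k * (y - log l) * exp (k * (y - log l))) / l,
      (k - k * exp (k * (y - log l)) - k ^ 2 * exp (k * (y - log l))) / l ^ 2]] i j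

/-- Third-order partial derivatives of `weibullLog`. -/
def weibullLog₃ (i j h : Fin 2) (k l y : ℝ) : ℝ :=
  let a := 2 / k ^ 3 - (y - log l) ^ 3 * exp (k * (y - log l))
  let b := (2 * (y - log l) * exp (k * (y - log l)) +
    k * (y - log l) ^ 2 * exp (k * (y - log l))) / l
  let c := (1 - exp (k * (y - log l)) - k * (y - log l) * exp (k * (y - log l))
    - 2 * k * exp (k * (y - log l)) - k ^ 2 * (y - log l) * exp (k * (y - log l))) / l ^ 2
  let d := (-2 * k + (2 * k + 3 * k ^ 2 + k ^ 3) * exp (k * (y - log l))) / l ^ 3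
  ![![![a, b], ![b, c]], ![![b, c], ![c, d]]] i j h

section Derivatives

variable {k l : ℝ} (y : ℝ)

lemma hasDerivAt_exp_shape (c : ℝ) : HasDerivAt (fun t => exp (t * c)) (c * exp (k * c)) k := by
  have h := ((hasDerivAt_id k).mul_const c).exp
  simpa [mul_comm] using h

lemma hasDerivAt_sub_log (hl : 0 < l) : HasDerivAt (fun t => y - log t) (-(1 / l)) l := by
  simpa using (hasDerivAt_log hl.ne').const_sub y

lemma hasDerivAt_exp_scale (hl : 0 < l) : HasDerivAt (fun t => exp (k * (y - log t)))
    (-(k / l) * exp (k * (y - log l))) l := by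
  refine ((hasDerivAt_sub_log y hl).const_mul k).exp.congr_deriv ?_
  ring

lemma hasDerivAt_weibullLog_shape (hk : 0 < k) :
    HasDerivAt (fun t => weibullLog t l y) (weibullLog₁ 0 k l y) k := by
  refine ((((hasDerivAt_log hk.ne').sub_const (log l)).add
    (((hasDerivAt_id k).sub_const 1).mul_const (y - log l))).sub
    (hasDerivAt_exp_shape (y - log l))).congr_deriv ?_
  simp [weibullLog₁]

lemma hasDerivAt_weibullLog_scale (hl : 0 < l) :
    HasDerivAt (fun t => weibullLog k t y) (weibullLog₁ 1 k l y) l := by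
  refine ((((hasDerivAt_log hl.ne').const_sub (log k)).add
    ((hasDerivAt_sub_log y hl).const_mul (k - 1))).sub
    (hasDerivAt_exp_scale y hl)).congr_deriv ?_
  simp [weibullLog₁]
  field_simp
  ring

lemma hasDerivAt_weibullLog₁_shape (hk : 0 < k) (j : Fin 2) :
    HasDerivAt (fun t => weibullLog₁ j t l y) (weibullLog₂ 0 j k l y) k := by
  have hE := hasDerivAt_exp_shape (k := k) (y - log l)
  have hi := hasDerivAt_id k
  fin_cases j
  · refine ((((hasDerivAt_inv hk.ne').add_const (y - log l)).sub
      (hE.const_mul (y - log l))).congr_of_eventuallyEq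
        (Eventually.of_forall fun t => ?_)).congr_deriv ?_
    · simp [weibullLog₁]
    · simp [weibullLog₂]
      field_simp
  · refine ((((hi.mul hE).sub hi).div_const l).congr_of_eventuallyEq
        (Eventually.of_forall fun t => ?_)).congr_deriv ?_
    · simp [weibullLog₁]
    · simp [weibullLog₂]
      ring

lemma hasDerivAt_weibullLog₁_scale (hl : 0 < l) (j : Fin 2) :
    HasDerivAt (fun t => weibullLog₁ j k t y) (weibullLog₂ 1 j k l y) l := by
  have hE := hasDerivAt_exp_scale (k := k) y hl
  have hu := hasDerivAt_sub_log y hl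
  have hi := hasDerivAt_id l
  fin_cases j
  · refine (((hu.const_add (1 / k)).sub (hu.mul hE)).congr_of_eventuallyEq
        (Eventually.of_forall fun t => ?_)).congr_deriv ?_
    · simp [weibullLog₁]
    · simp [weibullLog₂]
      field_simp
      ring
  · refine ((((hE.const_mul k).sub_const k).div hi hl.ne').congr_of_eventuallyEq
        (Eventually.of_forall fun t => ?_)).congr_deriv ?_
    · simp [weibullLog₁]
    · simp [weibullLog₂]
      field_simp
      ring

lemma hasDerivAt_weibullLog₂_shape (hk : 0 < k) (i j : Fin 2) :
    HasDerivAt (fun t => weibullLog₂ i j t l y) (weibullLog₃ 0 i j k l y) k := by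
  have hE := hasDerivAt_exp_shape (k := k) (y - log l)
  have hi := hasDerivAt_id k
  have hm : HasDerivAt (fun t => (-1 + exp (t * (y - log l)) + t * (y - log l) *
      exp (t * (y - log l))) / l) (weibullLog₃ 0 0 1 k l y) k := by
    refine (((hE.const_add (-1)).add ((hi.mul_const (y - log l)).mul hE)).div_const
      l).congr_deriv ?_
    simp [weibullLog₃]
    ring
  fin_cases i <;> fin_cases j
  · refine ((((hi.pow 2).inv (by simpa using hk.ne')).const_mul (-1)).sub
      (hE.const_mul ((y - log l) ^ 2))).congr_of_eventuallyEq
        (Eventually.of_forall fun t => ?_) |>.congr_deriv ?_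
    · simp [weibullLog₂, div_eq_mul_inv]
    · simp [weibullLog₃]
      field_simp
      try ring
  · simpa [weibullLog₂, weibullLog₃] using hm
  · simpa [weibullLog₂, weibullLog₃] using hm
  · refine (((hi.sub (hi.mul hE)).sub ((hi.pow 2).mul hE)).div_const
      (l ^ 2)).congr_of_eventuallyEq (Eventually.of_forall fun t => ?_) |>.congr_deriv ?_
    · simp [weibullLog₂]
    · simp [weibullLog₃]
      ring

lemma hasDerivAt_weibullLog₂_scale (hl : 0 < l) (i j : Fin 2) :
    HasDerivAt (fun t => weibullLog₂ i j k t y) (weibullLog₃ 1 i j k l y) l := by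
  have hE := hasDerivAt_exp_scale (k := k) y hl
  have hu := hasDerivAt_sub_log y hl
  have hi := hasDerivAt_id l
  have hm : HasDerivAt (fun t => (-1 + exp (k * (y - log t)) + k * (y - log t) *
      exp (k * (y - log t))) / t) (weibullLog₃ 1 0 1 k l y) l := by
    refine (((hE.const_add (-1)).add ((hu.const_mul k).mul hE)).div hi hl.ne').congr_deriv ?_
    simp [weibullLog₃]
    field_simp
    ring
  fin_cases i <;> fin_cases j
  · refine (((hu.pow 2).mul hE).const_sub (-1 / k ^ 2)).congr_of_eventuallyEq
        (Eventually.of_forall fun t => ?_) |>.congr_deriv ?_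
    · simp [weibullLog₂]
    · simp [weibullLog₃]
      field_simp
      ring
  · simpa [weibullLog₂, weibullLog₃] using hm
  · simpa [weibullLog₂, weibullLog₃] using hm
  · refine (((hE.const_mul k).const_sub k).sub (hE.const_mul (k ^ 2))).div (hi.pow 2)
      (by simpa using hl.ne') |>.congr_of_eventuallyEq (Eventually.of_forall fun t => ?_)
      |>.congr_deriv ?_
    · simp [weibullLog₂]
    · simp [weibullLog₃]
      field_simp
      ring

end Derivatives

lemma log_weibullPDF (hθ : θ ∈ weibullParams) {x : ℝ} (hx : 0 < x) :
    log (weibullPDF θ x) = weibullLog (θ 0) (θ 1) (log x) := by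
  obtain ⟨hk, hl⟩ := hθ
  have hq : 0 < x / θ 1 := div_pos hx hl
  rw [weibullPDF, if_pos hx, log_mul (mul_pos (div_pos hk hl) (rpow_pos_of_pos hq _)).ne'
    (exp_pos _).ne', log_mul (div_pos hk hl).ne' (rpow_pos_of_pos hq _).ne', log_exp,
    log_rpow hq, log_div hk.ne' hl.ne', rpow_def_of_pos hq, log_div hx.ne' hl.ne', weibullLog,
    mul_comm (θ 0)]
  ring

variable {θ : Fin 2 → ℝ}

lemma partialDeriv_log_weibullPDF (hθ : θ ∈ weibullParams) {x : ℝ} (hx : 0 < x) (i : Fin 2) :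
    partialDeriv i (fun τ => log (weibullPDF τ x)) θ = weibullLog₁ i (θ 0) (θ 1) (log x) := by
  have h : ∀ τ ∈ weibullParams, log (weibullPDF τ x) = weibullLog (τ 0) (τ 1) (log x) :=
    fun τ hτ => log_weibullPDF hτ hx
  fin_cases i
  · exact partialDeriv_zero_eq hθ (F := fun k l => weibullLog k l (log x)) h
      (hasDerivAt_weibullLog_shape _ hθ.1)
  · exact partialDeriv_one_eq hθ (F := fun k l => weibullLog k l (log x)) h
      (hasDerivAt_weibullLog_scale _ hθ.2)

lemma sub_log_eq (hθ : θ ∈ weibullParams) {x : ℝ} (hx : 0 < x) :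
    log x - log (θ 1) = log (weibullStd θ x) / θ 0 := by
  rw [log_weibullStd hθ hx, mul_div_cancel_left₀ _ hθ.1.ne']

lemma exp_mul_sub_log_eq (hθ : θ ∈ weibullParams) {x : ℝ} (hx : 0 < x) :
    exp (θ 0 * (log x - log (θ 1))) = weibullStd θ x := by
  rw [← log_weibullStd hθ hx, exp_log (weibullStd_pos hθ hx)]

lemma exp_mul_log_div_eq (hθ : θ ∈ weibullParams) {x : ℝ} (hx : 0 < x) :
    exp (θ 0 * (log (weibullStd θ x) / θ 0)) = weibullStd θ x := by
  rw [← sub_log_eq hθ hx, exp_mul_sub_log_eq hθ hx]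

/-- The Weibull information matrix. -/
def weibullInfo (θ : Fin 2 → ℝ) : Matrix (Fin 2) (Fin 2) ℝ :=
  !![(6 * (eulerMascheroniConstant - 1) ^ 2 + π ^ 2) / (6 * θ 0 ^ 2),
      (eulerMascheroniConstant - 1) / θ 1;
    (eulerMascheroniConstant - 1) / θ 1, θ 0 ^ 2 / θ 1 ^ 2]

lemma fisherInfo_weibull (hθ : θ ∈ weibullParams) : fisherInfo weibullPDF θ = weibullInfo θ := by
  obtain ⟨g00, g01, g02, g10, g11, g12, g13, g20, g21, g22, g23⟩ := gmom_table
  have hk : θ 0 ≠ 0 := hθ.1.ne'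
  have hl : θ 1 ≠ 0 := hθ.2.ne'
  have key : ∀ i j : Fin 2, fisherInfo weibullPDF θ i j =
      ∫ x, weibullLog₁ i (θ 0) (θ 1) (log x) * weibullLog₁ j (θ 0) (θ 1) (log x)
        ∂(obsLaw weibullPDF θ) := by
    intro i j
    rw [fisherInfo, Matrix.of_apply]
    refine integral_congr_ae ?_
    filter_upwards [ae_weibull_pos] with x hx
    rw [partialDeriv_log_weibullPDF hθ hx, partialDeriv_log_weibullPDF hθ hx]
  have h01 : ∫ x, weibullLog₁ 0 (θ 0) (θ 1) (log x) * weibullLog₁ 1 (θ 0) (θ 1) (log x)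
        ∂(obsLaw weibullPDF θ) = (eulerMascheroniConstant - 1) / θ 1 := by
    -- Row `m`, column `j` holds the coefficient of `vᵐ (log v)ʲ` in the product of the scores,
    -- where `v` is the standardised observation.
    rw [(weibull_expect hθ ![![-1 / θ 1, -1 / θ 1, 0, 0], ![1 / θ 1, 2 / θ 1, 0, 0],
      ![0, -1 / θ 1, 0, 0]] fun x hx => ?_).2]
    · simp [Fin.sum_univ_succ, g00, g01, g02, g10, g11, g12, g13, g20, g21, g22, g23]
      field_simp
      ring
    · simp [weibullLog₁, exp_mul_log_div_eq hθ hx, sub_log_eq hθ hx, Fin.sum_univ_succ]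
      field_simp
      ring
  ext i j
  rw [key]
  fin_cases i <;> fin_cases j
  · simp only [Fin.zero_eta]
    rw [(weibull_expect hθ ![![1 / θ 0 ^ 2, 2 / θ 0 ^ 2, 1 / θ 0 ^ 2, 0],
      ![0, -2 / θ 0 ^ 2, -2 / θ 0 ^ 2, 0],
      ![0, 0, 1 / θ 0 ^ 2, 0]] fun x hx => ?_).2]
    · simp [Fin.sum_univ_succ, weibullInfo, g00, g01, g02, g10, g11, g12, g13, g20, g21, g22, g23]
      field_simp
      ring
    · simp [weibullLog₁, exp_mul_log_div_eq hθ hx, sub_log_eq hθ hx, Fin.sum_univ_succ]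
      field_simp
      ring
  · simpa [weibullInfo] using h01
  · simpa [weibullInfo, mul_comm] using h01
  · simp only [Fin.mk_one]
    rw [(weibull_expect hθ ![![θ 0 ^ 2 / θ 1 ^ 2, 0, 0, 0], ![-2 * θ 0 ^ 2 / θ 1 ^ 2, 0, 0, 0],
      ![θ 0 ^ 2 / θ 1 ^ 2, 0, 0, 0]] fun x hx => ?_).2]
    · simp [Fin.sum_univ_succ, weibullInfo, g00, g01, g02, g10, g11, g12, g13, g20, g21, g22, g23]
      field_simp
      ring
    · simp [weibullLog₁, exp_mul_sub_log_eq hθ hx, Fin.sum_univ_succ]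
      field_simp
      ring

lemma det_weibullInfo (hθ : θ ∈ weibullParams) :
    (weibullInfo θ).det = π ^ 2 / (6 * θ 1 ^ 2) := by
  have hk : θ 0 ≠ 0 := hθ.1.ne'
  have hl : θ 1 ≠ 0 := hθ.2.ne'
  simp [weibullInfo, Matrix.det_fin_two]
  field_simp
  ring

lemma inv_weibullInfo (hθ : θ ∈ weibullParams) : (weibullInfo θ)⁻¹ =
    !![6 * θ 0 ^ 2 / π ^ 2, 6 * (1 - eulerMascheroniConstant) * θ 1 / π ^ 2;
      6 * (1 - eulerMascheroniConstant) * θ 1 / π ^ 2,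
      (6 * (eulerMascheroniConstant - 1) ^ 2 + π ^ 2) * θ 1 ^ 2 / (π ^ 2 * θ 0 ^ 2)] := by
  have hk : θ 0 ≠ 0 := hθ.1.ne'
  have hl : θ 1 ≠ 0 := hθ.2.ne'
  have hp := pi_ne_zero
  refine Matrix.inv_eq_right_inv ?_
  ext i j
  fin_cases i <;> fin_cases j <;> simp [weibullInfo, Matrix.mul_apply] <;> field_simp <;> ring

/-- The Wallace–Freeman penalty of the Weibull model, up to a constant. -/
def weibullPen (k l : ℝ) : ℝ := log (1 + k ^ 2) + log (1 + l ^ 2) - log l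

/-- Half the log-determinant of the information contributes `-log λ`. The prior normalisers and
`π²/6` are absorbed in `c`, which affects neither gradients nor minimisers. -/
lemma wfPen_weibull : ∃ c : ℝ, ∀ τ ∈ weibullParams,
    wfPen weibullPDF weibullPrior τ = weibullPen (τ 0) (τ 1) + c := by
  refine ⟨-2 * log (2 / π) + (1 / 2) * log (π ^ 2 / 6), fun τ hτ => ?_⟩
  obtain ⟨hk, hl⟩ := id hτ
  have hc : ∀ t : ℝ, 0 < t → log (halfCauchyPDF t) = log (2 / π) - log (1 + t ^ 2) := by
    intro t ht
    rw [halfCauchyPDF, if_pos ht, ← div_div, log_div (by positivity) (by positivity)]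
  have hpos : ∀ t : ℝ, 0 < t → halfCauchyPDF t ≠ 0 := by
    intro t ht
    rw [halfCauchyPDF, if_pos ht]
    positivity
  rw [wfPen, fisherInfo_weibull hτ, det_weibullInfo hτ, weibullPrior,
    log_mul (hpos _ hk) (hpos _ hl), hc _ hk, hc _ hl, ← div_div,
    log_div (x := π ^ 2 / 6) (by positivity) (by positivity), log_pow, weibullPen]
  push_cast
  ring

lemma hasDerivAt_log_one_add_sq (k : ℝ) :
    HasDerivAt (fun t => log (1 + t ^ 2)) (2 * k / (1 + k ^ 2)) k := by
  refine (((hasDerivAt_pow 2 k).const_add 1).log (by positivity)).congr_deriv ?_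
  simp

lemma hasDerivAt_weibullPen_shape (k l : ℝ) :
    HasDerivAt (fun t => weibullPen t l) (2 * k / (1 + k ^ 2)) k :=
  ((hasDerivAt_log_one_add_sq k).add_const _).sub_const _

lemma hasDerivAt_weibullPen_scale (k : ℝ) {l : ℝ} (hl : 0 < l) :
    HasDerivAt (fun t => weibullPen k t) (2 * l / (1 + l ^ 2) - 1 / l) l := by
  rw [one_div]
  exact ((hasDerivAt_log_one_add_sq l).const_add _).sub (hasDerivAt_log hl.ne')

lemma wfGrad_weibull (hθ : θ ∈ weibullParams) : wfGrad weibullPDF weibullPrior θ =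
    ![-(2 * θ 0 / (θ 0 ^ 2 + 1)), (1 - θ 1 ^ 2) / (θ 1 * (θ 1 ^ 2 + 1))] := by
  obtain ⟨c, hc⟩ := wfPen_weibull
  have hl : θ 1 ≠ 0 := hθ.2.ne'
  ext i
  fin_cases i
  · simp only [wfGrad, Fin.zero_eta]
    rw [partialDeriv_zero_eq hθ (F := fun k l => weibullPen k l + c) hc
      ((hasDerivAt_weibullPen_shape _ _).add_const c), add_comm 1]
    simp
  · simp only [wfGrad, Fin.mk_one]
    rw [partialDeriv_one_eq hθ (F := fun k l => weibullPen k l + c) hc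
      ((hasDerivAt_weibullPen_scale _ hθ.2).add_const c)]
    simp
    field_simp
    ring

lemma inv_fisherInfo_mulVec_wfGrad (hθ : θ ∈ weibullParams) :
    (fisherInfo weibullPDF θ)⁻¹.mulVec (wfGrad weibullPDF weibullPrior θ) =
      weibullWFCorrection (θ 0) (θ 1) := by
  have hk : θ 0 ≠ 0 := hθ.1.ne'
  have hl : θ 1 ≠ 0 := hθ.2.ne'
  have hp := pi_ne_zero
  rw [fisherInfo_weibull hθ, inv_weibullInfo hθ, wfGrad_weibull hθ]
  have h1 : θ 0 ^ 2 + 1 ≠ 0 := by positivity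
  have h2 : θ 1 ^ 2 + 1 ≠ 0 := by positivity
  ext i
  fin_cases i <;> simp [Matrix.mulVec, dotProduct, weibullWFCorrection] <;> field_simp <;> ring

/-! ### Cumulants and the Cox–Snell expression -/

section Sample

variable {n : ℕ} {x : Fin n → ℝ}

lemma logLik_weibull (hx : ∀ a, 0 < x a) {τ : Fin 2 → ℝ} (hτ : τ ∈ weibullParams) :
    logLik weibullPDF x τ = ∑ a, weibullLog (τ 0) (τ 1) (log (x a)) :=
  Finset.sum_congr rfl fun a _ => log_weibullPDF hτ (hx a)

lemma partialDeriv_logLik (hx : ∀ a, 0 < x a) (i : Fin 2) {τ : Fin 2 → ℝ} (hτ : τ ∈ weibullParams) :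
    partialDeriv i (logLik weibullPDF x) τ = ∑ a, weibullLog₁ i (τ 0) (τ 1) (log (x a)) := by
  fin_cases i
  · exact partialDeriv_zero_eq hτ (F := fun k l => ∑ a, weibullLog k l (log (x a)))
      (fun _ => logLik_weibull hx)
      (HasDerivAt.fun_sum fun a _ => hasDerivAt_weibullLog_shape _ hτ.1)
  · exact partialDeriv_one_eq hτ (F := fun k l => ∑ a, weibullLog k l (log (x a)))
      (fun _ => logLik_weibull hx)
      (HasDerivAt.fun_sum fun a _ => hasDerivAt_weibullLog_scale _ hτ.2)

lemma partialDeriv₂_logLik (hx : ∀ a, 0 < x a) (i j : Fin 2) {τ : Fin 2 → ℝ}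
    (hτ : τ ∈ weibullParams) : partialDeriv i (partialDeriv j (logLik weibullPDF x)) τ =
      ∑ a, weibullLog₂ i j (τ 0) (τ 1) (log (x a)) := by
  fin_cases i
  · exact partialDeriv_zero_eq hτ (F := fun k l => ∑ a, weibullLog₁ j k l (log (x a)))
      (fun _ => partialDeriv_logLik hx j)
      (HasDerivAt.fun_sum fun a _ => hasDerivAt_weibullLog₁_shape _ hτ.1 j)
  · exact partialDeriv_one_eq hτ (F := fun k l => ∑ a, weibullLog₁ j k l (log (x a)))
      (fun _ => partialDeriv_logLik hx j)
      (HasDerivAt.fun_sum fun a _ => hasDerivAt_weibullLog₁_scale _ hτ.2 j)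

lemma partialDeriv₃_logLik (hx : ∀ a, 0 < x a) (i j h : Fin 2) {τ : Fin 2 → ℝ}
    (hτ : τ ∈ weibullParams) :
    partialDeriv i (partialDeriv j (partialDeriv h (logLik weibullPDF x))) τ =
      ∑ a, weibullLog₃ i j h (τ 0) (τ 1) (log (x a)) := by
  fin_cases i
  · exact partialDeriv_zero_eq hτ (F := fun k l => ∑ a, weibullLog₂ j h k l (log (x a)))
      (fun _ => partialDeriv₂_logLik hx j h)
      (HasDerivAt.fun_sum fun a _ => hasDerivAt_weibullLog₂_shape _ hτ.1 j h)
  · exact partialDeriv_one_eq hτ (F := fun k l => ∑ a, weibullLog₂ j h k l (log (x a)))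
      (fun _ => partialDeriv₂_logLik hx j h)
      (HasDerivAt.fun_sum fun a _ => hasDerivAt_weibullLog₂_scale _ hτ.2 j h)

end Sample

lemma ae_sample_pos (hθ : θ ∈ weibullParams) (n : ℕ) :
    ∀ᵐ x ∂(sampleLaw weibullPDF n θ), ∀ a, 0 < x a := by
  have := isProbabilityMeasure_weibull hθ
  rw [ae_all_iff]
  intro a
  exact (measurePreserving_eval (fun _ : Fin n => obsLaw weibullPDF θ) a).quasiMeasurePreserving.ae
    ae_weibull_pos

lemma integral_sample_sum (hθ : θ ∈ weibullParams) (n : ℕ) {f : ℝ → ℝ}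
    (hf : Integrable f (obsLaw weibullPDF θ)) :
    ∫ x, ∑ a, f (x a) ∂(sampleLaw weibullPDF n θ) = n * ∫ y, f y ∂(obsLaw weibullPDF θ) := by
  have := isProbabilityMeasure_weibull hθ
  have hmp := fun a : Fin n => measurePreserving_eval (fun _ : Fin n => obsLaw weibullPDF θ) a
  have hfi : ∀ a : Fin n, Integrable (fun x => f (x a))
      (Measure.pi fun _ : Fin n => obsLaw weibullPDF θ) :=
    fun a => (hmp a).integrable_comp_of_integrable hf
  rw [sampleLaw, integral_finsetSum _ fun a _ => hfi a]
  have h : ∀ a : Fin n, ∫ x, f (x a) ∂(Measure.pi fun _ : Fin n => obsLaw weibullPDF θ) =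
      ∫ y, f y ∂(obsLaw weibullPDF θ) := fun a => by
    have h2 := integral_map (hmp a).aemeasurable ((hmp a).map_eq.symm ▸ hf.1)
    rw [(hmp a).map_eq] at h2
    exact h2.symm
  simp [h]

lemma weibullLog₂_expect (hθ : θ ∈ weibullParams) (i j : Fin 2) :
    Integrable (fun x => weibullLog₂ i j (θ 0) (θ 1) (log x)) (obsLaw weibullPDF θ) ∧
    ∫ x, weibullLog₂ i j (θ 0) (θ 1) (log x) ∂(obsLaw weibullPDF θ) = -weibullInfo θ i j := by
  obtain ⟨g00, g01, g02, g10, g11, g12, g13, g20, g21, g22, g23⟩ := gmom_table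
  have hk : θ 0 ≠ 0 := hθ.1.ne'
  have hl : θ 1 ≠ 0 := hθ.2.ne'
  have h01 : Integrable (fun x => weibullLog₂ 0 1 (θ 0) (θ 1) (log x)) (obsLaw weibullPDF θ) ∧
      ∫ x, weibullLog₂ 0 1 (θ 0) (θ 1) (log x) ∂(obsLaw weibullPDF θ) = -weibullInfo θ 0 1 := by
    have h := weibull_expect hθ ![![-1 / θ 1, 0, 0, 0], ![1 / θ 1, 1 / θ 1, 0, 0], 0]
      (f := fun x => weibullLog₂ 0 1 (θ 0) (θ 1) (log x)) fun x hx => by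
        simp [weibullLog₂, exp_mul_log_div_eq hθ hx, sub_log_eq hθ hx, Fin.sum_univ_succ]
        field_simp
        try ring
    refine ⟨h.1, h.2.trans ?_⟩
    simp [Fin.sum_univ_succ, weibullInfo, g00, g01, g02, g10, g11, g12, g13, g20, g21, g22, g23]
    field_simp
    ring
  fin_cases i <;> fin_cases j
  · have h := weibull_expect hθ ![![-1 / θ 0 ^ 2, 0, 0, 0], ![0, 0, -1 / θ 0 ^ 2, 0], 0]
      (f := fun x => weibullLog₂ 0 0 (θ 0) (θ 1) (log x)) fun x hx => by
        simp [weibullLog₂, exp_mul_log_div_eq hθ hx, sub_log_eq hθ hx, Fin.sum_univ_succ]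
        field_simp
        try ring
    refine ⟨h.1, h.2.trans ?_⟩
    simp [Fin.sum_univ_succ, weibullInfo, g00, g01, g02, g10, g11, g12, g13, g20, g21, g22, g23]
    field_simp
    ring
  · exact h01
  · exact h01
  · have h := weibull_expect hθ ![![θ 0 / θ 1 ^ 2, 0, 0, 0],
      ![-(θ 0 + θ 0 ^ 2) / θ 1 ^ 2, 0, 0, 0], 0]
      (f := fun x => weibullLog₂ 1 1 (θ 0) (θ 1) (log x)) fun x hx => by
        simp [weibullLog₂, exp_mul_log_div_eq hθ hx, sub_log_eq hθ hx, Fin.sum_univ_succ]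
        field_simp
        try ring
    refine ⟨h.1, h.2.trans ?_⟩
    simp [Fin.sum_univ_succ, weibullInfo, g00, g01, g02, g10, g11, g12, g13, g20, g21, g22, g23]
    field_simp
    ring

/-- Per-observation third-order cumulants of the Weibull log-likelihood. -/
def weibullCum₃ (θ : Fin 2 → ℝ) (i j h : Fin 2) : ℝ :=
  let a := (2 - gmom 1 3) / θ 0 ^ 3
  let b := (2 * gmom 1 1 + gmom 1 2) / (θ 0 * θ 1)
  let c := (-gmom 1 1 - 2 * θ 0 - θ 0 * gmom 1 1) / θ 1 ^ 2
  let d := (3 * θ 0 ^ 2 + θ 0 ^ 3) / θ 1 ^ 3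
  ![![![a, b], ![b, c]], ![![b, c], ![c, d]]] i j h

lemma weibullLog₃_expect (hθ : θ ∈ weibullParams) (i j h : Fin 2) :
    Integrable (fun x => weibullLog₃ i j h (θ 0) (θ 1) (log x)) (obsLaw weibullPDF θ) ∧
    ∫ x, weibullLog₃ i j h (θ 0) (θ 1) (log x) ∂(obsLaw weibullPDF θ) = weibullCum₃ θ i j h := by
  obtain ⟨g00, -, -, g10, -⟩ := gmom_table
  have hk : θ 0 ≠ 0 := hθ.1.ne'
  have hl : θ 1 ≠ 0 := hθ.2.ne'
  have key : ∀ (i j h : Fin 2) (c : Fin 3 → Fin 4 → ℝ),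
      (∀ x, 0 < x → weibullLog₃ i j h (θ 0) (θ 1) (log x) =
        ∑ m, ∑ j, c m j * (weibullStd θ x ^ (m : ℕ) * log (weibullStd θ x) ^ (j : ℕ))) →
      ∑ m, ∑ j, c m j * gmom m j = weibullCum₃ θ i j h →
      Integrable (fun x => weibullLog₃ i j h (θ 0) (θ 1) (log x)) (obsLaw weibullPDF θ) ∧
      ∫ x, weibullLog₃ i j h (θ 0) (θ 1) (log x) ∂(obsLaw weibullPDF θ) =
        weibullCum₃ θ i j h := fun i j h c h1 h2 =>
    ⟨(weibull_expect hθ c h1).1, (weibull_expect hθ c h1).2.trans h2⟩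
  have h000 := key 0 0 0 ![![2 / θ 0 ^ 3, 0, 0, 0], ![0, 0, 0, -1 / θ 0 ^ 3], 0]
    (fun x hx => by
      simp [weibullLog₃, exp_mul_log_div_eq hθ hx, sub_log_eq hθ hx, Fin.sum_univ_succ]
      field_simp
      try ring)
    (by
      simp [Fin.sum_univ_succ, weibullCum₃, g00]
      field_simp
      try ring)
  have h001 := key 0 0 1 ![0, ![0, 2 / (θ 0 * θ 1), 1 / (θ 0 * θ 1), 0], 0]
    (fun x hx => by
      simp [weibullLog₃, exp_mul_log_div_eq hθ hx, sub_log_eq hθ hx, Fin.sum_univ_succ]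
      field_simp
      try ring)
    (by
      simp [Fin.sum_univ_succ, weibullCum₃]
      field_simp
      try ring)
  have h011 := key 0 1 1 ![![1 / θ 1 ^ 2, 0, 0, 0], ![-(1 + 2 * θ 0) / θ 1 ^ 2,
      -(1 + θ 0) / θ 1 ^ 2, 0, 0], 0]
    (fun x hx => by
      simp [weibullLog₃, exp_mul_log_div_eq hθ hx, sub_log_eq hθ hx, Fin.sum_univ_succ]
      field_simp
      try ring)
    (by
      simp [Fin.sum_univ_succ, weibullCum₃, g00, g10]
      field_simp
      try ring)
  have h111 := key 1 1 1 ![![-2 * θ 0 / θ 1 ^ 3, 0, 0, 0],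
      ![(2 * θ 0 + 3 * θ 0 ^ 2 + θ 0 ^ 3) / θ 1 ^ 3, 0, 0, 0], 0]
    (fun x hx => by
      simp [weibullLog₃, exp_mul_log_div_eq hθ hx, sub_log_eq hθ hx, Fin.sum_univ_succ]
      field_simp
      try ring)
    (by
      simp [Fin.sum_univ_succ, weibullCum₃, g00, g10]
      field_simp
      try ring)
  fin_cases i <;> fin_cases j <;> fin_cases h
  exacts [h000, h001, h001, h011, h001, h011, h011, h111]

/-- Needed at every `τ` of the parameter space, not only at the true parameter, because the
Cox–Snell expression differentiates it. -/
lemma cumulant₂_weibull (n : ℕ) (i j : Fin 2) {τ : Fin 2 → ℝ} (hτ : τ ∈ weibullParams) :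
    cumulant₂ weibullPDF n i j τ = -(n * weibullInfo τ i j) := by
  obtain ⟨h1, h2⟩ := weibullLog₂_expect hτ i j
  rw [cumulant₂, integral_congr_ae (g := fun x => ∑ a, weibullLog₂ i j (τ 0) (τ 1) (log (x a))),
    integral_sample_sum hτ n h1, h2]
  · ring
  · filter_upwards [ae_sample_pos hτ n] with x hx using partialDeriv₂_logLik hx i j hτ

lemma cumulant₃_weibull (n : ℕ) (i j h : Fin 2) (hθ : θ ∈ weibullParams) :
    cumulant₃ weibullPDF n i j h θ = n * weibullCum₃ θ i j h := by
  obtain ⟨h1, h2⟩ := weibullLog₃_expect hθ i j h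
  rw [cumulant₃, integral_congr_ae (g := fun x => ∑ a, weibullLog₃ i j h (θ 0) (θ 1) (log (x a))),
    integral_sample_sum hθ n h1, h2]
  filter_upwards [ae_sample_pos hθ n] with x hx using partialDeriv₃_logLik hx i j h hθ

/-- The partial derivatives of the Weibull information matrix. -/
def weibullInfoDeriv (θ : Fin 2 → ℝ) (h i j : Fin 2) : ℝ :=
  ![![![-(6 * (eulerMascheroniConstant - 1) ^ 2 + π ^ 2) / (3 * θ 0 ^ 3), 0],
      ![0, 2 * θ 0 / θ 1 ^ 2]],
    ![![0, -(eulerMascheroniConstant - 1) / θ 1 ^ 2],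
      ![-(eulerMascheroniConstant - 1) / θ 1 ^ 2, -2 * θ 0 ^ 2 / θ 1 ^ 3]]] h i j

lemma partialDeriv_cumulant₂ (n : ℕ) (h i j : Fin 2) (hθ : θ ∈ weibullParams) :
    partialDeriv h (cumulant₂ weibullPDF n i j) θ = -(n * weibullInfoDeriv θ h i j) := by
  have hk : θ 0 ≠ 0 := hθ.1.ne'
  have hl : θ 1 ≠ 0 := hθ.2.ne'
  have hc : ∀ τ ∈ weibullParams, cumulant₂ weibullPDF n i j τ =
      -(n * weibullInfo ![τ 0, τ 1] i j) := fun τ hτ => by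
    rw [cumulant₂_weibull n i j hτ]
    simp [weibullInfo]
  have hinv : ∀ {c : ℝ} (_ : c ≠ 0) (a : ℝ), HasDerivAt (fun t => a / t) (-a / c ^ 2) c := by
    intro c hc a
    simpa [div_eq_mul_inv, neg_mul, mul_neg] using (hasDerivAt_inv hc).const_mul a
  have hinv2 : ∀ {c : ℝ} (_ : c ≠ 0) (a : ℝ),
      HasDerivAt (fun t => a / t ^ 2) (-2 * a / c ^ 3) c := by
    intro c hc a
    refine ((hasDerivAt_const c a).div (hasDerivAt_pow 2 c) (by positivity)).congr_deriv ?_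
    simp
    field_simp
  fin_cases h
  · refine partialDeriv_zero_eq hθ (F := fun k l => -(n * weibullInfo ![k, l] i j)) hc
      (HasDerivAt.fun_neg (HasDerivAt.const_mul (n : ℝ) ?_))
    fin_cases i <;> fin_cases j
    · refine ((hinv2 hk ((6 * (eulerMascheroniConstant - 1) ^ 2 + π ^ 2) / 6)).congr_of_eventuallyEq
        (Eventually.of_forall fun t => ?_)).congr_deriv ?_
      · simp [weibullInfo, div_div]
      · simp [weibullInfoDeriv]
        field_simp
        ring
    · simpa [weibullInfo, weibullInfoDeriv] using hasDerivAt_const (θ 0) _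
    · simpa [weibullInfo, weibullInfoDeriv] using hasDerivAt_const (θ 0) _
    · simpa [weibullInfo, weibullInfoDeriv] using (hasDerivAt_pow 2 (θ 0)).div_const (θ 1 ^ 2)
  · refine partialDeriv_one_eq hθ (F := fun k l => -(n * weibullInfo ![k, l] i j)) hc
      (HasDerivAt.fun_neg (HasDerivAt.const_mul (n : ℝ) ?_))
    fin_cases i <;> fin_cases j
    · simpa [weibullInfo, weibullInfoDeriv] using hasDerivAt_const (θ 1) _
    · simpa [weibullInfo, weibullInfoDeriv] using hinv hl (eulerMascheroniConstant - 1)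
    · simpa [weibullInfo, weibullInfoDeriv] using hinv hl (eulerMascheroniConstant - 1)
    · simpa [weibullInfo, weibullInfoDeriv] using hinv2 hl (θ 0 ^ 2)

/-- The two inverse matrices contribute `n⁻²` and the cumulants `n`; what remains is a finite sum of
per-observation quantities, evaluated with the moment table. -/
lemma coxSnell_weibull (hθ : θ ∈ weibullParams) {n : ℕ} (hn : 1 ≤ n) :
    coxSnell weibullPDF n θ = (1 / (n : ℝ)) • weibullMLECoeff (θ 0) (θ 1) := by
  obtain ⟨g00, g01, g02, g10, g11, g12, g13, g20, g21, g22, g23⟩ := gmom_table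
  have hk : θ 0 ≠ 0 := hθ.1.ne'
  have hl : θ 1 ≠ 0 := hθ.2.ne'
  have hp := pi_ne_zero
  have hn0 : (n : ℝ) ≠ 0 := by positivity
  have hinfo : sampleInfo weibullPDF n θ = (n : ℝ) • weibullInfo θ := by
    ext i j
    simp [sampleInfo, cumulant₂_weibull n i j hθ]
  have hinv : (sampleInfo weibullPDF n θ)⁻¹ = (1 / (n : ℝ)) • (weibullInfo θ)⁻¹ := by
    rw [hinfo]
    refine Matrix.inv_eq_right_inv ?_
    rw [Matrix.smul_mul, Matrix.mul_smul, smul_smul, mul_one_div_cancel hn0, one_smul,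
      Matrix.mul_nonsing_inv]
    rw [det_weibullInfo hθ]
    exact (by positivity : π ^ 2 / (6 * θ 1 ^ 2) ≠ 0).isUnit
  have hsum : ∀ s, coxSnell weibullPDF n θ s = (1 / (n : ℝ)) * ∑ i, ∑ j, ∑ l,
      (weibullInfo θ)⁻¹ s i * (weibullInfo θ)⁻¹ j l *
        (-weibullInfoDeriv θ l i j - (1 / 2) * weibullCum₃ θ i j l) := by
    intro s
    simp only [coxSnell, hinv, partialDeriv_cumulant₂ n _ _ _ hθ, cumulant₃_weibull n _ _ _ hθ,
      Finset.mul_sum, Matrix.smul_apply, smul_eq_mul]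
    refine Finset.sum_congr rfl fun i _ => Finset.sum_congr rfl fun j _ =>
      Finset.sum_congr rfl fun l _ => ?_
    field_simp
    try ring
  ext s
  rw [hsum, Pi.smul_apply, smul_eq_mul, inv_weibullInfo hθ]
  congr 1
  fin_cases s <;>
  · simp [Fin.sum_univ_succ, weibullInfoDeriv, weibullCum₃, weibullMLECoeff, g11, g12, g13]
    field_simp
    ring

/-! ### The ratio of the shape biases at scale one -/

lemma weibullWFCoeff_one (k : ℝ) : weibullWFCoeff k 1 0 =
    6 * k / (π ^ 4 * (k ^ 2 + 1)) * (π ^ 2 * (k ^ 2 + 3) - 6 * (k ^ 2 + 1) * apery) := by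
  have hp := pi_ne_zero
  have h1 : k ^ 2 + 1 ≠ 0 := by positivity
  simp [weibullWFCoeff, weibullMLECoeff, weibullWFCorrection]
  field_simp
  ring

/-- `ζ(3) ≤ π²/6` leaves at least `2π²`. -/
lemma weibullWF_denominator_pos (k : ℝ) : 0 < π ^ 2 * (k ^ 2 + 3) - 6 * (k ^ 2 + 1) * apery := by
  have h := mul_le_mul_of_nonneg_left apery_le (by positivity : 0 ≤ 6 * (k ^ 2 + 1))
  have hp : 0 < π ^ 2 := by positivity
  linarith

lemma weibullWFCoeff_one_pos {k : ℝ} (hk : 0 < k) : 0 < weibullWFCoeff k 1 0 := by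
  rw [weibullWFCoeff_one]
  exact mul_pos (by positivity) (weibullWF_denominator_pos k)

lemma shapeBiasRatio_one {k : ℝ} (hk : 0 < k) : shapeBiasRatio k 1 =
    3 * (k ^ 2 + 1) * (π ^ 2 - 2 * apery) /
      (π ^ 2 * (k ^ 2 + 3) - 6 * (k ^ 2 + 1) * apery) := by
  have hp := pi_ne_zero
  have h1 : k ^ 2 + 1 ≠ 0 := by positivity
  have h2 := (weibullWF_denominator_pos k).ne'
  rw [shapeBiasRatio, weibullWFCoeff_one]
  simp only [weibullMLECoeff, Matrix.cons_val_zero]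
  rw [div_eq_div_iff (mul_ne_zero (by positivity) h2) h2]
  field_simp
  ring

/-- The terms in `ζ(3)` cancel: numerator minus denominator is `2π²k²`. -/
lemma one_lt_shapeBiasRatio_one {k : ℝ} (hk : 0 < k) : 1 < shapeBiasRatio k 1 := by
  rw [shapeBiasRatio_one hk, one_lt_div (weibullWF_denominator_pos k)]
  have : 0 < π ^ 2 * k ^ 2 := by positivity
  linarith

/-! ### Moments of averages of independent observations -/

section Averages

variable {P : Measure ℝ}

/-- `f` is measurable and centred, with absolute moments of all orders. -/
structure Centred (f : ℝ → ℝ) (P : Measure ℝ) : Prop where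
  measurable : Measurable f
  moments : AllMoments f P
  integral_eq : ∫ y, f y ∂P = 0

lemma Centred.add {f g : ℝ → ℝ} (hf : Centred f P) (hg : Centred g P) :
    Centred (fun y => f y + g y) P :=
  ⟨hf.1.add hg.1, hf.2.add hg.2, by
    rw [integral_add hf.2.integrable hg.2.integrable, hf.3, hg.3, add_zero]⟩

lemma Centred.sub {f g : ℝ → ℝ} (hf : Centred f P) (hg : Centred g P) :
    Centred (fun y => f y - g y) P :=
  ⟨hf.1.sub hg.1, hf.2.sub hg.2, by
    rw [integral_sub hf.2.integrable hg.2.integrable, hf.3, hg.3, sub_zero]⟩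

variable [IsProbabilityMeasure P] {n : ℕ}

/-- The sample average of `f`. -/
def avg (f : ℝ → ℝ) {n : ℕ} (x : Fin n → ℝ) : ℝ := (∑ a, f (x a)) / n

lemma allMoments_coord {f : ℝ → ℝ} (hf : AllMoments f P) (a : Fin n) :
    AllMoments (fun x : Fin n → ℝ => f (x a)) (Measure.pi fun _ => P) :=
  hf.comp (measurePreserving_eval (fun _ : Fin n => P) a)

lemma allMoments_avg {f : ℝ → ℝ} (hf : AllMoments f P) :
    AllMoments (fun x : Fin n → ℝ => avg f x) (Measure.pi fun _ => P) := by
  have h := (AllMoments.sum Finset.univ fun a _ => allMoments_coord (n := n) hf a).const_mul (1 / n)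
  refine h.mono (h.1.congr (Eventually.of_forall fun x => ?_)) (Eventually.of_forall fun x => ?_)
  · simp [avg, div_eq_inv_mul]
  · simp [avg, div_eq_inv_mul]

lemma integral_coord {f : ℝ → ℝ} (hf : AEStronglyMeasurable f P) (a : Fin n) :
    ∫ x, f (x a) ∂(Measure.pi fun _ : Fin n => P) = ∫ y, f y ∂P := by
  have hmp := measurePreserving_eval (fun _ : Fin n => P) a
  have h := integral_map hmp.aemeasurable (hmp.map_eq.symm ▸ hf)
  rw [hmp.map_eq] at h
  exact h.symm

lemma iIndepFun_coord : iIndepFun (fun (a : Fin n) (x : Fin n → ℝ) => x a)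
    (Measure.pi fun _ => P) :=
  iIndepFun_pi (X := fun _ => id) fun _ => aemeasurable_id

lemma integral_pow_sum_mul_pow {f : ℝ → ℝ} (hf : Measurable f) (hP : AllMoments f P)
    {s : Finset (Fin n)} {a : Fin n} (ha : a ∉ s) (i j : ℕ) :
    ∫ x, f (x a) ^ i * (∑ b ∈ s, f (x b)) ^ j ∂(Measure.pi fun _ : Fin n => P) =
      (∫ y, f y ^ i ∂P) * ∫ x, (∑ b ∈ s, f (x b)) ^ j ∂(Measure.pi fun _ : Fin n => P) := by
  have hind : iIndepFun (fun (a : Fin n) (x : Fin n → ℝ) => f (x a)) (Measure.pi fun _ => P) :=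
    (iIndepFun_coord (P := P)).comp (fun _ => f) fun _ => hf
  have h := hind.indepFun_finsetSum_of_notMem (fun b => hf.comp (measurable_pi_apply b)) ha
  have h2 := h.symm.comp (φ := fun t => t ^ i) (ψ := fun t => t ^ j) (by fun_prop) (by fun_prop)
  have hm : Measurable (fun x : Fin n → ℝ => (∑ b ∈ s, f (x b)) ^ j) := by fun_prop
  have hm2 : Measurable (fun x : Fin n → ℝ => f (x a) ^ i) := by fun_prop
  have h3 := h2.integral_mul_eq_mul_integral hm2.aestronglyMeasurable
    (by simpa [Function.comp_def] using hm.aestronglyMeasurable)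
  have h4 := integral_coord (P := P) (n := n) (f := fun y => f y ^ i) (hP.1.pow i) a
  rw [← h4]
  simpa [Function.comp_def] using h3

/-- Induction on `m`, then on the index set. Adding an observation to a sum `S` and expanding
binomially, the term linear in the new observation vanishes by centring, and the others carry `S` to
a power at most `m - 2`. Each insertion thus costs `O(|s|^{m/2 - 1})`, and the costs add up to
`O(|s|^{m/2})`. -/
lemma abs_integral_pow_sum_le {f : ℝ → ℝ} (hf : Measurable f) (hP : AllMoments f P)
    (h0 : ∫ y, f y ∂P = 0) (m : ℕ) : ∃ C : ℝ, 0 ≤ C ∧ ∀ (n : ℕ) (s : Finset (Fin n)),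
      |∫ x, (∑ b ∈ s, f (x b)) ^ m ∂(Measure.pi fun _ : Fin n => P)| ≤
        C * (s.card : ℝ) ^ (m / 2) := by
  induction m using Nat.strong_induction_on with
  | _ m ih =>
  have hint : ∀ (n : ℕ) (s : Finset (Fin n)) (i j : ℕ) (a : Fin n),
      Integrable (fun x : Fin n → ℝ => f (x a) ^ i * (∑ b ∈ s, f (x b)) ^ j)
      (Measure.pi fun _ => P) := fun n s i j a =>
    (((allMoments_coord hP a).pow i).mul
      ((AllMoments.sum s fun b _ => allMoments_coord hP b).pow j)).integrable
  rcases Nat.lt_or_ge m 2 with hm | hm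
  · refine ⟨1, zero_le_one, fun n s => ?_⟩
    interval_cases m
    · simp
    · simp only [pow_one]
      rw [integral_finsetSum _ fun b _ => (allMoments_coord hP b).integrable]
      simp [integral_coord hP.1, h0]
  choose! C hC0 hC using ih
  set D : ℝ := ∑ j ∈ Finset.range (m - 1), |∫ y, f y ^ (j + 2) ∂P| * C (m - (j + 2)) *
    (m.choose (j + 2)) with hD
  have hD0 : 0 ≤ D := Finset.sum_nonneg fun j hj => by
    have : m - (j + 2) < m := by omega
    have := hC0 _ this
    positivity
  refine ⟨D, hD0, fun n s => ?_⟩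
  induction s using Finset.induction_on with
  | empty =>
    have : m ≠ 0 := by omega
    have : m / 2 ≠ 0 := by omega
    simp [*]
  | insert a s ha ihs =>
    have hexp : ∫ x, (∑ b ∈ insert a s, f (x b)) ^ m ∂(Measure.pi fun _ : Fin n => P) =
        ∑ j ∈ Finset.range (m + 1), (∫ y, f y ^ j ∂P) *
          (∫ x, (∑ b ∈ s, f (x b)) ^ (m - j) ∂(Measure.pi fun _ : Fin n => P)) *
            (m.choose j) := by
      simp only [Finset.sum_insert ha, add_pow]
      rw [integral_finsetSum _ fun j _ => (hint n s j (m - j) a).mul_const _]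
      refine Finset.sum_congr rfl fun j _ => ?_
      rw [integral_mul_const, integral_pow_sum_mul_pow hf hP ha]
    -- The terms `j = 0` and `j = 1` are split off: the first is the integral over the smaller index
    -- set, the second is zero by centring.
    rw [hexp, show m + 1 = (m - 1) + 1 + 1 by omega, Finset.sum_range_succ',
      Finset.sum_range_succ', Finset.card_insert_of_notMem ha]
    have hm1 : ∀ j, m - 1 + 1 - j = m - j := fun j => by omega
    simp only [zero_add, pow_one, h0, zero_mul, pow_zero, integral_const, probReal_univ,
      smul_eq_mul, one_mul, Nat.sub_zero, Nat.choose_zero_right, Nat.cast_one, mul_one, add_zero]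
    set c : ℝ := (s.card : ℝ) with hc
    have hc0 : 0 ≤ c := Nat.cast_nonneg _
    obtain ⟨q, hq⟩ : ∃ q, m / 2 = q + 1 := ⟨m / 2 - 1, by omega⟩
    have h1 : |∑ j ∈ Finset.range (m - 1), (∫ y, f y ^ (j + 1 + 1) ∂P) *
          (∫ x, (∑ b ∈ s, f (x b)) ^ (m - (j + 1 + 1)) ∂(Measure.pi fun _ : Fin n => P)) *
            (m.choose (j + 1 + 1))| ≤ D * (c + 1) ^ q := by
      rw [hD, Finset.sum_mul]
      refine (Finset.abs_sum_le_sum_abs _ _).trans (Finset.sum_le_sum fun j hj => ?_)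
      have hj' : m - (j + 2) < m := by omega
      have h2 := hC _ hj' n s
      have h3 : c ^ ((m - (j + 2)) / 2) ≤ (c + 1) ^ q := by
        refine (pow_le_pow_left₀ hc0 (by linarith) _).trans
          (pow_le_pow_right₀ (by linarith) (by omega))
      rw [abs_mul, abs_mul, Nat.abs_cast]
      have := hC0 _ hj'
      calc _ ≤ |∫ y, f y ^ (j + 2) ∂P| * (C (m - (j + 2)) * c ^ ((m - (j + 2)) / 2)) *
            (m.choose (j + 2)) := by gcongr
        _ ≤ |∫ y, f y ^ (j + 2) ∂P| * (C (m - (j + 2)) * (c + 1) ^ q) *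
            (m.choose (j + 2)) := by gcongr
        _ = _ := by ring
    refine (abs_add_le _ _).trans ((add_le_add h1 ihs).trans ?_)
    rw [hq]
    push_cast
    have h4 : c ^ (q + 1) ≤ c * (c + 1) ^ q := by
      rw [pow_succ']
      gcongr
      linarith
    calc D * (c + 1) ^ q + D * c ^ (q + 1) ≤ D * (c + 1) ^ q + D * (c * (c + 1) ^ q) := by gcongr
      _ = _ := by ring

/-- With integer division the exponent is `m/2` rounded up. For odd `m` this beats the central-limit
scale by half a power of `n`, which is why cubic terms contribute only `O(n⁻²)`. -/
lemma abs_integral_avg_pow_le {f : ℝ → ℝ} (hf : Measurable f) (hP : AllMoments f P)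
    (h0 : ∫ y, f y ∂P = 0) (m : ℕ) : ∃ C : ℝ, 0 ≤ C ∧ ∀ n : ℕ, 1 ≤ n →
      |∫ x, avg f x ^ m ∂(Measure.pi fun _ : Fin n => P)| ≤ C / (n : ℝ) ^ (m - m / 2) := by
  obtain ⟨C, hC0, hC⟩ := abs_integral_pow_sum_le hf hP h0 m
  refine ⟨C, hC0, fun n hn => ?_⟩
  have hn' : (0 : ℝ) < n := by positivity
  have h := hC n Finset.univ
  simp only [avg, div_pow, integral_div, abs_div, abs_pow, Nat.abs_cast]
  rw [div_le_div_iff₀ (by positivity) (by positivity)]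
  simp only [Finset.card_univ, Fintype.card_fin] at h
  calc _ ≤ C * (n : ℝ) ^ (m / 2) * n ^ (m - m / 2) := by gcongr
    _ = C * n ^ m := by rw [mul_assoc, ← pow_add]; congr 2; omega

lemma integral_avg_sq {f : ℝ → ℝ} (hf : Measurable f) (hP : AllMoments f P)
    (h0 : ∫ y, f y ∂P = 0) {n : ℕ} (hn : 1 ≤ n) :
    ∫ x, avg f x ^ 2 ∂(Measure.pi fun _ : Fin n => P) = (∫ y, f y ^ 2 ∂P) / n := by
  have hn' : (n : ℝ) ≠ 0 := by positivity
  have key : ∀ s : Finset (Fin n), ∫ x, (∑ b ∈ s, f (x b)) ^ 2 ∂(Measure.pi fun _ : Fin n => P) =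
      s.card * ∫ y, f y ^ 2 ∂P := by
    intro s
    induction s using Finset.induction_on with
    | empty => simp
    | insert a s ha ihs =>
      have hI : ∀ i j, Integrable (fun x : Fin n → ℝ => f (x a) ^ i * (∑ b ∈ s, f (x b)) ^ j)
          (Measure.pi fun _ => P) := fun i j =>
        (((allMoments_coord hP a).pow i).mul
          ((AllMoments.sum s fun b _ => allMoments_coord hP b).pow j)).integrable
      have he : ∀ x : Fin n → ℝ, (∑ b ∈ insert a s, f (x b)) ^ 2 =
          f (x a) ^ 2 * (∑ b ∈ s, f (x b)) ^ 0 + (2 * (f (x a) ^ 1 * (∑ b ∈ s, f (x b)) ^ 1) +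
            f (x a) ^ 0 * (∑ b ∈ s, f (x b)) ^ 2) := fun x => by
        rw [Finset.sum_insert ha]; ring
      simp only [he]
      have hs : Integrable (fun x : Fin n → ℝ => 2 * (f (x a) ^ 1 * (∑ b ∈ s, f (x b)) ^ 1) +
            f (x a) ^ 0 * (∑ b ∈ s, f (x b)) ^ 2) (Measure.pi fun _ => P) :=
        ((hI _ _).const_mul _).add (hI _ _)
      rw [integral_add (hI 2 0) hs, integral_add ((hI 1 1).const_mul 2) (hI 0 2),
        integral_const_mul,
        integral_pow_sum_mul_pow hf hP ha, integral_pow_sum_mul_pow hf hP ha,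
        integral_pow_sum_mul_pow hf hP ha, ihs, Finset.card_insert_of_notMem ha]
      simp [h0]
      ring
  simp only [avg, div_pow, integral_div, key]
  simp
  field_simp

lemma avg_add (f g : ℝ → ℝ) (x : Fin n → ℝ) : avg (fun y => f y + g y) x = avg f x + avg g x := by
  simp [avg, Finset.sum_add_distrib, add_div]

lemma avg_sub (f g : ℝ → ℝ) (x : Fin n → ℝ) : avg (fun y => f y - g y) x = avg f x - avg g x := by
  simp [avg, Finset.sum_sub_distrib, sub_div]

lemma avg_const_mul (c : ℝ) (f : ℝ → ℝ) (x : Fin n → ℝ) :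
    avg (fun y => c * f y) x = c * avg f x := by
  simp [avg, ← Finset.mul_sum, mul_div_assoc]

lemma Centred.integral_avg {f : ℝ → ℝ} (hf : Centred f P) (n : ℕ) :
    ∫ x, avg f x ∂(Measure.pi fun _ : Fin n => P) = 0 := by
  simp only [avg, integral_div]
  rw [integral_finsetSum _ fun b _ => (allMoments_coord hf.2 b).integrable]
  simp [integral_coord hf.2.1, hf.3]

/-- Polarisation of the variance formula; the cubic bound that follows is obtained in the same way
from third moments of `±` combinations. -/
lemma integral_avg_mul_avg {f g : ℝ → ℝ} (hf : Centred f P) (hg : Centred g P) {n : ℕ}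
    (hn : 1 ≤ n) : ∫ x, avg f x * avg g x ∂(Measure.pi fun _ : Fin n => P) =
      (∫ y, f y * g y ∂P) / n := by
  have h1 := integral_avg_sq (hf.add hg).1 (hf.add hg).2 (hf.add hg).3 hn
  have h2 := integral_avg_sq (hf.sub hg).1 (hf.sub hg).2 (hf.sub hg).3 hn
  have e1 : ∀ a b : ℝ, a * b = ((a + b) ^ 2 - (a - b) ^ 2) / 4 := fun a b => by ring
  simp only [e1 (avg f _), e1 (f _), integral_div]
  rw [integral_sub, integral_sub]
  · simp only [avg_add, avg_sub] at h1 h2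
    rw [h1, h2]
    ring
  · exact (hf.add hg).2.integrable_pow 2
  · exact (hf.sub hg).2.integrable_pow 2
  · exact ((allMoments_avg hf.2).add (allMoments_avg hg.2)).integrable_pow 2
  · exact ((allMoments_avg hf.2).sub (allMoments_avg hg.2)).integrable_pow 2

lemma abs_integral_avg_mul_avg_mul_avg_le {f g h : ℝ → ℝ} (hf : Centred f P) (hg : Centred g P)
    (hh : Centred h P) : ∃ C : ℝ, ∀ n : ℕ, 1 ≤ n →
      |∫ x, avg f x * avg g x * avg h x ∂(Measure.pi fun _ : Fin n => P)| ≤ C / (n : ℝ) ^ 2 := by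
  have key := fun {u : ℝ → ℝ} (hu : Centred u P) => abs_integral_avg_pow_le hu.1 hu.2 hu.3 3
  obtain ⟨C1, -, h1⟩ := key ((hf.add hg).add hh)
  obtain ⟨C2, -, h2⟩ := key ((hf.add hg).sub hh)
  obtain ⟨C3, -, h3⟩ := key ((hf.sub hg).add hh)
  obtain ⟨C4, -, h4⟩ := key ((hf.sub hg).sub hh)
  refine ⟨(C1 + C2 + C3 + C4) / 24, fun n hn => ?_⟩
  specialize h1 n hn
  specialize h2 n hn
  specialize h3 n hn
  specialize h4 n hn
  have hF := allMoments_avg (n := n) hf.2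
  have hG := allMoments_avg (n := n) hg.2
  have hH := allMoments_avg (n := n) hh.2
  simp only [avg_add, avg_sub] at h1 h2 h3 h4
  norm_num at h1 h2 h3 h4
  have e : ∀ a b c : ℝ, a * b * c = (((a + b + c) ^ 3 - (a + b - c) ^ 3) -
      ((a - b + c) ^ 3 - (a - b - c) ^ 3)) / 24 := fun a b c => by ring
  simp only [e (avg f _), integral_div]
  rw [integral_sub, integral_sub, integral_sub, abs_div, abs_of_pos (by norm_num : (0 : ℝ) < 24),
    div_div, mul_comm (24 : ℝ), ← div_div]
  · gcongr
    refine (abs_sub _ _).trans ((add_le_add (abs_sub _ _) (abs_sub _ _)).trans ?_)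
    simp only [add_div]
    linarith
  · exact (((hF.sub hG).add hH).integrable_pow 3)
  · exact (((hF.sub hG).sub hH).integrable_pow 3)
  · exact (((hF.add hG).add hH).integrable_pow 3)
  · exact (((hF.add hG).sub hH).integrable_pow 3)
  · exact (((hF.add hG).add hH).integrable_pow 3).sub (((hF.add hG).sub hH).integrable_pow 3)
  · exact (((hF.sub hG).add hH).integrable_pow 3).sub (((hF.sub hG).sub hH).integrable_pow 3)

end Averages

/-! ### Stochastic expansions -/

section Jets

variable {ι : Type*} [Fintype ι]

/-- The linear form with coefficients `L`. -/
def linForm (L : ι → ℝ) (v : ι → ℝ) : ℝ := ∑ i, L i * v i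

/-- The quadratic form with coefficients `Q`. -/
def quadForm (Q : ι → ι → ℝ) (v : ι → ℝ) : ℝ := ∑ i, ∑ j, Q i j * (v i * v j)

/-- The cubic form with coefficients `C`. -/
def cubForm (C : ι → ι → ι → ℝ) (v : ι → ℝ) : ℝ := ∑ i, ∑ j, ∑ k, C i j k * (v i * v j * v k)

/-- The contraction of two linear forms with a matrix `S`. -/
def contract (S : ι → ι → ℝ) (L L' : ι → ℝ) : ℝ := ∑ i, ∑ j, L i * L' j * S i j

lemma linForm_add (L L' v : ι → ℝ) : linForm (L + L') v = linForm L v + linForm L' v := by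
  simp [linForm, add_mul, Finset.sum_add_distrib]

lemma linForm_smul (a : ℝ) (L v : ι → ℝ) : linForm (a • L) v = a * linForm L v := by
  simp [linForm, Finset.mul_sum, mul_assoc]

lemma quadForm_add (Q Q' : ι → ι → ℝ) (v : ι → ℝ) :
    quadForm (Q + Q') v = quadForm Q v + quadForm Q' v := by
  simp [quadForm, add_mul, Finset.sum_add_distrib]

lemma quadForm_smul (a : ℝ) (Q : ι → ι → ℝ) (v : ι → ℝ) :
    quadForm (a • Q) v = a * quadForm Q v := by
  simp [quadForm, Finset.mul_sum, mul_assoc]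

lemma cubForm_add (C C' : ι → ι → ι → ℝ) (v : ι → ℝ) :
    cubForm (C + C') v = cubForm C v + cubForm C' v := by
  simp [cubForm, add_mul, Finset.sum_add_distrib]

lemma cubForm_smul (a : ℝ) (C : ι → ι → ι → ℝ) (v : ι → ℝ) :
    cubForm (a • C) v = a * cubForm C v := by
  simp [cubForm, Finset.mul_sum, mul_assoc]

lemma linForm_mul_linForm (L L' v : ι → ℝ) :
    linForm L v * linForm L' v = quadForm (fun i j => L i * L' j) v := by
  rw [linForm, linForm, Finset.sum_mul_sum, quadForm]
  exact Finset.sum_congr rfl fun i _ => Finset.sum_congr rfl fun j _ => by ring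

lemma linForm_mul_quadForm (L : ι → ℝ) (Q : ι → ι → ℝ) (v : ι → ℝ) :
    linForm L v * quadForm Q v = cubForm (fun i j k => L i * Q j k) v := by
  rw [linForm, quadForm, Finset.sum_mul, cubForm]
  refine Finset.sum_congr rfl fun i _ => ?_
  rw [Finset.mul_sum]
  refine Finset.sum_congr rfl fun j _ => ?_
  rw [Finset.mul_sum]
  exact Finset.sum_congr rfl fun k _ => by ring

lemma abs_linForm_le (L v : ι → ℝ) : |linForm L v| ≤ (∑ i, |L i|) * ‖v‖ := by
  rw [linForm, Finset.sum_mul]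
  refine (Finset.abs_sum_le_sum_abs _ _).trans (Finset.sum_le_sum fun i _ => ?_)
  rw [abs_mul]
  gcongr
  exact norm_le_pi_norm v i

lemma abs_quadForm_le (Q : ι → ι → ℝ) (v : ι → ℝ) :
    |quadForm Q v| ≤ (∑ i, ∑ j, |Q i j|) * ‖v‖ ^ 2 := by
  rw [quadForm, Finset.sum_mul]
  refine (Finset.abs_sum_le_sum_abs _ _).trans (Finset.sum_le_sum fun i _ => ?_)
  rw [Finset.sum_mul]
  refine (Finset.abs_sum_le_sum_abs _ _).trans (Finset.sum_le_sum fun j _ => ?_)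
  rw [abs_mul, abs_mul, sq]
  gcongr
  exacts [norm_le_pi_norm v i, norm_le_pi_norm v j]

lemma abs_cubForm_le (C : ι → ι → ι → ℝ) (v : ι → ℝ) :
    |cubForm C v| ≤ (∑ i, ∑ j, ∑ k, |C i j k|) * ‖v‖ ^ 3 := by
  rw [cubForm, Finset.sum_mul]
  refine (Finset.abs_sum_le_sum_abs _ _).trans (Finset.sum_le_sum fun i _ => ?_)
  rw [Finset.sum_mul]
  refine (Finset.abs_sum_le_sum_abs _ _).trans (Finset.sum_le_sum fun j _ => ?_)
  rw [Finset.sum_mul]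
  refine (Finset.abs_sum_le_sum_abs _ _).trans (Finset.sum_le_sum fun k _ => ?_)
  rw [abs_mul, abs_mul, abs_mul, pow_succ, sq]
  gcongr
  exacts [norm_le_pi_norm v i, norm_le_pi_norm v j, norm_le_pi_norm v k]

variable {Ω : Type*} {l : Filter Ω} {ξ : Ω → ι → ℝ} {S : ι → ι → ℝ}

/-- `X = c + L(ξ) + Q(ξ) + C(ξ) + O(|ξ|ᴺ)` along `l`, where the quadratic form `Q` has contraction
`B` with `S`. -/
def HasExpansion (l : Filter Ω) (ξ : Ω → ι → ℝ) (S : ι → ι → ℝ) (N : ℕ) (X : Ω → ℝ)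
    (c : ℝ) (L : ι → ℝ) (B : ℝ) : Prop :=
  ∃ (Q : ι → ι → ℝ) (C : ι → ι → ι → ℝ), ∑ i, ∑ j, Q i j * S i j = B ∧
    (fun ω => X ω - (c + linForm L (ξ ω) + quadForm Q (ξ ω) + cubForm C (ξ ω))) =O[l]
      (fun ω => ‖ξ ω‖ ^ N)

lemma isBigO_linForm (L : ι → ℝ) : (fun ω => linForm L (ξ ω)) =O[l] (fun ω => ‖ξ ω‖ ^ 1) :=
  IsBigO.of_bound (∑ i, |L i|) (Eventually.of_forall fun ω => by
    simpa using abs_linForm_le L (ξ ω))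

lemma isBigO_quadForm (Q : ι → ι → ℝ) :
    (fun ω => quadForm Q (ξ ω)) =O[l] (fun ω => ‖ξ ω‖ ^ 2) :=
  IsBigO.of_bound (∑ i, ∑ j, |Q i j|) (Eventually.of_forall fun ω => by
    simpa using abs_quadForm_le Q (ξ ω))

lemma isBigO_cubForm (C : ι → ι → ι → ℝ) :
    (fun ω => cubForm C (ξ ω)) =O[l] (fun ω => ‖ξ ω‖ ^ 3) :=
  IsBigO.of_bound (∑ i, ∑ j, ∑ k, |C i j k|) (Eventually.of_forall fun ω => by
    simpa using abs_cubForm_le C (ξ ω))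

lemma isBigO_norm_pow (hξ : Tendsto ξ l (𝓝 0)) {M N : ℕ} (h : N ≤ M) :
    (fun ω => ‖ξ ω‖ ^ M) =O[l] (fun ω => ‖ξ ω‖ ^ N) := by
  refine IsBigO.of_bound 1 ?_
  have h1 : ∀ᶠ ω in l, ‖ξ ω‖ < 1 := by
    have := hξ.norm
    rw [norm_zero] at this
    exact this.eventually (gt_mem_nhds one_pos)
  filter_upwards [h1] with ω hω
  simpa using pow_le_pow_of_le_one (norm_nonneg _) hω.le h

lemma IsBigO.mul_norm_pow {f g : Ω → ℝ} {M N : ℕ} (hf : f =O[l] (fun ω => ‖ξ ω‖ ^ M))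
    (hg : g =O[l] (fun ω => ‖ξ ω‖ ^ N)) :
    (fun ω => f ω * g ω) =O[l] (fun ω => ‖ξ ω‖ ^ (M + N)) := by
  simpa only [pow_add] using hf.mul hg

/-! ### The algebra of expansions -/

namespace HasExpansion

variable {N : ℕ} {X Y : Ω → ℝ} {c c' : ℝ} {L L' : ι → ℝ} {B B' : ℝ}

lemma mono (hξ : Tendsto ξ l (𝓝 0)) {M : ℕ} (h : HasExpansion l ξ S M X c L B) (hN : N ≤ M) :
    HasExpansion l ξ S N X c L B := by
  obtain ⟨Q, C, hB, hX⟩ := h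
  exact ⟨Q, C, hB, hX.trans (isBigO_norm_pow hξ hN)⟩

lemma congr_isBigO (h : HasExpansion l ξ S N X c L B)
    (hY : (fun ω => Y ω - X ω) =O[l] (fun ω => ‖ξ ω‖ ^ N)) : HasExpansion l ξ S N Y c L B := by
  obtain ⟨Q, C, hB, hX⟩ := h
  exact ⟨Q, C, hB, (hY.add hX).congr_left fun ω => by ring⟩

lemma congr (h : HasExpansion l ξ S N X c L B) (hY : X =ᶠ[l] Y) : HasExpansion l ξ S N Y c L B := by
  refine h.congr_isBigO (EventuallyEq.trans_isBigO ?_ (isBigO_zero _ _))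
  filter_upwards [hY] with ω hω
  simp [hω]

lemma of_eq (h : HasExpansion l ξ S N X c L B) (hc : c = c') (hL : L = L') (hB : B = B') :
    HasExpansion l ξ S N X c' L' B' := by
  subst hc hL hB
  exact h

lemma const (c : ℝ) : HasExpansion l ξ S N (fun _ => c) c 0 0 :=
  ⟨0, 0, by simp, by simpa [linForm, quadForm, cubForm] using isBigO_zero _ _⟩

lemma coord [DecidableEq ι] (i : ι) :
    HasExpansion l ξ S N (fun ω => ξ ω i) 0 (Pi.single i 1) 0 :=
  ⟨0, 0, by simp, by
    simpa [linForm, quadForm, cubForm, Pi.single_apply] using isBigO_zero _ _⟩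

lemma of_isBigO (hX : X =O[l] (fun ω => ‖ξ ω‖ ^ N)) : HasExpansion l ξ S N X 0 0 0 :=
  (const 0).congr_isBigO (by simpa using hX)

lemma add (hX : HasExpansion l ξ S N X c L B) (hY : HasExpansion l ξ S N Y c' L' B') :
    HasExpansion l ξ S N (fun ω => X ω + Y ω) (c + c') (L + L') (B + B') := by
  obtain ⟨Q, C, rfl, hX⟩ := hX
  obtain ⟨Q', C', rfl, hY⟩ := hY
  refine ⟨Q + Q', C + C', ?_, (hX.add hY).congr_left fun ω => ?_⟩
  · simp [add_mul, Finset.sum_add_distrib]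
  · rw [linForm_add, quadForm_add, cubForm_add]
    ring

lemma const_mul (a : ℝ) (hX : HasExpansion l ξ S N X c L B) :
    HasExpansion l ξ S N (fun ω => a * X ω) (a * c) (a • L) (a * B) := by
  obtain ⟨Q, C, rfl, hX⟩ := hX
  refine ⟨a • Q, a • C, ?_, (hX.const_mul_left a).congr_left fun ω => ?_⟩
  · simp [Finset.mul_sum, mul_assoc]
  · rw [linForm_smul, quadForm_smul, cubForm_smul]
    ring

lemma sub (hX : HasExpansion l ξ S N X c L B) (hY : HasExpansion l ξ S N Y c' L' B') :
    HasExpansion l ξ S N (fun ω => X ω - Y ω) (c - c') (L - L') (B - B') := by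
  have h := hX.add (hY.const_mul (-1))
  refine (h.congr (Eventually.of_forall fun ω => by ring)).of_eq (by ring) ?_ (by ring)
  rw [neg_one_smul, sub_eq_add_neg]

lemma isBigO_zero_const (hξ : Tendsto ξ l (𝓝 0)) (hN : 1 ≤ N)
    (hX : HasExpansion l ξ S N X 0 L B) : X =O[l] (fun ω => ‖ξ ω‖ ^ 1) := by
  obtain ⟨Q, C, -, hX⟩ := hX
  have h := (((hX.trans (isBigO_norm_pow hξ hN)).add (isBigO_linForm L)).add
    ((isBigO_quadForm Q).trans (isBigO_norm_pow hξ (by norm_num)))).add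
    ((isBigO_cubForm C).trans (isBigO_norm_pow hξ (by norm_num)))
  exact h.congr_left fun ω => by ring

lemma sub_const_isBigO (hξ : Tendsto ξ l (𝓝 0)) (hN : 1 ≤ N)
    (hX : HasExpansion l ξ S N X c L B) : (fun ω => X ω - c) =O[l] (fun ω => ‖ξ ω‖ ^ 1) :=
  isBigO_zero_const hξ hN ((hX.sub (const c)).of_eq (sub_self c) (sub_zero L) (sub_zero B))

lemma tendsto (hξ : Tendsto ξ l (𝓝 0)) (hN : 1 ≤ N) (hX : HasExpansion l ξ S N X c L B) :
    Tendsto X l (𝓝 c) := by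
  have h := (hX.sub_const_isBigO hξ hN).trans_tendsto (by simpa using hξ.norm)
  simpa using h.add_const c

/-- A product of two expansions, where `p ∈ {0, 1}` records whether both constant terms vanish. -/
lemma mul_aux (hξ : Tendsto ξ l (𝓝 0)) (p : ℕ) (hN : p ≤ N) (hN4 : N + p ≤ 4)
    (hX : HasExpansion l ξ S N X c L B)
    (hY : HasExpansion l ξ S N Y c' L' B')
    (hc : p = 0 ∨ p = 1 ∧ c = 0 ∧ c' = 0) :
    HasExpansion l ξ S (N + p) (fun ω => X ω * Y ω) (c * c') (c • L' + c' • L)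
      (c * B' + c' * B + contract S L L') := by
  obtain ⟨Q, C, rfl, hX⟩ := hX
  obtain ⟨Q', C', rfl, hY⟩ := hY
  set J : Ω → ℝ := fun ω => c + linForm L (ξ ω) + quadForm Q (ξ ω) + cubForm C (ξ ω) with hJ
  set J' : Ω → ℝ := fun ω => c' + linForm L' (ξ ω) + quadForm Q' (ξ ω) + cubForm C' (ξ ω) with hJ'
  have hJO : ∀ (c : ℝ) (L : ι → ℝ) (Q : ι → ι → ℝ) (C : ι → ι → ι → ℝ),
      (p = 0 ∨ p = 1 ∧ c = 0) → (fun ω => c + linForm L (ξ ω) + quadForm Q (ξ ω) +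
        cubForm C (ξ ω)) =O[l] (fun ω => ‖ξ ω‖ ^ p) := by
    intro c L Q C hp
    have hp1 : p ≤ 1 := by omega
    have hcc : (fun _ : Ω => c) =O[l] (fun ω => ‖ξ ω‖ ^ p) := by
      rcases hp with rfl | ⟨-, rfl⟩
      · simpa using isBigO_const_const c (one_ne_zero : (1 : ℝ) ≠ 0) l
      · exact isBigO_zero _ _
    exact ((hcc.add ((isBigO_linForm L).trans (isBigO_norm_pow hξ hp1))).add
      ((isBigO_quadForm Q).trans (isBigO_norm_pow hξ (by omega)))).add
      ((isBigO_cubForm C).trans (isBigO_norm_pow hξ (by omega)))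
  have hJb : J =O[l] (fun ω => ‖ξ ω‖ ^ p) := hJO c L Q C (by tauto)
  have hJb' : J' =O[l] (fun ω => ‖ξ ω‖ ^ p) := hJO c' L' Q' C' (by tauto)
  -- The product of the two cubic jets, cut off after degree three. The quadratic form `L ⊗ L'`
  -- produces the term `contract S L L'`.
  refine ⟨(fun i j => L i * L' j) + (c • Q' + c' • Q), (c • C' + c' • C) +
    ((fun i j k => L i * Q' j k) + (fun i j k => L' i * Q j k)), ?_, ?_⟩
  · simp [add_mul, Finset.sum_add_distrib, contract, Finset.mul_sum, mul_assoc]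
    ring
  · have hl := isBigO_linForm (ξ := ξ) (l := l) L
    have hl' := isBigO_linForm (ξ := ξ) (l := l) L'
    have hq := isBigO_quadForm (ξ := ξ) (l := l) Q
    have hq' := isBigO_quadForm (ξ := ξ) (l := l) Q'
    have ht := isBigO_cubForm (ξ := ξ) (l := l) C
    have ht' := isBigO_cubForm (ξ := ξ) (l := l) C'
    have e : ∀ {f : Ω → ℝ} {M : ℕ}, f =O[l] (fun ω => ‖ξ ω‖ ^ M) → N + p ≤ M →
        f =O[l] (fun ω => ‖ξ ω‖ ^ (N + p)) := fun hf hM => hf.trans (isBigO_norm_pow hξ hM)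
    -- `XY - JJ' = J(Y - J') + (X - J)J' + (X - J)(Y - J')` accounts for three error terms; the
    -- other six are the products of forms of total degree at least four.
    have h1 := e (IsBigO.mul_norm_pow hJb hY) (by omega)
    have h2 := e (IsBigO.mul_norm_pow hX hJb') (by omega)
    have h3 := e (IsBigO.mul_norm_pow hX hY) (by omega)
    have h4 := e (IsBigO.mul_norm_pow hl ht') (by omega)
    have h5 := e (IsBigO.mul_norm_pow hq hq') (by omega)
    have h6 := e (IsBigO.mul_norm_pow ht hl') (by omega)
    have h7 := e (IsBigO.mul_norm_pow hq ht') (by omega)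
    have h8 := e (IsBigO.mul_norm_pow ht hq') (by omega)
    have h9 := e (IsBigO.mul_norm_pow ht ht') (by omega)
    refine ((((((((h1.add h2).add h3).add h4).add h5).add h6).add h7).add h8).add h9).congr_left
      fun ω => ?_
    rw [linForm_add, linForm_smul, linForm_smul, quadForm_add, quadForm_add, quadForm_smul,
      quadForm_smul, cubForm_add, cubForm_add, cubForm_add, cubForm_smul, cubForm_smul,
      ← linForm_mul_linForm, ← linForm_mul_quadForm, ← linForm_mul_quadForm]
    simp only [hJ, hJ']
    ring

lemma mul (hξ : Tendsto ξ l (𝓝 0)) (hN4 : N ≤ 4)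
    (hX : HasExpansion l ξ S N X c L B) (hY : HasExpansion l ξ S N Y c' L' B') :
    HasExpansion l ξ S N (fun ω => X ω * Y ω) (c * c') (c • L' + c' • L)
      (c * B' + c' * B + contract S L L') :=
  mul_aux hξ 0 (Nat.zero_le _) hN4 hX hY (Or.inl rfl)

/-- When both factors are `O(|ξ|)` the remainder of the product gains one power. This gain drives
the iteration for implicitly defined quantities. -/
lemma mul_of_zero (hξ : Tendsto ξ l (𝓝 0)) (hN : 1 ≤ N) (hN4 : N + 1 ≤ 4)
    (hX : HasExpansion l ξ S N X 0 L B) (hY : HasExpansion l ξ S N Y 0 L' B') :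
    HasExpansion l ξ S (N + 1) (fun ω => X ω * Y ω) 0 0 (contract S L L') :=
  (mul_aux hξ 1 hN hN4 hX hY (Or.inr ⟨rfl, rfl, rfl⟩)).of_eq (by simp) (by simp) (by simp)

lemma contract_zero_left (L : ι → ℝ) : contract S 0 L = 0 := by simp [contract]

/-- The cubic Taylor polynomial of `φ` is substituted into the expansion of `X - c`. Its third-order
term leaves no trace in the linear part or in the contraction, because the square of `X - c` already
has zero linear part. -/
lemma comp (hξ : Tendsto ξ l (𝓝 0)) (hX : HasExpansion l ξ S 4 X c L B) {φ : ℝ → ℝ}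
    {a₀ a₁ a₂ a₃ : ℝ} (hφ : (fun t => φ (c + t) - (a₀ + a₁ * t + a₂ * t ^ 2 + a₃ * t ^ 3))
      =O[𝓝 0] (fun t => t ^ 4)) :
    HasExpansion l ξ S 4 (fun ω => φ (X ω)) a₀ (a₁ • L) (a₁ * B + a₂ * contract S L L) := by
  have hD : HasExpansion l ξ S 4 (fun ω => X ω - c) 0 L B :=
    (hX.sub (const c)).of_eq (by simp) (by simp) (by simp)
  have hD2 := mul hξ le_rfl hD hD
  have hD3 := mul hξ le_rfl hD2 hD
  have hsum := (((const (l := l) (ξ := ξ) (S := S) (N := 4) a₀).add (hD.const_mul a₁)).add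
    (hD2.const_mul a₂)).add (hD3.const_mul a₃)
  refine (hsum.congr_isBigO (Y := fun ω => φ (X ω)) ?_).of_eq (by simp) (by simp)
    (by simp [contract_zero_left])
  have ht : Tendsto (fun ω => X ω - c) l (𝓝 0) := hD.tendsto hξ (by norm_num)
  have hO := (hφ.comp_tendsto ht).trans ((hD.isBigO_zero_const hξ (by norm_num)).pow 4)
  refine (hO.congr_left fun ω => ?_).congr_right fun ω => by simp
  simp only [Function.comp_apply, add_sub_cancel]
  ring

end HasExpansion

end Jets

/-! ### Expectations of estimators with a stochastic expansion -/

/-- A sample of arbitrary size. -/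
abbrev Sample := Σ n : ℕ, (Fin n → ℝ)

variable {ι : Type*}

/-- The vector of averages of the functions `φ i` over a sample. -/
def avgs (φ : ι → ℝ → ℝ) (ω : Sample) : ι → ℝ := fun i => avg (φ i) ω.2

/-- The filter of large samples in `V` whose averages of the `φ i` are small. -/
def goodFilter (φ : ι → ℝ → ℝ) (V : Set Sample) : Filter Sample :=
  comap (fun ω => (ω.1, avgs φ ω)) (atTop ×ˢ 𝓝 0) ⊓ 𝓟 V

section Filter

variable {φ : ι → ℝ → ℝ} {V : Set Sample}

lemma tendsto_avgs : Tendsto (avgs φ) (goodFilter φ V) (𝓝 0) :=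
  (tendsto_snd.comp tendsto_comap).mono_left inf_le_left

lemma tendsto_size : Tendsto (fun ω : Sample => ω.1) (goodFilter φ V) atTop :=
  (tendsto_fst.comp (tendsto_comap (f := fun ω : Sample => (ω.1, avgs φ ω)))).mono_left inf_le_left

lemma eventually_valid : ∀ᶠ ω in goodFilter φ V, ω ∈ V :=
  (eventually_principal.2 fun _ h => h : ∀ᶠ ω in 𝓟 V, ω ∈ V).filter_mono inf_le_right

lemma eventually_goodFilter [Fintype ι] {p : Sample → Prop} (h : ∀ᶠ ω in goodFilter φ V, p ω) :
    ∃ r > 0, ∃ N : ℕ, ∀ ω : Sample, N ≤ ω.1 → ω ∈ V → ‖avgs φ ω‖ < r → p ω := by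
  rw [goodFilter, eventually_inf_principal, eventually_comap] at h
  obtain ⟨pa, ha, pb, hb, hab⟩ := eventually_prod_iff.1 h
  obtain ⟨N, hN⟩ := eventually_atTop.1 ha
  obtain ⟨r, hr, hb⟩ := Metric.eventually_nhds_iff.1 hb
  refine ⟨r, hr, N, fun ω hn hV hx => hab (hN _ hn) (hb ?_) ω rfl hV⟩
  simpa using hx

end Filter

variable [Fintype ι]

lemma norm_pow_le_sum (v : ι → ℝ) {p : ℕ} (hp : p ≠ 0) : ‖v‖ ^ (2 * p) ≤ ∑ i, v i ^ (2 * p) := by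
  have h0 : ∀ i, 0 ≤ v i ^ (2 * p) := fun i => (even_two_mul p).pow_nonneg _
  rcases isEmpty_or_nonempty ι with he | he
  · have : v = 0 := Subsingleton.elim _ _
    simp [this, hp]
  · obtain ⟨i, hi⟩ := Finite.exists_max fun i => |v i|
    have hv : ‖v‖ ≤ |v i| := (pi_norm_le_iff_of_nonneg (abs_nonneg _)).2 hi
    refine (pow_le_pow_left₀ (norm_nonneg _) hv _).trans ?_
    rw [(even_two_mul p).pow_abs]
    exact Finset.single_le_sum (fun i _ => h0 i) (Finset.mem_univ i)

variable {P : Measure ℝ}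

/-- The `3/2`-th absolute moments of `T` grow at most polynomially in the sample size. -/
def Tame (P : Measure ℝ) (T : Sample → ℝ) : Prop :=
  ∃ (C : ℝ) (q : ℕ), 0 ≤ C ∧ ∀ᶠ n : ℕ in atTop,
    AEStronglyMeasurable (fun x : Fin n → ℝ => T ⟨n, x⟩) (Measure.pi fun _ => P) ∧
    Integrable (fun x : Fin n → ℝ => |T ⟨n, x⟩| ^ (3 / 2 : ℝ)) (Measure.pi fun _ => P) ∧
    ∫ x : Fin n → ℝ, |T ⟨n, x⟩| ^ (3 / 2 : ℝ) ∂(Measure.pi fun _ => P) ≤ C * (n : ℝ) ^ q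

/-- Truncation at level `R²`: above it, `t = t^{3/2} / t^{1/2} ≤ t^{3/2} / R`. This is what the
exponent `3/2 > 1` in `Tame` is for. -/
lemma le_sq_add_rpow_div {t R : ℝ} (ht : 0 ≤ t) (hR : 0 < R) :
    t ≤ R ^ 2 + t ^ (3 / 2 : ℝ) / R := by
  rcases le_total t (R ^ 2) with h | h
  · have : 0 ≤ t ^ (3 / 2 : ℝ) / R := by positivity
    linarith
  · have h1 : R ≤ t ^ (1 / 2 : ℝ) := by
      rw [← sqrt_eq_rpow]
      exact le_sqrt_of_sq_le h
    have h2 : t ^ (3 / 2 : ℝ) = t * t ^ (1 / 2 : ℝ) := by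
      rw [← rpow_one_add' ht (by norm_num)]
      norm_num
    have h3 : t ≤ t ^ (3 / 2 : ℝ) / R := by
      rw [le_div_iff₀ hR, h2]
      gcongr
    have : 0 ≤ R ^ 2 := by positivity
    linarith

variable [IsProbabilityMeasure P]

lemma Tame.integrable {T : Sample → ℝ} (hT : Tame P T) :
    ∀ᶠ n : ℕ in atTop, Integrable (fun x : Fin n → ℝ => T ⟨n, x⟩) (Measure.pi fun _ => P) := by
  obtain ⟨C, q, -, h⟩ := hT
  filter_upwards [h] with n ⟨h1, h2, _⟩
  refine ((integrable_const (1 : ℝ)).add h2).mono' h1 (Eventually.of_forall fun x => ?_)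
  simpa using le_sq_add_rpow_div (abs_nonneg (T ⟨n, x⟩)) one_pos

variable {φ : ι → ℝ → ℝ} {V : Set Sample}

lemma integral_sum_avgs_pow_le (hφ : ∀ i, Centred (φ i) P) (p : ℕ) : ∃ C : ℝ, 0 ≤ C ∧
    ∀ n : ℕ, 1 ≤ n → ∫ x : Fin n → ℝ, ∑ i, avgs φ ⟨n, x⟩ i ^ (2 * p) ∂(Measure.pi fun _ => P) ≤
      C / (n : ℝ) ^ p := by
  choose C hC0 hC using fun i => abs_integral_avg_pow_le (hφ i).1 (hφ i).2 (hφ i).3 (2 * p)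
  refine ⟨∑ i, C i, Finset.sum_nonneg fun i _ => hC0 i, fun n hn => ?_⟩
  simp only [avgs]
  rw [integral_finsetSum _ fun i _ => (allMoments_avg (hφ i).2).integrable_pow (2 * p),
    Finset.sum_div]
  refine Finset.sum_le_sum fun i _ => (le_abs_self _).trans ((hC i n hn).trans_eq ?_)
  congr 2
  omega

lemma integrable_sum_avgs_pow (hφ : ∀ i, Centred (φ i) P) (p n : ℕ) :
    Integrable (fun x : Fin n → ℝ => ∑ i, avgs φ ⟨n, x⟩ i ^ p) (Measure.pi fun _ => P) :=
  integrable_finsetSum _ fun i _ => (allMoments_avg (hφ i).2).integrable_pow _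

/-- The covariance matrix of the functions `φ i`. -/
def covMatrix (P : Measure ℝ) (φ : ι → ℝ → ℝ) (i j : ι) : ℝ := ∫ y, φ i y * φ j y ∂P

/-- The third-order Taylor polynomial with the given coefficients, evaluated at the averages. -/
def jetEval (c : ℝ) (L : ι → ℝ) (Q : ι → ι → ℝ) (C : ι → ι → ι → ℝ) (v : ι → ℝ) : ℝ :=
  c + linForm L v + quadForm Q v + cubForm C v

/-- Linear forms in centred averages integrate to zero, quadratic forms exactly to their contraction
with the covariance matrix over `n`, and cubic forms to `O(n⁻²)`. -/
lemma integral_jetEval (hφ : ∀ i, Centred (φ i) P) (c : ℝ) (L : ι → ℝ) (Q : ι → ι → ℝ)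
    (C : ι → ι → ι → ℝ) : ∃ K : ℝ, ∀ n : ℕ, 1 ≤ n →
      Integrable (fun x : Fin n → ℝ => jetEval c L Q C (avgs φ ⟨n, x⟩)) (Measure.pi fun _ => P) ∧
      |∫ x : Fin n → ℝ, jetEval c L Q C (avgs φ ⟨n, x⟩) ∂(Measure.pi fun _ => P)
        - (c + (∑ i, ∑ j, Q i j * covMatrix P φ i j) / n)| ≤ K / (n : ℝ) ^ 2 := by
  choose K hK using fun i j k => abs_integral_avg_mul_avg_mul_avg_le (hφ i) (hφ j) (hφ k)
  refine ⟨∑ i, ∑ j, ∑ k, |C i j k| * K i j k, fun n hn => ?_⟩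
  have hA := fun i => allMoments_avg (n := n) (hφ i).2
  have i1 : ∀ i, Integrable (fun x : Fin n → ℝ => L i * avgs φ ⟨n, x⟩ i) (Measure.pi fun _ => P) :=
    fun i => (hA i).integrable.const_mul _
  have i2 : ∀ i j, Integrable (fun x : Fin n → ℝ => Q i j * (avgs φ ⟨n, x⟩ i * avgs φ ⟨n, x⟩ j))
      (Measure.pi fun _ => P) := fun i j => ((hA i).mul (hA j)).integrable.const_mul _
  have i3 : ∀ i j k, Integrable (fun x : Fin n → ℝ => C i j k *
      (avgs φ ⟨n, x⟩ i * avgs φ ⟨n, x⟩ j * avgs φ ⟨n, x⟩ k)) (Measure.pi fun _ => P) :=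
    fun i j k => (((hA i).mul (hA j)).mul (hA k)).integrable.const_mul _
  have I1 : Integrable (fun x : Fin n → ℝ => linForm L (avgs φ ⟨n, x⟩)) (Measure.pi fun _ => P) :=
    integrable_finsetSum _ fun i _ => i1 i
  have I2 : Integrable (fun x : Fin n → ℝ => quadForm Q (avgs φ ⟨n, x⟩)) (Measure.pi fun _ => P) :=
    integrable_finsetSum _ fun i _ => integrable_finsetSum _ fun j _ => i2 i j
  have I3 : Integrable (fun x : Fin n → ℝ => cubForm C (avgs φ ⟨n, x⟩)) (Measure.pi fun _ => P) :=
    integrable_finsetSum _ fun i _ => integrable_finsetSum _ fun j _ =>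
      integrable_finsetSum _ fun k _ => i3 i j k
  have I0 : Integrable (fun _ : Fin n → ℝ => c) (Measure.pi fun _ => P) := integrable_const c
  refine ⟨((I0.add I1).add I2).add I3, ?_⟩
  have E1 : ∫ x : Fin n → ℝ, linForm L (avgs φ ⟨n, x⟩) ∂(Measure.pi fun _ => P) = 0 := by
    simp only [linForm]
    rw [integral_finsetSum _ fun i _ => i1 i]
    refine Finset.sum_eq_zero fun i _ => ?_
    rw [integral_const_mul]
    simp [avgs, (hφ i).integral_avg n]
  have E2 : ∫ x : Fin n → ℝ, quadForm Q (avgs φ ⟨n, x⟩) ∂(Measure.pi fun _ => P) =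
      (∑ i, ∑ j, Q i j * covMatrix P φ i j) / n := by
    simp only [quadForm]
    rw [integral_finsetSum _ fun i _ => integrable_finsetSum _ fun j _ => i2 i j, Finset.sum_div]
    refine Finset.sum_congr rfl fun i _ => ?_
    rw [integral_finsetSum _ fun j _ => i2 i j, Finset.sum_div]
    refine Finset.sum_congr rfl fun j _ => ?_
    rw [integral_const_mul, covMatrix, mul_div_assoc]
    congr 1
    exact integral_avg_mul_avg (hφ i) (hφ j) hn
  have E3 : |∫ x : Fin n → ℝ, cubForm C (avgs φ ⟨n, x⟩) ∂(Measure.pi fun _ => P)| ≤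
      (∑ i, ∑ j, ∑ k, |C i j k| * K i j k) / (n : ℝ) ^ 2 := by
    simp only [cubForm]
    rw [integral_finsetSum _ fun i _ => integrable_finsetSum _ fun j _ =>
      integrable_finsetSum _ fun k _ => i3 i j k, Finset.sum_div]
    refine (Finset.abs_sum_le_sum_abs _ _).trans (Finset.sum_le_sum fun i _ => ?_)
    rw [integral_finsetSum _ fun j _ => integrable_finsetSum _ fun k _ => i3 i j k, Finset.sum_div]
    refine (Finset.abs_sum_le_sum_abs _ _).trans (Finset.sum_le_sum fun j _ => ?_)
    rw [integral_finsetSum _ fun k _ => i3 i j k, Finset.sum_div]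
    refine (Finset.abs_sum_le_sum_abs _ _).trans (Finset.sum_le_sum fun k _ => ?_)
    rw [integral_const_mul, abs_mul, mul_div_assoc]
    gcongr
    exact hK i j k n hn
  have I01 : Integrable (fun x : Fin n → ℝ => c + linForm L (avgs φ ⟨n, x⟩))
      (Measure.pi fun _ => P) := I0.add I1
  have I012 : Integrable (fun x : Fin n → ℝ => c + linForm L (avgs φ ⟨n, x⟩) +
      quadForm Q (avgs φ ⟨n, x⟩)) (Measure.pi fun _ => P) := I01.add I2
  simp only [jetEval]
  rw [integral_add I012 I3, integral_add I01 I2, integral_add I0 I1, E1, E2]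
  simpa using E3

lemma abs_jetEval_le (c : ℝ) (L : ι → ℝ) (Q : ι → ι → ℝ) (C : ι → ι → ι → ℝ) {r : ℝ} (hr : 0 < r) :
    ∃ K : ℝ, 0 ≤ K ∧ ∀ v : ι → ℝ, r ≤ ‖v‖ → |jetEval c L Q C v| ≤ K * ‖v‖ ^ 4 := by
  refine ⟨|c| / r ^ 4 + (∑ i, |L i|) / r ^ 3 + (∑ i, ∑ j, |Q i j|) / r ^ 2 +
    (∑ i, ∑ j, ∑ k, |C i j k|) / r, by positivity, fun v hv => ?_⟩
  have h1 : 1 ≤ ‖v‖ / r := by rwa [one_le_div hr]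
  have hc : |c| ≤ |c| / r ^ 4 * ‖v‖ ^ 4 := by
    calc |c| = |c| * 1 := by ring
      _ ≤ |c| * (‖v‖ / r) ^ 4 := by gcongr; exact one_le_pow₀ h1
      _ = _ := by rw [div_pow]; ring
  have hl : |linForm L v| ≤ (∑ i, |L i|) / r ^ 3 * ‖v‖ ^ 4 := by
    calc |linForm L v| ≤ (∑ i, |L i|) * ‖v‖ * 1 := by simpa using abs_linForm_le L v
      _ ≤ (∑ i, |L i|) * ‖v‖ * (‖v‖ / r) ^ 3 := by gcongr; exact one_le_pow₀ h1
      _ = _ := by rw [div_pow]; ring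
  have hq : |quadForm Q v| ≤ (∑ i, ∑ j, |Q i j|) / r ^ 2 * ‖v‖ ^ 4 := by
    calc |quadForm Q v| ≤ (∑ i, ∑ j, |Q i j|) * ‖v‖ ^ 2 * 1 := by simpa using abs_quadForm_le Q v
      _ ≤ (∑ i, ∑ j, |Q i j|) * ‖v‖ ^ 2 * (‖v‖ / r) ^ 2 := by gcongr; exact one_le_pow₀ h1
      _ = _ := by rw [div_pow]; ring
  have ht : |cubForm C v| ≤ (∑ i, ∑ j, ∑ k, |C i j k|) / r * ‖v‖ ^ 4 := by
    calc |cubForm C v| ≤ (∑ i, ∑ j, ∑ k, |C i j k|) * ‖v‖ ^ 3 * 1 := by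
          simpa using abs_cubForm_le C v
      _ ≤ (∑ i, ∑ j, ∑ k, |C i j k|) * ‖v‖ ^ 3 * (‖v‖ / r) := by gcongr
      _ = _ := by ring
  rw [jetEval]
  calc _ ≤ |c| + |linForm L v| + |quadForm Q v| + |cubForm C v| :=
        (abs_add_le _ _).trans (add_le_add_left ((abs_add_le _ _).trans
          (add_le_add_left (abs_add_le _ _) _)) _)
    _ ≤ _ := by rw [add_mul, add_mul, add_mul]; gcongr

lemma one_le_sum_avgs_pow_div (ω : Sample) {r : ℝ} (hr : 0 < r) (h : r ≤ ‖avgs φ ω‖) {p : ℕ}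
    (hp : p ≠ 0) : 1 ≤ (∑ i, avgs φ ω i ^ (2 * p)) / r ^ (2 * p) := by
  rw [one_le_div (by positivity)]
  exact (pow_le_pow_left₀ hr.le h _).trans (norm_pow_le_sum _ hp)

/-- For small averages the error of the jet is `O(|ξ|⁴)`, with mean `O(n⁻²)`. For large averages the
jet is itself dominated by `|ξ|⁴`, and `T` is truncated by `le_sq_add_rpow_div`: the bounded part
meets the tiny probability of the event, the rest is controlled by the `3/2`-th moment. -/
theorem integral_sub_isBigO (hφ : ∀ i, Centred (φ i) P)
    (hV : ∀ᶠ n : ℕ in atTop, ∀ᵐ x ∂(Measure.pi fun _ : Fin n => P), (⟨n, x⟩ : Sample) ∈ V)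
    {T : Sample → ℝ} (hT : Tame P T) {c B : ℝ} {L : ι → ℝ}
    (hX : HasExpansion (goodFilter φ V) (avgs φ) (covMatrix P φ) 4 T c L B) :
    (fun n : ℕ => ∫ x : Fin n → ℝ, T ⟨n, x⟩ ∂(Measure.pi fun _ => P) - (c + B / n)) =O[atTop]
      (fun n : ℕ => 1 / (n : ℝ) ^ 2) := by
  obtain ⟨Q, C, rfl, hX⟩ := hX
  obtain ⟨K₁, hK₁, hX⟩ := hX.exists_nonneg
  obtain ⟨r, hr, N, hN⟩ := eventually_goodFilter hX.bound
  obtain ⟨K₂, hK₂, hjet⟩ := abs_jetEval_le c L Q C hr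
  obtain ⟨K₃, hE⟩ := integral_jetEval hφ c L Q C
  have hTi := hT.integrable
  obtain ⟨D, q, hD, hT⟩ := hT
  obtain ⟨M₁, hM₁, hM₁'⟩ := integral_sum_avgs_pow_le hφ 2
  -- Below, `R² = n^{2q+4}` multiplies the bound for the bad event, so moments of order `2(2q+6)`,
  -- of size `n^{-(2q+6)}`, leave `n⁻²`.
  obtain ⟨M₂, hM₂, hM₂'⟩ := integral_sum_avgs_pow_le hφ (2 * q + 6)
  refine IsBigO.of_bound ((K₁ + K₂) * M₁ + M₂ / r ^ (2 * (2 * q + 6)) + D + K₃) ?_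
  filter_upwards [hTi, hT, hV, eventually_ge_atTop N, eventually_ge_atTop 1] with n hTn
    ⟨hm, hint, hle⟩ hVn hn hn1
  obtain ⟨hJi, hJ⟩ := hE n hn1
  have hn0 : (0 : ℝ) < n := by positivity
  -- The `3/2`-th moment is at most `D n^q`, so dividing by `R` leaves `D / n²`.
  set R : ℝ := (n : ℝ) ^ (q + 2) with hR
  have hR0 : 0 < R := by positivity
  have hb : ∀ᵐ x ∂(Measure.pi fun _ : Fin n => P), |T ⟨n, x⟩ - jetEval c L Q C (avgs φ ⟨n, x⟩)| ≤
      (K₁ + K₂) * ∑ i, avgs φ ⟨n, x⟩ i ^ (2 * 2) +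
      (R ^ 2 / r ^ (2 * (2 * q + 6)) * ∑ i, avgs φ ⟨n, x⟩ i ^ (2 * (2 * q + 6)) +
      |T ⟨n, x⟩| ^ (3 / 2 : ℝ) / R) := by
    filter_upwards [hVn] with x hx
    have h4 := norm_pow_le_sum (avgs φ ⟨n, x⟩) two_ne_zero
    have h2p : 0 ≤ ∑ i, avgs φ ⟨n, x⟩ i ^ (2 * (2 * q + 6)) :=
      Finset.sum_nonneg fun i _ => (even_two_mul _).pow_nonneg _
    have h32 : 0 ≤ |T ⟨n, x⟩| ^ (3 / 2 : ℝ) := by positivity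
    rcases lt_or_ge ‖avgs φ ⟨n, x⟩‖ r with h | h
    · have := hN ⟨n, x⟩ hn hx h
      rw [Real.norm_eq_abs, Real.norm_of_nonneg (by positivity)] at this
      calc _ ≤ K₁ * ‖avgs φ ⟨n, x⟩‖ ^ 4 := this
        _ ≤ (K₁ + K₂) * ∑ i, avgs φ ⟨n, x⟩ i ^ (2 * 2) := by
          gcongr
          · linarith
        _ ≤ _ := le_add_of_nonneg_right (by positivity)
    · have h1 := one_le_sum_avgs_pow_div ⟨n, x⟩ hr h (p := 2 * q + 6) (by omega)
      have h5 : |T ⟨n, x⟩| ≤ R ^ 2 / r ^ (2 * (2 * q + 6)) *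
          ∑ i, avgs φ ⟨n, x⟩ i ^ (2 * (2 * q + 6)) + |T ⟨n, x⟩| ^ (3 / 2 : ℝ) / R := by
        refine (le_sq_add_rpow_div (abs_nonneg _) hR0).trans (add_le_add_left ?_ _)
        calc R ^ 2 = R ^ 2 * 1 := by ring
          _ ≤ R ^ 2 * ((∑ i, avgs φ ⟨n, x⟩ i ^ (2 * (2 * q + 6))) / r ^ (2 * (2 * q + 6))) := by
            gcongr
          _ = _ := by ring
      have h6 : |jetEval c L Q C (avgs φ ⟨n, x⟩)| ≤ (K₁ + K₂) * ∑ i, avgs φ ⟨n, x⟩ i ^ (2 * 2) := by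
        refine (hjet _ h).trans ?_
        gcongr
        linarith
      refine (abs_sub _ _).trans ?_
      linarith
  have hi4 := integrable_sum_avgs_pow hφ (2 * 2) n
  have hi2p := integrable_sum_avgs_pow hφ (2 * (2 * q + 6)) n
  have hia : Integrable (fun x : Fin n → ℝ => R ^ 2 / r ^ (2 * (2 * q + 6)) *
      ∑ i, avgs φ ⟨n, x⟩ i ^ (2 * (2 * q + 6)) + |T ⟨n, x⟩| ^ (3 / 2 : ℝ) / R)
      (Measure.pi fun _ => P) := (hi2p.const_mul _).add (hint.div_const R)
  have hI := integral_mono_ae (hTn.sub hJi).abs ((hi4.const_mul (K₁ + K₂)).add hia) hb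
  have hs : ∫ x : Fin n → ℝ, (K₁ + K₂) * ∑ i, avgs φ ⟨n, x⟩ i ^ (2 * 2) +
      (R ^ 2 / r ^ (2 * (2 * q + 6)) * ∑ i, avgs φ ⟨n, x⟩ i ^ (2 * (2 * q + 6)) +
      |T ⟨n, x⟩| ^ (3 / 2 : ℝ) / R) ∂(Measure.pi fun _ => P) ≤
      ((K₁ + K₂) * M₁ + M₂ / r ^ (2 * (2 * q + 6)) + D) * (1 / (n : ℝ) ^ 2) := by
    rw [integral_add (hi4.const_mul _) hia, integral_add (hi2p.const_mul _) (hint.div_const R),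
      integral_const_mul, integral_const_mul, integral_div]
    have a1 := hM₁' n hn1
    have a2 := hM₂' n hn1
    have b1 : R ^ 2 / r ^ (2 * (2 * q + 6)) * (M₂ / (n : ℝ) ^ (2 * q + 6)) =
        M₂ / r ^ (2 * (2 * q + 6)) * (1 / (n : ℝ) ^ 2) := by
      rw [hR]
      field_simp
      ring
    have b2 : D * (n : ℝ) ^ q / R = D * (1 / (n : ℝ) ^ 2) := by
      rw [hR]
      field_simp
      ring
    calc _ ≤ (K₁ + K₂) * (M₁ / (n : ℝ) ^ 2) + (R ^ 2 / r ^ (2 * (2 * q + 6)) *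
          (M₂ / (n : ℝ) ^ (2 * q + 6)) + D * (n : ℝ) ^ q / R) := by gcongr
      _ = _ := by rw [b1, b2]; ring
  rw [Real.norm_eq_abs, Real.norm_eq_abs, abs_of_pos (by positivity : 0 < 1 / (n : ℝ) ^ 2), add_mul]
  have hfin : |∫ x : Fin n → ℝ, T ⟨n, x⟩ ∂(Measure.pi fun _ => P) -
      ∫ x : Fin n → ℝ, jetEval c L Q C (avgs φ ⟨n, x⟩) ∂(Measure.pi fun _ => P)| ≤
      ((K₁ + K₂) * M₁ + M₂ / r ^ (2 * (2 * q + 6)) + D) * (1 / (n : ℝ) ^ 2) := by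
    rw [← integral_sub hTn hJi]
    exact abs_integral_le_integral_abs.trans (hI.trans hs)
  rw [div_eq_mul_one_div K₃] at hJ
  exact (abs_sub_le _ _ _).trans (add_le_add hfin hJ)

/-- The truncation of `integral_sub_isBigO` with the same exponents. The extra factor `n` turns the
bad contributions from `n⁻²` into `n⁻¹`, which still vanishes. -/
theorem tendsto_integral_sub (hφ : ∀ i, Centred (φ i) P)
    (hV : ∀ᶠ n : ℕ in atTop, ∀ᵐ x ∂(Measure.pi fun _ : Fin n => P), (⟨n, x⟩ : Sample) ∈ V)
    {T T' : Sample → ℝ} (hT : Tame P T) (hT' : Tame P T') {d : ℝ}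
    (hd : Tendsto (fun ω : Sample => (ω.1 : ℝ) * (T ω - T' ω)) (goodFilter φ V) (𝓝 d)) :
    Tendsto (fun n : ℕ => (n : ℝ) * (∫ x : Fin n → ℝ, T ⟨n, x⟩ ∂(Measure.pi fun _ => P) -
      ∫ x : Fin n → ℝ, T' ⟨n, x⟩ ∂(Measure.pi fun _ => P))) atTop (𝓝 d) := by
  have hTi := hT.integrable
  have hTi' := hT'.integrable
  obtain ⟨D₁, q₁, hD₁, hT⟩ := hT
  obtain ⟨D₂, q₂, hD₂, hT'⟩ := hT'
  set q := max q₁ q₂ with hq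
  obtain ⟨M, hM, hM'⟩ := integral_sum_avgs_pow_le hφ (2 * q + 6)
  rw [Metric.tendsto_atTop']
  intro ε hε
  obtain ⟨r, hr, N, hN⟩ := eventually_goodFilter (Metric.tendsto_nhds.1 hd (ε / 2) (by positivity))
  set K := (2 + |d|) / r ^ (2 * (2 * q + 6)) * M + (D₁ + D₂) with hK
  have hlim : ∀ᶠ n : ℕ in atTop, K / (n : ℝ) < ε / 2 :=
    (tendsto_const_div_atTop_nhds_zero_nat K).eventually (gt_mem_nhds (by positivity))
  refine eventually_atTop.1 ?_ |>.imp fun n h m hm => h m hm.le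
  filter_upwards [hTi, hTi', hT, hT', hV, eventually_ge_atTop N, eventually_ge_atTop 1, hlim] with n
    hTn hTn' ⟨hm, hint, hle⟩ ⟨hm', hint', hle'⟩ hVn hn hn1 hKn
  have hn0 : (0 : ℝ) < n := by positivity
  have hn1' : (1 : ℝ) ≤ n := by exact_mod_cast hn1
  set R : ℝ := (n : ℝ) ^ (q + 2) with hR
  have hR0 : 0 < R := by positivity
  have hR1 : 1 ≤ R := one_le_pow₀ hn1'
  have hb : ∀ᵐ x ∂(Measure.pi fun _ : Fin n => P), |n * (T ⟨n, x⟩ - T' ⟨n, x⟩) - d| ≤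
      ε / 2 + ((2 + |d|) * n * R ^ 2 / r ^ (2 * (2 * q + 6)) *
        ∑ i, avgs φ ⟨n, x⟩ i ^ (2 * (2 * q + 6)) +
      (n / R * |T ⟨n, x⟩| ^ (3 / 2 : ℝ) + n / R * |T' ⟨n, x⟩| ^ (3 / 2 : ℝ))) := by
    filter_upwards [hVn] with x hx
    have h2p : 0 ≤ ∑ i, avgs φ ⟨n, x⟩ i ^ (2 * (2 * q + 6)) :=
      Finset.sum_nonneg fun i _ => (even_two_mul _).pow_nonneg _
    rcases lt_or_ge ‖avgs φ ⟨n, x⟩‖ r with h | h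
    · have := hN ⟨n, x⟩ hn hx h
      rw [Real.dist_eq] at this
      exact this.le.trans (le_add_of_nonneg_right (by positivity))
    · have h1 := one_le_sum_avgs_pow_div ⟨n, x⟩ hr h (p := 2 * q + 6) (by omega)
      have h5 := le_sq_add_rpow_div (abs_nonneg (T ⟨n, x⟩)) hR0
      have h5' := le_sq_add_rpow_div (abs_nonneg (T' ⟨n, x⟩)) hR0
      have h6 : |n * (T ⟨n, x⟩ - T' ⟨n, x⟩) - d| ≤ n * (|T ⟨n, x⟩| + |T' ⟨n, x⟩|) + |d| := by
        refine (abs_sub _ _).trans (add_le_add_left ?_ _)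
        rw [abs_mul, Nat.abs_cast]
        gcongr
        exact abs_sub _ _
      have h7 : |d| ≤ |d| * n * R ^ 2 := by
        rw [mul_assoc]
        exact le_mul_of_one_le_right (abs_nonneg _)
          (one_le_mul_of_one_le_of_one_le hn1' (one_le_pow₀ hR1))
      have h8 : (2 + |d|) * n * R ^ 2 ≤ (2 + |d|) * n * R ^ 2 / r ^ (2 * (2 * q + 6)) *
          ∑ i, avgs φ ⟨n, x⟩ i ^ (2 * (2 * q + 6)) := by
        calc (2 + |d|) * n * R ^ 2 = (2 + |d|) * n * R ^ 2 * 1 := by ring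
          _ ≤ (2 + |d|) * n * R ^ 2 * ((∑ i, avgs φ ⟨n, x⟩ i ^ (2 * (2 * q + 6))) /
              r ^ (2 * (2 * q + 6))) := by gcongr
          _ = _ := by ring
      have h9 : n * (|T ⟨n, x⟩| + |T' ⟨n, x⟩|) ≤ n * ((R ^ 2 + |T ⟨n, x⟩| ^ (3 / 2 : ℝ) / R) +
          (R ^ 2 + |T' ⟨n, x⟩| ^ (3 / 2 : ℝ) / R)) := by gcongr
      have h10 : n * ((R ^ 2 + |T ⟨n, x⟩| ^ (3 / 2 : ℝ) / R) +
          (R ^ 2 + |T' ⟨n, x⟩| ^ (3 / 2 : ℝ) / R)) = 2 * n * R ^ 2 +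
          (n / R * |T ⟨n, x⟩| ^ (3 / 2 : ℝ) + n / R * |T' ⟨n, x⟩| ^ (3 / 2 : ℝ)) := by ring
      linarith
  have hi2p := integrable_sum_avgs_pow hφ (2 * (2 * q + 6)) n
  have hib : Integrable (fun x : Fin n → ℝ => n / R * |T ⟨n, x⟩| ^ (3 / 2 : ℝ) +
      n / R * |T' ⟨n, x⟩| ^ (3 / 2 : ℝ)) (Measure.pi fun _ => P) :=
    (hint.const_mul _).add (hint'.const_mul _)
  have hia : Integrable (fun x : Fin n → ℝ => (2 + |d|) * n * R ^ 2 / r ^ (2 * (2 * q + 6)) *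
      ∑ i, avgs φ ⟨n, x⟩ i ^ (2 * (2 * q + 6)) + (n / R * |T ⟨n, x⟩| ^ (3 / 2 : ℝ) +
      n / R * |T' ⟨n, x⟩| ^ (3 / 2 : ℝ))) (Measure.pi fun _ => P) := (hi2p.const_mul _).add hib
  have hc : ∀ c : ℝ, Integrable (fun _ : Fin n → ℝ => c) (Measure.pi fun _ => P) :=
    fun c => integrable_const c
  have hTT : Integrable (fun x : Fin n → ℝ => n * (T ⟨n, x⟩ - T' ⟨n, x⟩))
      (Measure.pi fun _ => P) := (hTn.sub hTn').const_mul _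
  have hI := integral_mono_ae (hTT.sub (hc d)).abs ((hc (ε / 2)).add hia) hb
  have hs : ∫ x : Fin n → ℝ, ε / 2 + ((2 + |d|) * n * R ^ 2 / r ^ (2 * (2 * q + 6)) *
        ∑ i, avgs φ ⟨n, x⟩ i ^ (2 * (2 * q + 6)) +
      (n / R * |T ⟨n, x⟩| ^ (3 / 2 : ℝ) + n / R * |T' ⟨n, x⟩| ^ (3 / 2 : ℝ)))
      ∂(Measure.pi fun _ => P) ≤ ε / 2 + K / n := by
    rw [integral_add (hc _) hia, integral_add (hi2p.const_mul _) hib,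
      integral_add (hint.const_mul _) (hint'.const_mul _), integral_const_mul, integral_const_mul,
      integral_const_mul, integral_const, probReal_univ, one_smul]
    have a := hM' n hn1
    have e1 : ∫ x : Fin n → ℝ, |T ⟨n, x⟩| ^ (3 / 2 : ℝ) ∂(Measure.pi fun _ => P) ≤ D₁ * n ^ q :=
      hle.trans (by gcongr; exact le_max_left _ _)
    have e2 : ∫ x : Fin n → ℝ, |T' ⟨n, x⟩| ^ (3 / 2 : ℝ) ∂(Measure.pi fun _ => P) ≤ D₂ * n ^ q :=
      hle'.trans (by gcongr; exact le_max_right _ _)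
    have b1 : (2 + |d|) * n * R ^ 2 / r ^ (2 * (2 * q + 6)) * (M / (n : ℝ) ^ (2 * q + 6)) =
        (2 + |d|) / r ^ (2 * (2 * q + 6)) * M / n := by
      rw [hR]
      field_simp
      ring
    have b2 : n / R * (D₁ * (n : ℝ) ^ q) + n / R * (D₂ * (n : ℝ) ^ q) = (D₁ + D₂) / n := by
      rw [hR]
      field_simp
      ring
    calc _ ≤ ε / 2 + ((2 + |d|) * n * R ^ 2 / r ^ (2 * (2 * q + 6)) *
          (M / (n : ℝ) ^ (2 * q + 6)) + (n / R * (D₁ * (n : ℝ) ^ q) +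
            n / R * (D₂ * (n : ℝ) ^ q))) := by gcongr
      _ = _ := by rw [b1, b2, hK]; ring
  have hfin : |∫ x : Fin n → ℝ, (n * (T ⟨n, x⟩ - T' ⟨n, x⟩) - d) ∂(Measure.pi fun _ => P)| ≤
      ε / 2 + K / n := abs_integral_le_integral_abs.trans (hI.trans hs)
  rw [integral_sub hTT (hc d), integral_const_mul, integral_sub hTn hTn', integral_const,
    probReal_univ, one_smul] at hfin
  rw [Real.dist_eq]
  linarith

/-! ### The penalised Weibull likelihood -/

/-- The Weibull negative log-likelihood plus `τ` times the Wallace–Freeman penalty. -/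
def crit (τ : ℝ) {n : ℕ} (x : Fin n → ℝ) (k l : ℝ) : ℝ :=
  -(∑ a, weibullLog k l (log (x a))) + τ * weibullPen k l

/-- `θ` minimises `crit τ x` over the parameter space. -/
def IsCritMin (τ : ℝ) {n : ℕ} (x : Fin n → ℝ) (θ : Fin 2 → ℝ) : Prop :=
  θ ∈ weibullParams ∧ ∀ k l : ℝ, 0 < k → 0 < l → crit τ x (θ 0) (θ 1) ≤ crit τ x k l

lemma neg_weibullLog_eq (k l y : ℝ) : -weibullLog k l y =
    -log k + (exp (k * (y - log l)) - k * (y - log l)) + y := by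
  rw [weibullLog]
  ring

lemma abs_le_exp_sub (s : ℝ) : |s| ≤ exp s - s := by
  rcases le_total 0 s with h | h
  · rw [abs_of_nonneg h]
    nlinarith [quadratic_le_exp_of_nonneg h, sq_nonneg (s - 1)]
  · rw [abs_of_nonpos h]
    linarith [exp_pos s]

lemma weibullPen_nonneg (k : ℝ) {l : ℝ} (hl : 0 < l) : 0 ≤ weibullPen k l := by
  have h1 : 0 ≤ log (1 + k ^ 2) := log_nonneg (by nlinarith [sq_nonneg k])
  have h2 : log l ≤ log (1 + l ^ 2) := log_le_log hl (by nlinarith [sq_nonneg (l - 1)])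
  rw [weibullPen]
  linarith

/-! ### Existence and a priori bounds for minimisers -/

section Deterministic

variable {τ : ℝ} {n : ℕ} {x : Fin n → ℝ}

/-- Coercivity: `eˢ - s ≥ |s|` with `s = k (log xₐ - log l)`, and the penalty is nonnegative. -/
lemma le_crit (hτ : 0 ≤ τ) {k l : ℝ} (hk : 0 < k) (hl : 0 < l) :
    -(n * log k) + k * ∑ a, |log (x a) - log l| + ∑ a, log (x a) ≤ crit τ x k l := by
  have h : ∀ a, -log k + k * |log (x a) - log l| + log (x a) ≤ -weibullLog k l (log (x a)) := by
    intro a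
    rw [neg_weibullLog_eq]
    have := abs_le_exp_sub (k * (log (x a) - log l))
    rw [abs_mul, abs_of_pos hk] at this
    linarith
  have hs := Finset.sum_le_sum fun a (_ : a ∈ Finset.univ) => h a
  simp only [Finset.sum_add_distrib, Finset.sum_neg_distrib, Finset.sum_const, Finset.card_univ,
    Fintype.card_fin, nsmul_eq_mul, ← Finset.mul_sum] at hs
  have := mul_nonneg hτ (weibullPen_nonneg k hl)
  rw [crit]
  linarith

lemma continuousOn_crit : ContinuousOn (fun p : ℝ × ℝ => crit τ x p.1 p.2)
    {p | 0 < p.1 ∧ 0 < p.2} := by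
  have h1 : ContinuousOn (fun p : ℝ × ℝ => log p.1) {p | 0 < p.1 ∧ 0 < p.2} :=
    continuousOn_fst.log fun p hp => hp.1.ne'
  have h2 : ContinuousOn (fun p : ℝ × ℝ => log p.2) {p | 0 < p.1 ∧ 0 < p.2} :=
    continuousOn_snd.log fun p hp => hp.2.ne'
  have h3 : ContinuousOn (fun p : ℝ × ℝ => log (1 + p.1 ^ 2)) {p | 0 < p.1 ∧ 0 < p.2} :=
    ContinuousOn.log (by fun_prop) fun p _ => by positivity
  have h4 : ContinuousOn (fun p : ℝ × ℝ => log (1 + p.2 ^ 2)) {p | 0 < p.1 ∧ 0 < p.2} :=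
    ContinuousOn.log (by fun_prop) fun p _ => by positivity
  unfold crit weibullLog weibullPen
  fun_prop

/-- For two distinct observations the sum of the `|log xₐ - log l|` is at least their log-distance
`d > 0`, whatever the scale. So the lower bound of `le_crit` grows linearly in `k` for large `k` and
logarithmically as `k → 0`. The sublevel set of the value at `(1, 1)` lies in a compact rectangle,
on which continuity gives a minimiser. -/
theorem exists_isCritMin (hτ : 0 ≤ τ) {a b : Fin n} (hx : ∀ a, 0 < x a) (hab : x a ≠ x b) :
    ∃ θ, IsCritMin τ x θ := by
  have hn : (0 : ℝ) < n := by
    have := a.pos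
    positivity
  set d := |log (x a) - log (x b)| with hd
  have hd0 : 0 < d := by
    rw [hd, abs_pos, sub_ne_zero]
    exact fun h => hab (log_injOn_pos (hx a) (hx b) h)
  set A := crit τ x 1 1 - ∑ a, log (x a) with hA
  -- From `-n log k ≤ A` on the sublevel set.
  set k₁ := exp (-A / n) with hk₁
  -- From the tangent to `log` at `2n/d`: it bounds `n log k` by `kd/2` plus a constant, so half of
  -- the linear term `kd` survives.
  set k₂ := 2 / d * (A - n + n * log (2 * n / d)) with hk₂
  -- Once `k` lies in `[k₁, k₂]`, this bounds `|log xₐ - log l|`.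
  set W := (A + n * log k₂) / k₁ with hW
  have hk₁0 : 0 < k₁ := exp_pos _
  have hsub : ∀ k l : ℝ, 0 < k → 0 < l → crit τ x k l ≤ crit τ x 1 1 →
      (k ∈ Icc k₁ k₂ ∧ l ∈ Icc (exp (log (x a) - W)) (exp (log (x a) + W))) := by
    intro k l hk hl h
    have h1 := (le_crit (x := x) hτ hk hl).trans h
    have h2 : -(n * log k) + k * ∑ a, |log (x a) - log l| ≤ A := by rw [hA]; linarith
    have hne : a ≠ b := fun h => hab (by rw [h])
    have h3 : |log (x a) - log l| + |log (x b) - log l| ≤ ∑ a, |log (x a) - log l| := by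
      rw [← Finset.sum_pair hne (f := fun a => |log (x a) - log l|)]
      exact Finset.sum_le_sum_of_subset_of_nonneg (Finset.subset_univ _) fun i _ _ => abs_nonneg _
    have h4 : d ≤ |log (x a) - log l| + |log (x b) - log l| := by
      have := abs_sub_le (log (x a)) (log l) (log (x b))
      rwa [abs_sub_comm (log l)] at this
    have h5 : k * d ≤ k * ∑ a, |log (x a) - log l| :=
      mul_le_mul_of_nonneg_left (h4.trans h3) hk.le
    have h6 : k * |log (x a) - log l| ≤ k * ∑ a, |log (x a) - log l| :=
      mul_le_mul_of_nonneg_left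
        ((le_add_of_nonneg_right (abs_nonneg _)).trans h3) hk.le
    have hkd : 0 < k * d := mul_pos hk hd0
    have hlow : k₁ ≤ k := by
      rw [hk₁, ← le_log_iff_exp_le hk, div_le_iff₀ hn]
      linarith
    have hup : k ≤ k₂ := by
      have h7 := log_le_sub_one_of_pos (show 0 < k * d / (2 * n) by positivity)
      have h8 : log (k * d / (2 * n)) = log k - log (2 * n / d) := by
        rw [← log_div hk.ne' (by positivity)]
        congr 1
        field_simp
      rw [h8] at h7
      have h9 : n * log k ≤ k * d / 2 - n + n * log (2 * n / d) := by
        have := mul_le_mul_of_nonneg_left h7 hn.le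
        have e : n * (k * d / (2 * n) - 1) = k * d / 2 - n := by field_simp
        rw [e] at this
        linarith
      have h10 : k * d / 2 ≤ A - n + n * log (2 * n / d) := by linarith
      calc k = 2 / d * (k * d / 2) := by field_simp
        _ ≤ k₂ := by rw [hk₂]; gcongr
    have hlogk : log k ≤ log k₂ := log_le_log hk hup
    have hu : |log (x a) - log l| ≤ W := by
      rw [hW, le_div_iff₀ hk₁0]
      calc |log (x a) - log l| * k₁ ≤ |log (x a) - log l| * k := by gcongr
        _ ≤ A + n * log k := by rw [mul_comm]; linarith
        _ ≤ _ := by gcongr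
    rw [abs_le] at hu
    refine ⟨⟨hlow, hup⟩, ?_, ?_⟩
    · rw [← le_log_iff_exp_le hl]
      linarith
    · rw [← log_le_iff_le_exp hl]
      linarith
  set S := Icc k₁ k₂ ×ˢ Icc (exp (log (x a) - W)) (exp (log (x a) + W)) with hS
  have hSc : IsCompact S := isCompact_Icc.prod isCompact_Icc
  have h11 : ((1 : ℝ), (1 : ℝ)) ∈ S := hsub 1 1 one_pos one_pos le_rfl
  have hSpos : S ⊆ {p | 0 < p.1 ∧ 0 < p.2} := fun p hp =>
    ⟨hk₁0.trans_le hp.1.1, (exp_pos _).trans_le hp.2.1⟩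
  obtain ⟨p, hpS, hp⟩ := hSc.exists_isMinOn ⟨_, h11⟩ ((continuousOn_crit (τ := τ) (x := x)).mono hSpos)
  refine ⟨![p.1, p.2], by simpa [weibullParams] using hSpos hpS, fun k l hk hl => ?_⟩
  simp only [Matrix.cons_val_zero, Matrix.cons_val_one]
  rcases le_total (crit τ x k l) (crit τ x 1 1) with h | h
  · exact hp (show (k, l) ∈ S from hsub k l hk hl h)
  · exact (hp h11).trans h

/-- If the scale exceeded `M`, lowering it to `M` would strictly improve every likelihood term, as
`eˢ - s` decreases for `s ≤ 0`, and would not raise the penalty. -/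
lemma IsCritMin.scale_le (hτ : 0 ≤ τ) {θ : Fin 2 → ℝ} (h : IsCritMin τ x θ) (hn : 0 < n)
    (hx : ∀ a, 0 < x a) {M : ℝ} (hM1 : 1 ≤ M) (hM : ∀ a, x a ≤ M) : θ 1 ≤ M := by
  by_contra! hlt
  obtain ⟨⟨hk, hl⟩, hmin⟩ := h
  have hM0 : 0 < M := by linarith
  have hlog : log M < log (θ 1) := log_lt_log hM0 hlt
  have h1 : ∀ a, -weibullLog (θ 0) M (log (x a)) < -weibullLog (θ 0) (θ 1) (log (x a)) := by
    intro a
    rw [neg_weibullLog_eq, neg_weibullLog_eq]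
    set s := θ 0 * (log (x a) - log (θ 1)) with hs
    set s' := θ 0 * (log (x a) - log M) with hs'
    have hss : s < s' := mul_lt_mul_of_pos_left (by linarith) hk
    have hs0 : s' ≤ 0 := mul_nonpos_of_nonneg_of_nonpos hk.le
      (sub_nonpos.2 (log_le_log (hx a) (hM a)))
    have h2 := add_one_lt_exp (sub_ne_zero.2 hss.ne)
    have h3 : exp s = exp s' * exp (s - s') := by rw [← exp_add]; ring_nf
    have h4 : exp s' ≤ 1 := exp_le_one_iff.2 hs0
    have h5 : exp s' * (s - s' + 1) < exp s := by
      rw [h3]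
      exact mul_lt_mul_of_pos_left h2 (exp_pos _)
    nlinarith
  have h2 : weibullPen (θ 0) M ≤ weibullPen (θ 0) (θ 1) := by
    have h3 : log (1 + M ^ 2) + log (θ 1) ≤ log (1 + θ 1 ^ 2) + log M := by
      rw [← log_mul (by positivity) hl.ne', ← log_mul (by positivity) hM0.ne']
      refine log_le_log (by positivity) ?_
      -- `(1 + l²)/l` increases on `l ≥ 1`; this is where `1 ≤ M` enters.
      have : 0 ≤ (θ 1 - M) * (θ 1 * M - 1) := mul_nonneg (by linarith) (by nlinarith)
      nlinarith
    rw [weibullPen, weibullPen]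
    linarith
  have hne : (Finset.univ : Finset (Fin n)).Nonempty := ⟨⟨0, hn⟩, Finset.mem_univ _⟩
  have h3 := Finset.sum_lt_sum_of_nonempty hne fun a _ => h1 a
  have h4 := hmin (θ 0) M hk hM0
  simp only [Finset.sum_neg_distrib] at h3
  have h5 := mul_le_mul_of_nonneg_left h2 hτ
  simp only [crit] at h4
  linarith

lemma IsCritMin.shape_eq {θ : Fin 2 → ℝ} (h : IsCritMin τ x θ) :
    -(∑ a, weibullLog₁ 0 (θ 0) (θ 1) (log (x a))) + τ * (2 * θ 0 / (1 + θ 0 ^ 2)) = 0 := by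
  obtain ⟨⟨hk, hl⟩, hmin⟩ := h
  have hloc : IsLocalMin (fun t => crit τ x t (θ 1)) (θ 0) := by
    filter_upwards [Ioi_mem_nhds hk] with t ht using hmin t (θ 1) ht hl
  exact hloc.hasDerivAt_eq_zero ((HasDerivAt.fun_sum fun a _ =>
    hasDerivAt_weibullLog_shape _ hk).fun_neg.add ((hasDerivAt_weibullPen_shape _ _).const_mul τ))

lemma IsCritMin.scale_eq {θ : Fin 2 → ℝ} (h : IsCritMin τ x θ) :
    -(∑ a, weibullLog₁ 1 (θ 0) (θ 1) (log (x a))) +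
      τ * (2 * θ 1 / (1 + θ 1 ^ 2) - 1 / θ 1) = 0 := by
  obtain ⟨⟨hk, hl⟩, hmin⟩ := h
  have hloc : IsLocalMin (fun t => crit τ x (θ 0) t) (θ 1) := by
    filter_upwards [Ioi_mem_nhds hl] with t ht using hmin (θ 0) t hk ht
  exact hloc.hasDerivAt_eq_zero ((HasDerivAt.fun_sum fun a _ =>
    hasDerivAt_weibullLog_scale _ hl).fun_neg.add
      ((hasDerivAt_weibullPen_scale _ hl).const_mul τ))

/-- Quadratic growth near zero and linear growth at infinity on both sides; the left tail comes from
`eˢ ≤ 1/(1 - s)`. -/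
lemma sq_div_le_mul_exp_sub_one (s : ℝ) : s ^ 2 / (1 + |s|) ≤ s * (exp s - 1) := by
  have h0 : 0 < 1 + |s| := by positivity
  rw [div_le_iff₀ h0]
  rcases le_total 0 s with h | h
  · rw [abs_of_nonneg h]
    have h1 := add_one_le_exp s
    have h2 : s * s ≤ s * (exp s - 1) := mul_le_mul_of_nonneg_left (by linarith) h
    nlinarith [mul_nonneg h h, mul_nonneg (mul_nonneg h h) h]
  · rw [abs_of_nonpos h]
    have h1 := add_one_le_exp (-s)
    have h2 : exp (-s) * exp s = 1 := by rw [← exp_add]; simp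
    have h3 : exp s * (1 - s) ≤ 1 := by nlinarith [exp_pos s]
    nlinarith

/-- With `sₐ = k (log xₐ - log l)` the shape equation reads `∑ sₐ (e^{sₐ} - 1) ≤ n`, because the
penalty term has a favourable sign. All summands are nonnegative, so each is at most `n`, which
forces `|sₐ| ≤ n + 1`; the scale cancels from `sₐ - s_b`. -/
lemma IsCritMin.shape_mul_le (hτ : 0 ≤ τ) {θ : Fin 2 → ℝ} (h : IsCritMin τ x θ) (a b : Fin n) :
    θ 0 * |log (x a) - log (x b)| ≤ 2 * (n + 1) := by
  have heq := h.shape_eq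
  obtain ⟨⟨hk, hl⟩, -⟩ := h
  set s : Fin n → ℝ := fun a => θ 0 * (log (x a) - log (θ 1)) with hs
  have hsum : ∑ a, s a * (exp (s a) - 1) ≤ n := by
    have h1 : ∀ a, weibullLog₁ 0 (θ 0) (θ 1) (log (x a)) =
        1 / θ 0 - (1 / θ 0) * (s a * (exp (s a) - 1)) := by
      intro a
      simp only [weibullLog₁, hs, Matrix.cons_val_zero]
      field_simp
      ring
    simp only [h1, Finset.sum_sub_distrib, ← Finset.mul_sum, Finset.sum_const, Finset.card_univ,
      Fintype.card_fin, nsmul_eq_mul] at heq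
    have h2 : 0 ≤ τ * (2 * θ 0 / (1 + θ 0 ^ 2)) := by positivity
    have h3 : 1 / θ 0 * ∑ a, s a * (exp (s a) - 1) ≤ 1 / θ 0 * n := by linarith
    exact le_of_mul_le_mul_left h3 (by positivity)
  have hone : ∀ c, s c ^ 2 ≤ n * (1 + |s c|) := by
    intro c
    have h1 : s c * (exp (s c) - 1) ≤ ∑ a, s a * (exp (s a) - 1) :=
      Finset.single_le_sum (f := fun a => s a * (exp (s a) - 1)) (fun i _ =>
        le_trans (by positivity) (sq_div_le_mul_exp_sub_one (s i))) (Finset.mem_univ c)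
    have h2 := (sq_div_le_mul_exp_sub_one (s c)).trans (h1.trans hsum)
    rwa [div_le_iff₀ (by positivity)] at h2
  have hbd : ∀ c, |s c| ≤ n + 1 := by
    intro c
    by_contra! hc
    have h1 := hone c
    rw [← sq_abs] at h1
    have hn : (0 : ℝ) ≤ n := Nat.cast_nonneg n
    nlinarith
  calc θ 0 * |log (x a) - log (x b)| = |s a - s b| := by
        rw [hs, ← mul_sub, abs_mul, abs_of_pos hk]
        congr 2
        ring
    _ ≤ |s a| + |s b| := abs_sub _ _
    _ ≤ _ := by linarith [hbd a, hbd b]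

end Deterministic

/-! ### Estimators as minimisers -/

section Estimators

variable {n : ℕ} {x : Fin n → ℝ}

/-- Both estimators minimise one family of criteria, with weight `0` or `1` on the penalty, so
existence, a priori bounds and localisation are proved once. -/
lemma isMaxOn_logLik_iff (hx : ∀ a, 0 < x a) {θ : Fin 2 → ℝ} :
    (θ ∈ weibullParams ∧ IsMaxOn (logLik weibullPDF x) weibullParams θ) ↔ IsCritMin 0 x θ := by
  refine and_congr_right fun hθ => ⟨fun h k l hk hl => ?_, fun h τ hτ => ?_⟩
  · have hm : ![k, l] ∈ weibullParams := ⟨by simpa using hk, by simpa using hl⟩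
    have := h hm
    simp only [mem_ofPred_eq, logLik_weibull hx hm, logLik_weibull hx hθ] at this
    simpa [crit] using this
  · have := h (τ 0) (τ 1) hτ.1 hτ.2
    simp only [mem_ofPred_eq, logLik_weibull hx hτ, logLik_weibull hx hθ]
    simpa [crit] using this

lemma isMinOn_wfCriterion_iff (hn : 0 < n) (hx : ∀ a, 0 < x a) {θ : Fin 2 → ℝ} :
    (θ ∈ weibullParams ∧ IsMinOn (wfCriterion weibullPDF weibullPrior x) weibullParams θ) ↔
      IsCritMin 1 x θ := by
  obtain ⟨c, hc⟩ := wfPen_weibull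
  have hn' : (0 : ℝ) < n := by positivity
  have hw : ∀ τ ∈ weibullParams, wfCriterion weibullPDF weibullPrior x τ =
      (1 / n : ℝ) * (crit 1 x (τ 0) (τ 1) + c) := by
    intro τ hτ
    have h := logLik_weibull hx hτ
    rw [logLik] at h
    rw [wfCriterion, hc τ hτ, Finset.sum_neg_distrib, h, crit]
    ring
  refine and_congr_right fun hθ => ⟨fun h k l hk hl => ?_, fun h τ hτ => ?_⟩
  · have hm : ![k, l] ∈ weibullParams := ⟨by simpa using hk, by simpa using hl⟩
    have := h hm
    simp only [mem_ofPred_eq, hw _ hm, hw _ hθ] at this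
    have := le_of_mul_le_mul_left this (by positivity)
    simpa using this
  · have := h (τ 0) (τ 1) hτ.1 hτ.2
    simp only [mem_ofPred_eq, hw _ hτ, hw _ hθ]
    gcongr

/-- The samples of positive, not all equal observations. -/
def validSamples : Set Sample := {ω | (∀ a, 0 < ω.2 a) ∧ ∃ a b, ω.2 a ≠ ω.2 b}

lemma isCritMin_mle {T : (Fin n → ℝ) → Fin 2 → ℝ}
    (hT : IsMLE weibullPDF (Ioi 0) weibullParams T) (hx : (⟨n, x⟩ : Sample) ∈ validSamples) :
    IsCritMin 0 x (T x) := by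
  obtain ⟨hpos, a, b, hab⟩ := hx
  obtain ⟨θ, hθ⟩ := exists_isCritMin le_rfl hpos hab
  exact (isMaxOn_logLik_iff hpos).1 (hT.2 x hpos ⟨θ, (isMaxOn_logLik_iff hpos).2 hθ⟩)

lemma isCritMin_wf {T : (Fin n → ℝ) → Fin 2 → ℝ}
    (hT : IsWFEstimator weibullPDF weibullPrior (Ioi 0) weibullParams T)
    (hx : (⟨n, x⟩ : Sample) ∈ validSamples) : IsCritMin 1 x (T x) := by
  obtain ⟨hpos, a, b, hab⟩ := hx
  obtain ⟨θ, hθ⟩ := exists_isCritMin zero_le_one hpos hab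
  exact (isMinOn_wfCriterion_iff a.pos hpos).1
    (hT.2 x hpos ⟨θ, (isMinOn_wfCriterion_iff a.pos hpos).2 hθ⟩)

end Estimators

/-! ### The statistics that drive the Weibull estimators -/

/-- The logarithm of the standardised observation. -/
def wlog (θ : Fin 2 → ℝ) (x : ℝ) : ℝ := log (weibullStd θ x)

/-- A function that dominates all tilted moments near the true parameter. -/
def tiltBound (z : ℝ) : ℝ := (exp (z / 2) + exp (3 * z / 2)) * (1 + z ^ 6)

/-- The statistics, as functions of the logarithm of the standardised observation. -/
def wStat (i : Fin 7) (z : ℝ) : ℝ :=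
  ![z, exp z, z * exp z, z ^ 2 * exp z, z ^ 3 * exp z, z ^ 4 * exp z, tiltBound z] i

/-- The expectations of the statistics. -/
def wMean (i : Fin 7) : ℝ := ∫ v, wStat i (log v) ∂stdExp

/-- The centred statistics as functions of an observation. -/
def wScore (θ : Fin 2 → ℝ) (i : Fin 7) (x : ℝ) : ℝ := wStat i (wlog θ x) - wMean i

lemma measurable_wlog (θ : Fin 2 → ℝ) : Measurable (wlog θ) :=
  (measurable_weibullStd θ).log

lemma measurable_tiltBound : Measurable tiltBound := by
  unfold tiltBound
  fun_prop

lemma measurable_wStat (i : Fin 7) : Measurable (wStat i) := by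
  have := measurable_tiltBound
  unfold wStat
  fin_cases i <;> simp <;> fun_prop

lemma integral_wStat_mul {f : ℝ → ℝ} {m j : ℕ} (hf : ∀ z, f z = z ^ j * exp z ^ m) :
    ∫ v, f (log v) ∂stdExp = gmom m j := by
  refine integral_congr_ae ?_
  filter_upwards [ae_stdExp_pos] with v hv
  rw [hf, exp_log hv, mul_comm]

lemma allMoments_pow_mul_exp_log {f : ℝ → ℝ} {m j : ℕ} (hf : ∀ z, f z = z ^ j * exp z ^ m) :
    AllMoments (fun v => f (log v)) stdExp := by
  have hfm : Measurable f := by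
    rw [funext hf]
    fun_prop
  refine (allMoments_pow_log_pow_stdExp m j).mono
    (hfm.comp measurable_log).aestronglyMeasurable ?_
  filter_upwards [ae_stdExp_pos] with v hv
  rw [hf, exp_log hv, mul_comm]

/-- `e^{z/2} + e^{3z/2} ≤ (1 + e^z)²`, and for `z = log v` the right-hand side is a polynomial in
`v`. -/
lemma allMoments_tiltBound : AllMoments (fun v => tiltBound (log v)) stdExp := by
  have h1 := allMoments_pow_mul_exp_log (f := fun z => exp z) (m := 1) (j := 0) (by simp)
  have h2 := allMoments_pow_mul_exp_log (f := fun z => z) (m := 0) (j := 1) (by simp)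
  have h := (((allMoments_const (μ := stdExp) 1).add h1).pow 2).mul
    ((allMoments_const (μ := stdExp) 1).add (h2.pow 6))
  refine h.mono (measurable_tiltBound.comp measurable_log).aestronglyMeasurable
    (Eventually.of_forall fun v => ?_)
  set z := log v
  have e1 : exp z = exp (z / 2) ^ 2 := by rw [← exp_nat_mul]; congr 1; push_cast; ring
  have e2 : exp (3 * z / 2) = exp (z / 2) ^ 3 := by rw [← exp_nat_mul]; congr 1; push_cast; ring
  have hp := exp_pos (z / 2)
  have h6 : 0 ≤ z ^ 6 := by positivity
  rw [tiltBound, abs_of_nonneg (by positivity), abs_of_nonneg (by positivity), e1, e2]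
  set s := exp (z / 2)
  gcongr
  nlinarith [mul_pos hp hp, sq_nonneg (s ^ 2 - s), sq_nonneg (s - 1)]

lemma allMoments_wStat (i : Fin 7) : AllMoments (fun v => wStat i (log v)) stdExp := by
  fin_cases i
  · exact allMoments_pow_mul_exp_log (m := 0) (j := 1) (by simp [wStat])
  · exact allMoments_pow_mul_exp_log (m := 1) (j := 0) (by simp [wStat])
  · exact allMoments_pow_mul_exp_log (m := 1) (j := 1) (by simp [wStat])
  · exact allMoments_pow_mul_exp_log (m := 1) (j := 2) (by simp [wStat])
  · exact allMoments_pow_mul_exp_log (m := 1) (j := 3) (by simp [wStat])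
  · exact allMoments_pow_mul_exp_log (m := 1) (j := 4) (by simp [wStat])
  · exact allMoments_tiltBound

variable {θ : Fin 2 → ℝ}

lemma centred_wScore (hθ : θ ∈ weibullParams) (i : Fin 7) :
    Centred (wScore θ i) (obsLaw weibullPDF θ) := by
  have := isProbabilityMeasure_weibull hθ
  have hm : AllMoments (fun x => wStat i (wlog θ x)) (obsLaw weibullPDF θ) :=
    (allMoments_wStat i).comp (measurePreserving_weibullStd hθ)
  refine ⟨((measurable_wStat i).comp (measurable_wlog θ)).sub_const _,
    hm.sub (allMoments_const _), ?_⟩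
  have h := integral_comp_weibullStd hθ (allMoments_wStat i).1
  unfold wScore
  rw [integral_sub hm.integrable (integrable_const _), wMean, ← h]
  simp [wlog]

lemma covMatrix_wScore (hθ : θ ∈ weibullParams) (i j : Fin 7) :
    covMatrix (obsLaw weibullPDF θ) (wScore θ) i j =
      ∫ v, wStat i (log v) * wStat j (log v) ∂stdExp - wMean i * wMean j := by
  have hi := (allMoments_wStat i)
  have hj := (allMoments_wStat j)
  have h := integral_comp_weibullStd hθ (f := fun v => (wStat i (log v) - wMean i) *
    (wStat j (log v) - wMean j)) ((hi.1.sub aestronglyMeasurable_const).mul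
      (hj.1.sub aestronglyMeasurable_const))
  have e : ∀ v, (wStat i (log v) - wMean i) * (wStat j (log v) - wMean j) =
      wStat i (log v) * wStat j (log v) - wMean j * wStat i (log v) -
        (wMean i * wStat j (log v) - wMean i * wMean j) := fun v => by ring
  rw [covMatrix]
  unfold wScore wlog
  rw [h]
  simp only [e]
  have i1 : Integrable (fun v => wStat i (log v) * wStat j (log v) - wMean j * wStat i (log v))
      stdExp := (hi.mul hj).integrable.sub (hi.integrable.const_mul _)
  have i2 : Integrable (fun v => wMean i * wStat j (log v) - wMean i * wMean j) stdExp :=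
    (hj.integrable.const_mul _).sub (integrable_const _)
  rw [integral_sub i1 i2,
    integral_sub (hi.mul hj).integrable (hi.integrable.const_mul _),
    integral_sub (hj.integrable.const_mul _) (integrable_const _), integral_const_mul,
    integral_const_mul, integral_const, ← wMean, ← wMean]
  simp
  ring

lemma wMean_zero : wMean 0 = gmom 0 1 := integral_wStat_mul (by simp [wStat])
lemma wMean_one : wMean 1 = gmom 1 0 := integral_wStat_mul (by simp [wStat])
lemma wMean_two : wMean 2 = gmom 1 1 := integral_wStat_mul (by simp [wStat])
lemma wMean_three : wMean 3 = gmom 1 2 := integral_wStat_mul (by simp [wStat])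
lemma wMean_four : wMean 4 = gmom 1 3 := integral_wStat_mul (by simp [wStat])
lemma wMean_five : wMean 5 = gmom 1 4 := integral_wStat_mul (by simp [wStat])

/-- The covariances of the first four statistics. -/
lemma covMatrix_wScore_table (hθ : θ ∈ weibullParams) :
    let S := covMatrix (obsLaw weibullPDF θ) (wScore θ)
    S 0 0 = gmom 0 2 - gmom 0 1 * gmom 0 1 ∧ S 0 1 = gmom 1 1 - gmom 0 1 * gmom 1 0 ∧
    S 0 2 = gmom 1 2 - gmom 0 1 * gmom 1 1 ∧ S 0 3 = gmom 1 3 - gmom 0 1 * gmom 1 2 ∧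
    S 1 1 = gmom 2 0 - gmom 1 0 * gmom 1 0 ∧ S 1 2 = gmom 2 1 - gmom 1 0 * gmom 1 1 ∧
    S 1 3 = gmom 2 2 - gmom 1 0 * gmom 1 2 ∧ S 2 2 = gmom 2 2 - gmom 1 1 * gmom 1 1 ∧
    S 2 3 = gmom 2 3 - gmom 1 1 * gmom 1 2 := by
  have h : ∀ {i j : Fin 7} {m p : ℕ} {a b : ℝ}, wMean i = a → wMean j = b →
      (∀ z, wStat i z * wStat j z = z ^ p * exp z ^ m) →
      covMatrix (obsLaw weibullPDF θ) (wScore θ) i j = gmom m p - a * b := by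
    rintro i j m p - - rfl rfl hz
    rw [covMatrix_wScore hθ, integral_wStat_mul (f := fun z => wStat i z * wStat j z) hz]
  have h0 := wMean_zero
  have h1 := wMean_one
  have h2 := wMean_two
  have h3 := wMean_three
  refine ⟨h h0 h0 ?_, h h0 h1 ?_, h h0 h2 ?_, h h0 h3 ?_, h h1 h1 ?_, h h1 h2 ?_,
    h h1 h3 ?_, h h2 h2 ?_, h h2 h3 ?_⟩ <;> intro z <;> simp [wStat] <;> ring

lemma covMatrix_comm (P : Measure ℝ) {ι : Type*} (φ : ι → ℝ → ℝ) (i j : ι) :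
    covMatrix P φ i j = covMatrix P φ j i := by
  simp only [covMatrix, mul_comm]

/-! ### Tilted empirical moments -/

/-- The filter of large valid samples whose centred statistics are small. -/
abbrev wFilter (θ : Fin 2 → ℝ) : Filter Sample := goodFilter (wScore θ) validSamples

/-- The empirical moments of the standardised log-observations under an exponential tilt. -/
def tilt (θ : Fin 2 → ℝ) (j : ℕ) (δ : ℝ) (ω : Sample) : ℝ :=
  avg (fun x => wlog θ x ^ j * exp ((1 + δ) * wlog θ x)) ω.2

/-- The mean of the standardised log-observations. -/
def wbar (θ : Fin 2 → ℝ) (ω : Sample) : ℝ := avg (wlog θ) ω.2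

/-- `HasExpansion` for the Weibull statistics. -/
abbrev WExpansion (θ : Fin 2 → ℝ) (N : ℕ) (X : Sample → ℝ) (c : ℝ) (L : Fin 7 → ℝ) (B : ℝ) : Prop :=
  HasExpansion (wFilter θ) (avgs (wScore θ)) (covMatrix (obsLaw weibullPDF θ) (wScore θ)) N X c L B

lemma avg_le_avg {f g : ℝ → ℝ} {n : ℕ} {x : Fin n → ℝ} (h : ∀ a, f (x a) ≤ g (x a)) :
    avg f x ≤ avg g x := by
  unfold avg
  gcongr
  exact h _

lemma abs_avg_le_avg {f g : ℝ → ℝ} {n : ℕ} {x : Fin n → ℝ} (h : ∀ a, |f (x a)| ≤ g (x a)) :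
    |avg f x| ≤ avg g x := by
  unfold avg
  rw [abs_div, Nat.abs_cast]
  gcongr
  exact (Finset.abs_sum_le_sum_abs _ _).trans (Finset.sum_le_sum fun a _ => h a)

lemma avg_const {n : ℕ} (hn : 0 < n) (c : ℝ) (x : Fin n → ℝ) : avg (fun _ => c) x = c := by
  have : (n : ℝ) ≠ 0 := by positivity
  simp [avg, this]

lemma eventually_size_pos : ∀ᶠ ω in wFilter θ, 0 < ω.1 :=
  tendsto_size.eventually (eventually_gt_atTop 0)

/-- Exact as soon as the sample is nonempty: the average is its mean plus one coordinate of `ξ`. -/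
lemma expansion_wStat (i : Fin 7) (N : ℕ) :
    WExpansion θ N (fun ω => avg (fun x => wStat i (wlog θ x)) ω.2) (wMean i) (Pi.single i 1) 0 := by
  refine (((HasExpansion.const (wMean i)).add (HasExpansion.coord i)).of_eq
    (by simp) (by simp) (by simp)).congr ?_
  filter_upwards [eventually_size_pos] with ω hω
  unfold avgs wScore
  rw [avg_sub, avg_const hω]
  ring

lemma expansion_wbar (N : ℕ) : WExpansion θ N (wbar θ) (gmom 0 1) (Pi.single 0 1) 0 :=
  (expansion_wStat 0 N).of_eq wMean_zero rfl rfl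

lemma expansion_tilt (N : ℕ) :
    WExpansion θ N (tilt θ 0 0) (gmom 1 0) (Pi.single 1 1) 0 ∧
    WExpansion θ N (tilt θ 1 0) (gmom 1 1) (Pi.single 2 1) 0 ∧
    WExpansion θ N (tilt θ 2 0) (gmom 1 2) (Pi.single 3 1) 0 ∧
    WExpansion θ N (tilt θ 3 0) (gmom 1 3) (Pi.single 4 1) 0 ∧
    WExpansion θ N (tilt θ 4 0) (gmom 1 4) (Pi.single 5 1) 0 := by
  have h := fun i => expansion_wStat (θ := θ) i N
  simp only [← wMean_one, ← wMean_two, ← wMean_three, ← wMean_four, ← wMean_five]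
  unfold tilt
  refine ⟨?_, ?_, ?_, ?_, ?_⟩
  · simpa [wStat] using h 1
  · simpa [wStat] using h 2
  · simpa [wStat] using h 3
  · simpa [wStat] using h 4
  · simpa [wStat] using h 5

lemma tendsto_wStat (i : Fin 7) :
    Tendsto (fun ω : Sample => avg (fun x => wStat i (wlog θ x)) ω.2) (wFilter θ) (𝓝 (wMean i)) :=
  (expansion_wStat i 1).tendsto tendsto_avgs le_rfl

lemma tendsto_tiltBound :
    Tendsto (fun ω : Sample => avg (fun x => tiltBound (wlog θ x)) ω.2) (wFilter θ) (𝓝 (wMean 6)) := by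
  simpa [wStat] using tendsto_wStat (θ := θ) 6

/-! ### Taylor expansion of the tilted moments -/

lemma abs_exp_sub_sum_le (x : ℝ) (n : ℕ) :
    |exp x - ∑ m ∈ Finset.range n, x ^ m / m.factorial| ≤ |x| ^ n * exp |x| := by
  have h := Complex.norm_exp_sub_sum_le_norm_mul_exp (x : ℂ) n
  rw [← Complex.ofReal_exp] at h
  simpa [← Complex.ofReal_pow, ← Complex.ofReal_natCast, ← Complex.ofReal_div,
    ← Complex.ofReal_sum, ← Complex.ofReal_sub, -Complex.ofReal_exp] using h

/-- For `|δ| ≤ 1/2` the factor `e^{|δz|}` is at most `e^{|z|/2}`, so `tiltBound` dominates every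
Taylor remainder in `δ` whose total power of `z` is at most six, uniformly in `δ`. -/
lemma abs_pow_mul_exp_le {z : ℝ} {j : ℕ} (hj : j ≤ 6) :
    |z| ^ j * (exp (|z| / 2) * exp z) ≤ tiltBound z := by
  have h1 : |z| ^ j ≤ 1 + z ^ 6 := by
    rw [← Even.pow_abs (by decide : Even 6) z]
    rcases le_total |z| 1 with h | h
    · have := pow_le_one₀ (n := j) (abs_nonneg z) h
      have : 0 ≤ |z| ^ 6 := by positivity
      linarith
    · have := pow_le_pow_right₀ h hj
      linarith
  have h2 : exp (|z| / 2) * exp z ≤ exp (z / 2) + exp (3 * z / 2) := by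
    rw [← exp_add]
    rcases abs_cases z with ⟨h, -⟩ | ⟨h, -⟩
    · rw [h, show z / 2 + z = 3 * z / 2 by ring]
      linarith [exp_pos (z / 2)]
    · rw [h, show -z / 2 + z = z / 2 by ring]
      linarith [exp_pos (3 * z / 2)]
  rw [tiltBound, mul_comm]
  gcongr

lemma abs_tilt_term_sub_le {z δ : ℝ} (hδ : |δ| ≤ 1 / 2) {j N : ℕ} (hj : j + N ≤ 6) :
    |z ^ j * exp ((1 + δ) * z) -
      ∑ i ∈ Finset.range N, δ ^ i / i.factorial * (z ^ (j + i) * exp z)| ≤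
      |δ| ^ N * tiltBound z := by
  have e : z ^ j * exp ((1 + δ) * z) -
      ∑ i ∈ Finset.range N, δ ^ i / i.factorial * (z ^ (j + i) * exp z) =
      z ^ j * exp z * (exp (δ * z) - ∑ i ∈ Finset.range N, (δ * z) ^ i / i.factorial) := by
    rw [mul_sub, Finset.mul_sum, mul_assoc, ← exp_add, show z + δ * z = (1 + δ) * z by ring]
    congr 1
    exact Finset.sum_congr rfl fun i _ => by rw [mul_pow, pow_add]; ring
  have h1 : exp |δ * z| ≤ exp (|z| / 2) := by
    rw [abs_mul]
    gcongr
    nlinarith [abs_nonneg z]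
  rw [e, abs_mul, abs_mul, abs_pow, abs_exp]
  calc |z| ^ j * exp z * |exp (δ * z) - ∑ i ∈ Finset.range N, (δ * z) ^ i / i.factorial|
      ≤ |z| ^ j * exp z * (|δ * z| ^ N * exp (|z| / 2)) := by
        gcongr
        exact (abs_exp_sub_sum_le _ _).trans (by gcongr)
    _ = |δ| ^ N * (|z| ^ (j + N) * (exp (|z| / 2) * exp z)) := by
        rw [abs_mul, mul_pow, pow_add]
        ring
    _ ≤ _ := by
        gcongr
        exact abs_pow_mul_exp_le hj

variable {θ : Fin 2 → ℝ} {ω : Sample}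

lemma avg_sum {ι : Type*} (s : Finset ι) (f : ι → ℝ → ℝ) {n : ℕ} (x : Fin n → ℝ) :
    avg (fun y => ∑ i ∈ s, f i y) x = ∑ i ∈ s, avg (f i) x := by
  simp only [avg]
  rw [Finset.sum_comm, Finset.sum_div]

lemma tilt_zero (j : ℕ) : tilt θ j 0 ω = avg (fun x => wlog θ x ^ j * exp (wlog θ x)) ω.2 := by
  simp [tilt]

lemma abs_tilt_sub_le {δ : ℝ} (hδ : |δ| ≤ 1 / 2) {j N : ℕ} (hj : j + N ≤ 6) :
    |tilt θ j δ ω - ∑ i ∈ Finset.range N, δ ^ i / i.factorial * tilt θ (j + i) 0 ω| ≤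
      |δ| ^ N * avg (fun x => tiltBound (wlog θ x)) ω.2 := by
  simp only [tilt_zero, ← avg_const_mul]
  rw [tilt, ← avg_sum, ← avg_sub]
  exact abs_avg_le_avg fun a => abs_tilt_term_sub_le hδ hj

/-- Mean value inequality for `eᵗ - t`, whose derivative is at most `R e^R` in absolute value on
`[-R, R]`. -/
lemma abs_exp_sub_exp_sub_le {a b R : ℝ} (ha : |a| ≤ R) (hb : |b| ≤ R) :
    |exp a - exp b - (a - b)| ≤ R * exp R * |a - b| := by
  have hR : 0 ≤ R := (abs_nonneg a).trans ha
  have hd : ∀ t : ℝ, HasDerivAt (fun t => exp t - t) (exp t - 1) t := fun t =>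
    (Real.hasDerivAt_exp t).sub (hasDerivAt_id t)
  have h := Convex.norm_image_sub_le_of_norm_hasDerivWithin_le (f := fun t => exp t - t)
    (f' := fun t => exp t - 1) (s := Icc (-R) R) (C := R * exp R) (x := b) (y := a)
    (fun t _ => (hd t).hasDerivWithinAt) (fun t ht => ?_) (convex_Icc _ _) (abs_le.1 hb)
    (abs_le.1 ha)
  · simp only [norm_eq_abs] at h
    convert h using 2
    ring
  · have ht' : |t| ≤ R := abs_le.2 ht
    have := abs_exp_sub_sum_le t 1
    simp only [Finset.range_one, Finset.sum_singleton, pow_zero, Nat.factorial_zero,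
      Nat.cast_one, div_one, pow_one] at this
    exact this.trans (by gcongr)

lemma abs_tilt_sub_tilt_le {δ δ' r : ℝ} (hr : r ≤ 1 / 2) (hδ : |δ| ≤ r) (hδ' : |δ'| ≤ r) {j : ℕ}
    (hj : j + 2 ≤ 6) :
    |tilt θ j δ ω - tilt θ j δ' ω - (δ - δ') * tilt θ (j + 1) 0 ω| ≤
      |δ - δ'| * r * avg (fun x => tiltBound (wlog θ x)) ω.2 := by
  have hr0 : 0 ≤ r := (abs_nonneg _).trans hδ
  rw [tilt_zero, ← avg_const_mul, ← avg_const_mul, tilt, tilt, ← avg_sub, ← avg_sub]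
  refine abs_avg_le_avg fun a => ?_
  set z := wlog θ (ω.2 a)
  have e : z ^ j * exp ((1 + δ) * z) - z ^ j * exp ((1 + δ') * z) -
      (δ - δ') * (z ^ (j + 1) * exp z) =
      z ^ j * exp z * (exp (δ * z) - exp (δ' * z) - (δ * z - δ' * z)) := by
    rw [add_mul, add_mul, one_mul, exp_add, exp_add]
    ring
  have h := abs_exp_sub_exp_sub_le (a := δ * z) (b := δ' * z) (R := r * |z|)
    (by rw [abs_mul]; gcongr) (by rw [abs_mul]; gcongr)
  have h1 : exp (r * |z|) ≤ exp (|z| / 2) := by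
    gcongr
    nlinarith [abs_nonneg z]
  rw [e, abs_mul, abs_mul, abs_pow, abs_exp]
  calc |z| ^ j * exp z * |exp (δ * z) - exp (δ' * z) - (δ * z - δ' * z)|
      ≤ |z| ^ j * exp z * (r * |z| * exp (|z| / 2) * |δ * z - δ' * z|) := by
        gcongr
        exact h.trans (by gcongr)
    _ = |δ - δ'| * r * (|z| ^ (j + 2) * (exp (|z| / 2) * exp z)) := by
        rw [← sub_mul, abs_mul]
        ring
    _ ≤ _ := by
        gcongr
        exact abs_pow_mul_exp_le hj

lemma tendsto_tilt_zero (j : ℕ) (hj : j ≤ 4) :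
    Tendsto (tilt θ j 0) (wFilter θ) (𝓝 (gmom 1 j)) := by
  obtain ⟨h0, h1, h2, h3, h4⟩ := expansion_tilt (θ := θ) 1
  interval_cases j
  exacts [h0.tendsto tendsto_avgs le_rfl, h1.tendsto tendsto_avgs le_rfl,
    h2.tendsto tendsto_avgs le_rfl, h3.tendsto tendsto_avgs le_rfl, h4.tendsto tendsto_avgs le_rfl]

lemma tendsto_wbar : Tendsto (wbar θ) (wFilter θ) (𝓝 (gmom 0 1)) :=
  (expansion_wbar 1).tendsto tendsto_avgs le_rfl

lemma eventually_abs_le_half {δ : Sample → ℝ} {l : Filter Sample} (hδ : Tendsto δ l (𝓝 0)) :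
    ∀ᶠ ω in l, |δ ω| ≤ 1 / 2 := by
  have := hδ.abs
  rw [abs_zero] at this
  exact this.eventually (ge_mem_nhds (by norm_num))

/-- Taylor expansion in the tilt. The implied constant is the sample average of `tiltBound`, which
converges along the filter because it is one of the statistics. -/
lemma tilt_isBigO {δ : Sample → ℝ} (hδ : Tendsto δ (wFilter θ) (𝓝 0)) {j N : ℕ}
    (hj : j + N ≤ 6) :
    (fun ω => tilt θ j (δ ω) ω -
      ∑ i ∈ Finset.range N, δ ω ^ i / i.factorial * tilt θ (j + i) 0 ω) =O[wFilter θ]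
      (fun ω => δ ω ^ N) := by
  have h1 : (fun ω => tilt θ j (δ ω) ω -
      ∑ i ∈ Finset.range N, δ ω ^ i / i.factorial * tilt θ (j + i) 0 ω) =O[wFilter θ]
      (fun ω => |δ ω| ^ N * avg (fun x => tiltBound (wlog θ x)) ω.2) := by
    refine IsBigO.of_bound 1 ?_
    filter_upwards [eventually_abs_le_half hδ] with ω hω
    rw [one_mul, norm_eq_abs, norm_eq_abs]
    exact (abs_tilt_sub_le hω hj).trans (le_abs_self _)
  refine h1.trans ?_
  have h2 := (isBigO_refl (fun ω => |δ ω| ^ N) (wFilter θ)).mul ((tendsto_tiltBound (θ := θ)).isBigO_one ℝ)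
  refine (h2.trans ?_)
  simp only [mul_one, ← abs_pow]
  exact (isBigO_refl _ _).abs_left

lemma tendsto_tilt {δ : Sample → ℝ} (hδ : Tendsto δ (wFilter θ) (𝓝 0)) {j : ℕ} (hj : j ≤ 4) :
    Tendsto (fun ω => tilt θ j (δ ω) ω) (wFilter θ) (𝓝 (gmom 1 j)) := by
  have h := tilt_isBigO hδ (j := j) (N := 1) (by omega)
  simp only [Finset.range_one, Finset.sum_singleton, pow_zero, Nat.factorial_zero,
      Nat.cast_one, div_one, pow_one, one_mul, add_zero] at h
  have h2 := (h.trans_tendsto hδ).add (tendsto_tilt_zero (θ := θ) j hj)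
  simpa using h2

/-- Differences of tilted moments are asymptotically linear in the tilt. -/
lemma tilt_sub_tilt_isLittleO {δ δ' : Sample → ℝ} (hδ : Tendsto δ (wFilter θ) (𝓝 0))
    (hδ' : Tendsto δ' (wFilter θ) (𝓝 0)) {j : ℕ} (hj : j ≤ 3) :
    (fun ω => tilt θ j (δ ω) ω - tilt θ j (δ' ω) ω - (δ ω - δ' ω) * gmom 1 (j + 1)) =o[wFilter θ]
      (fun ω => δ ω - δ' ω) := by
  have hr : Tendsto (fun ω => max |δ ω| |δ' ω|) (wFilter θ) (𝓝 0) := by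
    simpa using hδ.abs.max hδ'.abs
  have h1 : (fun ω => tilt θ j (δ ω) ω - tilt θ j (δ' ω) ω - (δ ω - δ' ω) * tilt θ (j + 1) 0 ω)
      =o[wFilter θ] (fun ω => δ ω - δ' ω) := by
    have h2 : (fun ω => max |δ ω| |δ' ω| * avg (fun x => tiltBound (wlog θ x)) ω.2)
        =o[wFilter θ] (fun _ => (1 : ℝ)) := by
      rw [isLittleO_one_iff]
      simpa using hr.mul tendsto_tiltBound
    refine IsBigO.trans_isLittleO ?_ (by
      simpa using (isBigO_refl (fun ω => δ ω - δ' ω) (wFilter θ)).mul_isLittleO h2)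
    refine IsBigO.of_bound 1 ?_
    filter_upwards [eventually_abs_le_half hδ, eventually_abs_le_half hδ'] with ω hω hω'
    have := abs_tilt_sub_tilt_le (θ := θ) (ω := ω) (max_le hω hω') (le_max_left _ _)
      (le_max_right _ _) (j := j) (by omega)
    rw [one_mul, norm_eq_abs, norm_mul, norm_eq_abs (δ ω - δ' ω)]
    refine this.trans ?_
    rw [mul_assoc]
    gcongr
    exact le_abs_self _
  have h3 : (fun ω => (δ ω - δ' ω) * (tilt θ (j + 1) 0 ω - gmom 1 (j + 1))) =o[wFilter θ]
      (fun ω => δ ω - δ' ω) := by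
    have h4 : (fun ω => tilt θ (j + 1) 0 ω - gmom 1 (j + 1)) =o[wFilter θ] (fun _ => (1 : ℝ)) := by
      rw [isLittleO_one_iff]
      simpa using (tendsto_tilt_zero (θ := θ) (j + 1) (by omega)).sub_const (gmom 1 (j + 1))
    simpa using (isBigO_refl (fun ω => δ ω - δ' ω) (wFilter θ)).mul_isLittleO h4
  exact (h1.add h3).congr_left fun ω => by ring

/-! ### Critical points in standardised coordinates -/

/-- The relative error in the shape. -/
def shapeDev (θ τ : Fin 2 → ℝ) : ℝ := τ 0 / θ 0 - 1

/-- The shape times the logarithmic error in the scale. -/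
def scaleDev (θ τ : Fin 2 → ℝ) : ℝ := τ 0 * (log (τ 1) - log (θ 1))

lemma sum_eq_mul_avg {f : ℝ → ℝ} {n : ℕ} (hn : 0 < n) (x : Fin n → ℝ) :
    ∑ a, f (x a) = n * avg f x := by
  rw [avg]
  field_simp

section Critical

variable {θ τ : Fin 2 → ℝ} {t : ℝ} {ω : Sample}

/-- The exponent of the fitted model is affine in the standardised log-observation: `shapeDev`
perturbs the slope and `scaleDev` is the intercept. Hence the likelihood depends on the data through
tilted moments. -/
lemma mul_sub_log_eq (hθ : θ ∈ weibullParams) {x : ℝ} (hx : 0 < x) :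
    τ 0 * (log x - log (τ 1)) = (1 + shapeDev θ τ) * wlog θ x - scaleDev θ τ := by
  have := hθ.1.ne'
  rw [wlog, log_weibullStd hθ hx, shapeDev, scaleDev]
  field_simp
  ring

lemma sum_exp_eq (hθ : θ ∈ weibullParams) (hn : 0 < ω.1) (hx : ∀ a, 0 < ω.2 a) :
    ∑ a, exp (τ 0 * (log (ω.2 a) - log (τ 1))) =
      ω.1 * (exp (-scaleDev θ τ) * tilt θ 0 (shapeDev θ τ) ω) := by
  simp only [mul_sub_log_eq (τ := τ) hθ (hx _)]
  rw [tilt, ← avg_const_mul, ← sum_eq_mul_avg hn]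
  refine Finset.sum_congr rfl fun a _ => ?_
  rw [pow_zero, one_mul, ← exp_add]
  congr 1
  ring

lemma sum_mul_exp_eq (hθ : θ ∈ weibullParams) (hn : 0 < ω.1) (hx : ∀ a, 0 < ω.2 a) :
    ∑ a, τ 0 * (log (ω.2 a) - log (τ 1)) * exp (τ 0 * (log (ω.2 a) - log (τ 1))) =
      ω.1 * (exp (-scaleDev θ τ) * ((1 + shapeDev θ τ) * tilt θ 1 (shapeDev θ τ) ω -
        scaleDev θ τ * tilt θ 0 (shapeDev θ τ) ω)) := by
  simp only [mul_sub_log_eq (τ := τ) hθ (hx _)]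
  rw [tilt, tilt, ← avg_const_mul, ← avg_const_mul, ← avg_sub, ← avg_const_mul,
    ← sum_eq_mul_avg hn]
  refine Finset.sum_congr rfl fun a _ => ?_
  rw [sub_eq_add_neg ((1 + shapeDev θ τ) * wlog θ (ω.2 a)) (scaleDev θ τ), exp_add]
  ring

lemma sum_log_eq (hθ : θ ∈ weibullParams) (hn : 0 < ω.1) (hx : ∀ a, 0 < ω.2 a) :
    ∑ a, τ 0 * (log (ω.2 a) - log (τ 1)) =
      ω.1 * ((1 + shapeDev θ τ) * wbar θ ω - scaleDev θ τ) := by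
  simp only [mul_sub_log_eq (τ := τ) hθ (hx _)]
  rw [Finset.sum_sub_distrib, ← Finset.mul_sum, sum_eq_mul_avg hn, wbar]
  simp
  ring

/-- The effect of the penalty on the equation for the scale. -/
def scaleBias (t : ℝ) (τ : Fin 2 → ℝ) (n : ℕ) : ℝ :=
  t / n * ((2 * τ 1 ^ 2 / (1 + τ 1 ^ 2) - 1) / τ 0)

/-- The effect of the penalty on the equation for the shape. -/
def shapeBias (t : ℝ) (τ : Fin 2 → ℝ) (n : ℕ) : ℝ :=
  t / n * (2 * τ 0 ^ 2 / (1 + τ 0 ^ 2))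

/-- The scale equation, solved for the scale: up to the penalty, `scaleDev` is the logarithm of the
tilted mass. This is what allows the scale to be profiled out. -/
lemma IsCritMin.tilt_zero_eq (hθ : θ ∈ weibullParams) (hn : 0 < ω.1) (hx : ∀ a, 0 < ω.2 a)
    (h : IsCritMin t ω.2 τ) :
    tilt θ 0 (shapeDev θ τ) ω = exp (scaleDev θ τ) * (1 + scaleBias t τ ω.1) := by
  have heq := h.scale_eq
  obtain ⟨⟨hk, hl⟩, -⟩ := h
  have hn' : (0 : ℝ) < ω.1 := by positivity
  have h1 : ∑ a, weibullLog₁ 1 (τ 0) (τ 1) (log (ω.2 a)) =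
      τ 0 / τ 1 * ∑ a, exp (τ 0 * (log (ω.2 a) - log (τ 1))) - τ 0 / τ 1 * ω.1 := by
    rw [Finset.mul_sum, eq_sub_iff_add_eq]
    simp only [weibullLog₁, Matrix.cons_val_one, Matrix.cons_val_fin_one]
    rw [← sub_eq_zero, add_sub_right_comm, ← Finset.sum_sub_distrib]
    have : ∀ a, (τ 0 * exp (τ 0 * (log (ω.2 a) - log (τ 1))) - τ 0) / τ 1 -
        τ 0 / τ 1 * exp (τ 0 * (log (ω.2 a) - log (τ 1))) = -(τ 0 / τ 1) := fun a => by ring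
    simp [this]
    ring
  rw [h1, sum_exp_eq hθ hn hx, exp_neg] at heq
  have he := exp_pos (scaleDev θ τ)
  rw [scaleBias]
  field_simp at heq ⊢
  linarith

lemma IsCritMin.shape_tilt_eq (hθ : θ ∈ weibullParams) (hn : 0 < ω.1) (hx : ∀ a, 0 < ω.2 a)
    (h : IsCritMin t ω.2 τ) :
    (1 + shapeDev θ τ) * tilt θ 1 (shapeDev θ τ) ω =
      exp (scaleDev θ τ) * (1 + (1 + shapeDev θ τ) * wbar θ ω +
        scaleDev θ τ * scaleBias t τ ω.1 - shapeBias t τ ω.1) := by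
  have h0 := h.tilt_zero_eq hθ hn hx
  have heq := h.shape_eq
  obtain ⟨⟨hk, hl⟩, -⟩ := h
  have hn' : (0 : ℝ) < ω.1 := by positivity
  have h1 : ∑ a, weibullLog₁ 0 (τ 0) (τ 1) (log (ω.2 a)) =
      1 / τ 0 * (ω.1 + ∑ a, τ 0 * (log (ω.2 a) - log (τ 1)) -
        ∑ a, τ 0 * (log (ω.2 a) - log (τ 1)) * exp (τ 0 * (log (ω.2 a) - log (τ 1)))) := by
    have hc : (ω.1 : ℝ) = ∑ _a : Fin ω.1, (1 : ℝ) := by simp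
    rw [hc, ← Finset.sum_add_distrib, ← Finset.sum_sub_distrib, Finset.mul_sum]
    refine Finset.sum_congr rfl fun a _ => ?_
    simp only [weibullLog₁, Matrix.cons_val_zero]
    field_simp
  rw [h1, sum_mul_exp_eq hθ hn hx, sum_log_eq hθ hn hx, h0, exp_neg] at heq
  have he := exp_pos (scaleDev θ τ)
  rw [shapeBias]
  field_simp at heq ⊢
  linarith

/-- The profile score equation for the shape. -/
lemma IsCritMin.profile_eq (hθ : θ ∈ weibullParams) (hn : 0 < ω.1) (hx : ∀ a, 0 < ω.2 a)
    (h : IsCritMin t ω.2 τ) :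
    (1 + shapeDev θ τ) * tilt θ 1 (shapeDev θ τ) ω -
      (1 + (1 + shapeDev θ τ) * wbar θ ω) * tilt θ 0 (shapeDev θ τ) ω =
      tilt θ 0 (shapeDev θ τ) ω * (scaleDev θ τ * scaleBias t τ ω.1 - shapeBias t τ ω.1) -
        scaleBias t τ ω.1 * ((1 + shapeDev θ τ) * tilt θ 1 (shapeDev θ τ) ω) := by
  rw [h.shape_tilt_eq hθ hn hx, h.tilt_zero_eq hθ hn hx]
  ring

lemma tilt_pos (hn : 0 < ω.1) (δ : ℝ) : 0 < tilt θ 0 δ ω := by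
  rw [tilt, avg]
  have : (Finset.univ : Finset (Fin ω.1)).Nonempty := ⟨⟨0, hn⟩, Finset.mem_univ _⟩
  have hs : 0 < ∑ a, wlog θ (ω.2 a) ^ 0 * exp ((1 + δ) * wlog θ (ω.2 a)) :=
    Finset.sum_pos (fun a _ => by rw [pow_zero, one_mul]; exact exp_pos _) this
  positivity

/-- The logarithm of the tilted mass is convex in `δ` and lies above its tangent at `0`. The proof
is `eᵘ ≥ 1 + u` under the tilted empirical measure. -/
lemma le_log_tilt (hn : 0 < ω.1) (δ : ℝ) :
    δ * (tilt θ 1 0 ω / tilt θ 0 0 ω) + log (tilt θ 0 0 ω) ≤ log (tilt θ 0 δ ω) := by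
  have h0 := tilt_pos (θ := θ) hn 0
  set c := tilt θ 1 0 ω / tilt θ 0 0 ω with hc
  rw [← log_exp (δ * c), ← log_mul (exp_pos _).ne' h0.ne']
  refine log_le_log (by positivity) ?_
  have e : exp (δ * c) * tilt θ 0 0 ω = avg (fun x => exp (δ * c) *
      ((1 - δ * c) * (wlog θ x ^ 0 * exp ((1 + 0) * wlog θ x)) +
        δ * (wlog θ x ^ 1 * exp ((1 + 0) * wlog θ x)))) ω.2 := by
    rw [avg_const_mul, avg_add, avg_const_mul, avg_const_mul, ← tilt, ← tilt]
    have : tilt θ 1 0 ω = c * tilt θ 0 0 ω := by rw [hc]; field_simp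
    rw [this]
    ring
  rw [e, tilt]
  refine avg_le_avg fun a => ?_
  set z := wlog θ (ω.2 a)
  have h1 := add_one_le_exp (δ * z - δ * c)
  calc exp (δ * c) * ((1 - δ * c) * (z ^ 0 * exp ((1 + 0) * z)) + δ * (z ^ 1 * exp ((1 + 0) * z)))
      = exp (δ * c) * exp z * (δ * z - δ * c + 1) := by
        rw [add_zero, one_mul]
        ring
    _ ≤ exp (δ * c) * exp z * exp (δ * z - δ * c) := by gcongr
    _ = _ := by
        rw [← exp_add, ← exp_add, pow_zero, one_mul]
        congr 1
        ring

lemma crit_eq (hθ : θ ∈ weibullParams) (hn : 0 < ω.1)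
    (hx : ∀ a, 0 < ω.2 a) :
    crit t ω.2 (τ 0) (τ 1) = ω.1 * (-log (τ 0) + exp (-scaleDev θ τ) * tilt θ 0 (shapeDev θ τ) ω -
      ((1 + shapeDev θ τ) * wbar θ ω - scaleDev θ τ) + avg log ω.2) +
      t * weibullPen (τ 0) (τ 1) := by
  rw [crit, ← Finset.sum_neg_distrib]
  simp only [neg_weibullLog_eq]
  rw [Finset.sum_add_distrib, Finset.sum_add_distrib, Finset.sum_sub_distrib,
    sum_exp_eq hθ hn hx, sum_log_eq hθ hn hx, sum_eq_mul_avg (f := log) hn]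
  simp
  ring

/-- Optimality confines the relative error in the shape. -/
lemma IsCritMin.shapeDev_sub_log_le (hθ : θ ∈ weibullParams) (hn : 0 < ω.1)
    (hx : ∀ a, 0 < ω.2 a) (ht : 0 ≤ t) (h : IsCritMin t ω.2 τ) :
    shapeDev θ τ - log (1 + shapeDev θ τ) ≤
      shapeDev θ τ * (1 + wbar θ ω - tilt θ 1 0 ω / tilt θ 0 0 ω) +
        (tilt θ 0 0 ω - 1 - log (tilt θ 0 0 ω) + t * weibullPen (θ 0) (θ 1) / ω.1) := by
  have hn' : (0 : ℝ) < ω.1 := by positivity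
  have h1 := h.2 (θ 0) (θ 1) hθ.1 hθ.2
  rw [crit_eq hθ hn hx, crit_eq hθ hn hx] at h1
  have e1 : shapeDev θ θ = 0 := by rw [shapeDev, div_self hθ.1.ne', sub_self]
  have e2 : scaleDev θ θ = 0 := by rw [scaleDev, sub_self, mul_zero]
  rw [e1, e2] at h1
  have hlog : log (τ 0) = log (1 + shapeDev θ τ) + log (θ 0) := by
    rw [shapeDev, add_sub_cancel, log_div h.1.1.ne' hθ.1.ne']
    ring
  have hV := tilt_pos (θ := θ) hn (shapeDev θ τ)
  have h2 := add_one_le_exp (-scaleDev θ τ + log (tilt θ 0 (shapeDev θ τ) ω))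
  rw [exp_add, exp_log hV] at h2
  have h3 := le_log_tilt (θ := θ) hn (shapeDev θ τ)
  have h4 : 0 ≤ t * weibullPen (τ 0) (τ 1) := mul_nonneg ht (weibullPen_nonneg _ h.1.2)
  have h5 : -log (τ 0) + exp (-scaleDev θ τ) * tilt θ 0 (shapeDev θ τ) ω -
      ((1 + shapeDev θ τ) * wbar θ ω - scaleDev θ τ) ≤
      -log (θ 0) + tilt θ 0 0 ω - wbar θ ω + t * weibullPen (θ 0) (θ 1) / ω.1 := by
    refine le_of_mul_le_mul_left (a := (ω.1 : ℝ)) ?_ hn'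
    rw [mul_add, mul_div_cancel₀ _ hn'.ne']
    simp only [neg_zero, exp_zero, one_mul, add_zero, sub_zero] at h1
    linarith
  rw [hlog] at h5
  linarith

end Critical

lemma one_add_shapeDev_pos {θ τ : Fin 2 → ℝ} (hθ : θ ∈ weibullParams) (hτ : τ ∈ weibullParams) :
    0 < 1 + shapeDev θ τ := by
  rw [shapeDev, add_sub_cancel]
  exact div_pos hτ.1 hθ.1

/-- `log (1+δ) = 2 log √(1+δ) ≤ 2(√(1+δ) - 1)` gives `δ - log (1+δ) ≥ (√(1+δ) - 1)²` for all `δ >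
-1`. This global coercivity beats the linear term `δψ` when `|ψ| ≤ 1/2`, so no prior bound on `δ` is
needed. -/
lemma sq_sqrt_sub_one_le {δ ψ η : ℝ} (hδ : 0 < 1 + δ) (h : δ - log (1 + δ) ≤ δ * ψ + η)
    (hψ : |ψ| ≤ 1 / 2) : (√(1 + δ) - 1) ^ 2 ≤ 16 * ψ ^ 2 + 4 * |η| := by
  have hs : 0 < √(1 + δ) := sqrt_pos.2 hδ
  have h1 : log (1 + δ) ≤ 2 * (√(1 + δ) - 1) := by
    have := log_le_sub_one_of_pos hs
    rw [log_sqrt hδ.le] at this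
    linarith
  have h2 := sq_sqrt hδ.le
  set s := √(1 + δ) - 1 with hs'
  have h3 : δ = s ^ 2 + 2 * s := by rw [hs']; linarith
  have h4 : s ^ 2 ≤ (s ^ 2 + 2 * s) * ψ + η := by rw [← h3]; linarith
  have h5 : s ^ 2 * ψ ≤ s ^ 2 * (1 / 2) := by
    gcongr
    exact (le_abs_self _).trans hψ
  nlinarith [sq_nonneg (s - 4 * ψ), le_abs_self η]

/-! ### Consistency along the filter of good samples -/

section Localisation

variable {θ : Fin 2 → ℝ} {t : ℝ} {T : Sample → Fin 2 → ℝ}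

lemma eventually_isCritMin (h : ∀ ω ∈ validSamples, IsCritMin t ω.2 (T ω)) :
    ∀ᶠ ω in wFilter θ, 0 < ω.1 ∧ (∀ a, 0 < ω.2 a) ∧ IsCritMin t ω.2 (T ω) := by
  filter_upwards [eventually_size_pos, eventually_valid] with ω h1 h2
  exact ⟨h1, h2.1, h ω h2⟩

lemma tendsto_inv_size : Tendsto (fun ω : Sample => ((ω.1 : ℝ))⁻¹) (wFilter θ) (𝓝 0) :=
  tendsto_inv_atTop_zero.comp (tendsto_natCast_atTop_atTop.comp tendsto_size)

/-- Comparing a minimiser with the true parameter gives the inequality of `sq_sqrt_sub_one_le`,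
whose `ψ` tends to `1 - γ - (1 - γ) = 0`, the mean of the shape score, and whose `η` tends to zero
as well. -/
theorem tendsto_shapeDev (hθ : θ ∈ weibullParams) (ht : 0 ≤ t)
    (h : ∀ ω ∈ validSamples, IsCritMin t ω.2 (T ω)) :
    Tendsto (fun ω => shapeDev θ (T ω)) (wFilter θ) (𝓝 0) := by
  obtain ⟨-, g01, -, g10, g11, -⟩ := gmom_table
  have hV0 := tendsto_tilt_zero (θ := θ) 0 (by norm_num)
  have hV1 := tendsto_tilt_zero (θ := θ) 1 (by norm_num)
  rw [g10] at hV0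
  have hψ : Tendsto (fun ω => 1 + wbar θ ω - tilt θ 1 0 ω / tilt θ 0 0 ω) (wFilter θ) (𝓝 0) := by
    have := (tendsto_wbar (θ := θ)).const_add 1 |>.sub (hV1.div hV0 one_ne_zero)
    rw [g01, g11, div_one, show 1 + -eulerMascheroniConstant - (1 - eulerMascheroniConstant) =
      (0 : ℝ) by ring] at this
    exact this
  have hη : Tendsto (fun ω => tilt θ 0 0 ω - 1 - log (tilt θ 0 0 ω) +
      t * weibullPen (θ 0) (θ 1) / ω.1) (wFilter θ) (𝓝 0) := by
    have := ((hV0.sub_const 1).sub (hV0.log one_ne_zero)).add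
      ((tendsto_inv_size (θ := θ)).const_mul (t * weibullPen (θ 0) (θ 1)))
    simpa [div_eq_mul_inv] using this
  have hsq : Tendsto (fun ω => (√(1 + shapeDev θ (T ω)) - 1) ^ 2) (wFilter θ) (𝓝 0) := by
    have hup := ((hψ.pow 2).const_mul 16).add (hη.abs.const_mul 4)
    rw [zero_pow two_ne_zero, abs_zero, mul_zero, mul_zero, add_zero] at hup
    refine squeeze_zero' (Eventually.of_forall fun ω => sq_nonneg _) ?_ hup
    filter_upwards [eventually_abs_le_half hψ, eventually_isCritMin h] with ω h1 ⟨hn, hx, hc⟩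
    exact sq_sqrt_sub_one_le (one_add_shapeDev_pos hθ hc.1) (hc.shapeDev_sub_log_le hθ hn hx ht) h1
  have hs : Tendsto (fun ω => √(1 + shapeDev θ (T ω)) - 1) (wFilter θ) (𝓝 0) := by
    rw [tendsto_zero_iff_abs_tendsto_zero]
    have := hsq.sqrt
    simpa [sqrt_sq_eq_abs, Function.comp_def] using this
  have h2 := hsq.add (hs.const_mul 2)
  rw [mul_zero, add_zero] at h2
  refine h2.congr' ?_
  filter_upwards [eventually_isCritMin h] with ω ⟨_, _, hc⟩
  have := sq_sqrt (one_add_shapeDev_pos hθ hc.1).le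
  linarith

lemma tendsto_shape (hθ : θ ∈ weibullParams)
    (hδ : Tendsto (fun ω => shapeDev θ (T ω)) (wFilter θ) (𝓝 0)) :
    Tendsto (fun ω => T ω 0) (wFilter θ) (𝓝 (θ 0)) := by
  have := (hδ.const_add 1).const_mul (θ 0)
  rw [add_zero, mul_one] at this
  refine this.congr fun ω => ?_
  have := hθ.1.ne'
  rw [shapeDev]
  field_simp
  ring

/-- The factor that depends on the scale is bounded by `1` whatever the scale is, so no control of
the scale is needed at this stage. -/
lemma tendsto_scaleBias_zero (hθ : θ ∈ weibullParams)
    (hδ : Tendsto (fun ω => shapeDev θ (T ω)) (wFilter θ) (𝓝 0)) :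
    Tendsto (fun ω => scaleBias t (T ω) ω.1) (wFilter θ) (𝓝 0) := by
  have hk := (tendsto_shape hθ hδ).inv₀ hθ.1.ne'
  have h1 := ((tendsto_inv_size (θ := θ)).const_mul t).mul hk
  rw [mul_zero, zero_mul] at h1
  have hb : IsBoundedUnder (· ≤ ·) (wFilter θ)
      (fun ω => ‖2 * T ω 1 ^ 2 / (1 + T ω 1 ^ 2) - 1‖) := by
    refine isBoundedUnder_of ⟨1, fun ω => ?_⟩
    have h0 : 0 < 1 + T ω 1 ^ 2 := by positivity
    rw [norm_eq_abs, abs_le]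
    constructor
    · have : 0 ≤ 2 * T ω 1 ^ 2 / (1 + T ω 1 ^ 2) := by positivity
      linarith
    · have : 2 * T ω 1 ^ 2 / (1 + T ω 1 ^ 2) ≤ 2 := by
        rw [div_le_iff₀ h0]
        linarith
      linarith
  refine (h1.zero_mul_isBoundedUnder_le hb).congr fun ω => ?_
  rw [scaleBias]
  ring

lemma tendsto_scaleDev (hθ : θ ∈ weibullParams)
    (h : ∀ ω ∈ validSamples, IsCritMin t ω.2 (T ω))
    (hδ : Tendsto (fun ω => shapeDev θ (T ω)) (wFilter θ) (𝓝 0)) :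
    Tendsto (fun ω => scaleDev θ (T ω)) (wFilter θ) (𝓝 0) := by
  obtain ⟨-, -, -, g10, -⟩ := gmom_table
  have hV0 := tendsto_tilt hδ (j := 0) (by norm_num)
  rw [g10] at hV0
  have hq := (tendsto_scaleBias_zero (t := t) hθ hδ).const_add 1
  rw [add_zero] at hq
  have := (hV0.log one_ne_zero).sub (hq.log one_ne_zero)
  rw [log_one, sub_zero] at this
  refine this.congr' ?_
  filter_upwards [eventually_isCritMin h, hq.eventually (lt_mem_nhds one_pos)]
    with ω ⟨hn, hx, hc⟩ hq
  rw [hc.tilt_zero_eq hθ hn hx, log_mul (exp_pos _).ne' hq.ne', log_exp]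
  ring

end Localisation

/-! ### Expansion of an implicitly defined quantity -/

section Contract

variable {ι : Type*} [Fintype ι] {S : ι → ι → ℝ}

lemma contract_add_left (L₁ L₂ L' : ι → ℝ) :
    contract S (L₁ + L₂) L' = contract S L₁ L' + contract S L₂ L' := by
  simp [contract, add_mul, Finset.sum_add_distrib]

lemma contract_add_right (L L₁ L₂ : ι → ℝ) :
    contract S L (L₁ + L₂) = contract S L L₁ + contract S L L₂ := by
  simp [contract, mul_add, add_mul, Finset.sum_add_distrib]

lemma contract_sub_left (L₁ L₂ L' : ι → ℝ) :
    contract S (L₁ - L₂) L' = contract S L₁ L' - contract S L₂ L' := by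
  simp [contract, sub_mul, Finset.sum_sub_distrib]

lemma contract_sub_right (L L₁ L₂ : ι → ℝ) :
    contract S L (L₁ - L₂) = contract S L L₁ - contract S L L₂ := by
  simp [contract, mul_sub, sub_mul, Finset.sum_sub_distrib]

lemma contract_smul_left (a : ℝ) (L L' : ι → ℝ) :
    contract S (a • L) L' = a * contract S L L' := by
  simp [contract, Finset.mul_sum, mul_assoc]

lemma contract_smul_right (a : ℝ) (L L' : ι → ℝ) :
    contract S L (a • L') = a * contract S L L' := by
  simp only [contract, Finset.mul_sum, Pi.smul_apply, smul_eq_mul]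
  exact Finset.sum_congr rfl fun i _ => Finset.sum_congr rfl fun j _ => by ring

lemma contract_single_single [DecidableEq ι] (i j : ι) :
    contract S (Pi.single i 1) (Pi.single j 1) = S i j := by
  simp [contract, Pi.single_apply]

end Contract

namespace HasExpansion

variable {ι : Type*} [Fintype ι] {Ω : Type*} {l : Filter Ω} {ξ : Ω → ι → ℝ} {S : ι → ι → ℝ}
  {δ A₀ A₁ A₂ A₃ : Ω → ℝ} {c₁ c₂ c₃ B₀ B₁ B₂ B₃ : ℝ} {L₀ L₁ L₂ L₃ : ι → ℝ}

/-- One step of the fixed-point iteration that solves a cubic equation for `δ`. -/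
lemma implicit_step (hξ : Tendsto ξ l (𝓝 0)) (hc : c₁ ≠ 0) {N : ℕ} (hN : 1 ≤ N) (hN4 : N + 1 ≤ 4)
    (h₀ : HasExpansion l ξ S 4 A₀ 0 L₀ B₀) (h₁ : HasExpansion l ξ S 4 A₁ c₁ L₁ B₁)
    (h₂ : HasExpansion l ξ S 4 A₂ c₂ L₂ B₂) (h₃ : HasExpansion l ξ S 4 A₃ c₃ L₃ B₃)
    (heq : (fun ω => A₀ ω + A₁ ω * δ ω + A₂ ω * δ ω ^ 2 + A₃ ω * δ ω ^ 3) =O[l]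
      (fun ω => ‖ξ ω‖ ^ 4)) {L : ι → ℝ} {B : ℝ} (hδ : HasExpansion l ξ S N δ 0 L B) :
    HasExpansion l ξ S (N + 1) δ 0 ((-c₁⁻¹) • L₀)
      (-c₁⁻¹ * (B₀ + contract S L₁ L + c₂ * contract S L L)) := by
  have hN' : N ≤ N + 1 := Nat.le_succ N
  have k1 : HasExpansion l ξ S N (fun ω => A₁ ω - c₁) 0 L₁ B₁ :=
    ((h₁.mono hξ (by omega)).sub (const c₁)).of_eq (by simp) (by simp) (by simp)
  have k2 := mul_of_zero hξ hN hN4 k1 hδ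
  have k3 := mul_of_zero hξ hN hN4 hδ hδ
  have k4 := mul hξ hN4 (h₂.mono hξ hN4) k3
  have k5 := mul_of_zero hξ hN hN4 (k3.mono hξ hN') hδ
  have k6 := mul hξ hN4 (h₃.mono hξ hN4) k5
  have k7 := of_isBigO (S := S) (heq.trans (isBigO_norm_pow hξ hN4))
  have k8 := (((((h₀.mono hξ hN4).add k2).add k4).add k6).sub k7).const_mul (-c₁⁻¹)
  refine (k8.congr (Eventually.of_forall fun ω => ?_)).of_eq (by simp) (by simp)
    (by simp [contract])
  field_simp
  ring

/-- The equation first gives `δ = O(|ξ|)`; three fixed-point steps then raise the order from one to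
four. The cubic coefficient `A₃` influences neither the linear part nor the contraction. -/
lemma implicit (hξ : Tendsto ξ l (𝓝 0)) (hc : c₁ ≠ 0)
    (h₀ : HasExpansion l ξ S 4 A₀ 0 L₀ B₀) (h₁ : HasExpansion l ξ S 4 A₁ c₁ L₁ B₁)
    (h₂ : HasExpansion l ξ S 4 A₂ c₂ L₂ B₂) (h₃ : HasExpansion l ξ S 4 A₃ c₃ L₃ B₃)
    (hδ : Tendsto δ l (𝓝 0))
    (heq : (fun ω => A₀ ω + A₁ ω * δ ω + A₂ ω * δ ω ^ 2 + A₃ ω * δ ω ^ 3) =O[l]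
      (fun ω => δ ω ^ 4)) {L : ι → ℝ} (hL : L = (-c₁⁻¹) • L₀) :
    HasExpansion l ξ S 4 δ 0 L (-c₁⁻¹ * (B₀ + contract S L₁ L + c₂ * contract S L L)) := by
  have t1 := h₁.tendsto hξ (by norm_num)
  have t2 := h₂.tendsto hξ (by norm_num)
  have t3 := h₃.tendsto hξ (by norm_num)
  -- Since `δ → 0` and `A₁ → c₁ ≠ 0`, the linear terms dominate, so `δ` is comparable with `-A₀ /
  -- c₁`.
  have hlin : (fun ω => A₀ ω + c₁ * δ ω) =o[l] δ := by
    have e1 : (fun ω => (A₁ ω - c₁ + A₂ ω * δ ω + A₃ ω * δ ω ^ 2) * δ ω) =o[l] δ := by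
      have ht : Tendsto (fun ω => A₁ ω - c₁ + A₂ ω * δ ω + A₃ ω * δ ω ^ 2) l (𝓝 0) := by
        simpa using ((t1.sub_const c₁).add (t2.mul hδ)).add (t3.mul (hδ.pow 2))
      simpa using ((isLittleO_one_iff ℝ).2 ht).mul_isBigO (isBigO_refl δ l)
    have e2 : (fun ω => δ ω ^ 4) =o[l] δ := by
      have ht : Tendsto (fun ω => δ ω ^ 3) l (𝓝 0) := by simpa using hδ.pow 3
      have := ((isLittleO_one_iff ℝ).2 ht).mul_isBigO (isBigO_refl δ l)
      refine (this.congr_left fun ω => by ring).congr_right fun ω => by ring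
    exact ((heq.trans_isLittleO e2).sub e1).congr_left fun ω => by ring
  have hδO : δ =O[l] (fun ω => ‖ξ ω‖ ^ 1) := by
    have e1 : (fun ω => c₁ * δ ω) =O[l] A₀ := by
      have h1 : (fun ω => A₀ ω + c₁ * δ ω) =o[l] (fun ω => c₁ * δ ω) :=
        hlin.trans_isBigO ((isBigO_refl δ l).const_mul_right hc |>.trans (isBigO_refl _ _))
      have h2 := h1.right_isBigO_sub
      refine h2.trans (IsBigO.of_bound 1 (Eventually.of_forall fun ω => ?_))
      simp
    exact ((isBigO_const_mul_left_iff hc).1 e1).trans (h₀.isBigO_zero_const hξ (by norm_num))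
  have heq' := heq.trans ((hδO.pow 4).congr_right fun ω => by rw [pow_one])
  have s1 : HasExpansion l ξ S 1 δ 0 0 0 := of_isBigO hδO
  -- The first step fixes the linear part, the second the contraction, the third only improves the
  -- order of the remainder.
  have s2 := implicit_step hξ hc le_rfl (by norm_num) h₀ h₁ h₂ h₃ heq' s1
  have s3 := implicit_step hξ hc (by norm_num) (by norm_num) h₀ h₁ h₂ h₃ heq' s2
  have s4 := implicit_step hξ hc (by norm_num) (by norm_num) h₀ h₁ h₂ h₃ heq' s3
  subst hL
  exact s4

end HasExpansion

/-! ### Taylor expansions of elementary functions -/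

lemma log_taylor : (fun t : ℝ => log (1 + t) - (0 + 1 * t + (-1 / 2) * t ^ 2 + (1 / 3) * t ^ 3))
    =O[𝓝 0] (fun t => t ^ 4) := by
  refine IsBigO.of_bound 2 ?_
  filter_upwards [Metric.ball_mem_nhds (0 : ℝ) (show (0 : ℝ) < 1 / 2 by norm_num)] with t ht
  have ht' : |t| < 1 / 2 := by simpa using ht
  have h := abs_log_sub_add_sum_range_le (x := -t) (by rw [abs_neg]; linarith) 3
  simp only [Finset.sum_range_succ, Finset.sum_range_zero, abs_neg] at h
  norm_num at h
  rw [norm_eq_abs, norm_eq_abs, abs_pow]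
  have h2 : |t| ^ 4 / (1 - |t|) ≤ 2 * |t| ^ 4 := by
    rw [div_le_iff₀ (by linarith)]
    have : 0 ≤ |t| ^ 4 := by positivity
    nlinarith
  refine le_trans (le_of_eq ?_) (h.trans h2)
  congr 1
  ring

lemma inv_taylor : (fun t : ℝ => (1 + t)⁻¹ - (1 + (-1) * t + 1 * t ^ 2 + (-1) * t ^ 3))
    =O[𝓝 0] (fun t => t ^ 4) := by
  refine IsBigO.of_bound 2 ?_
  filter_upwards [Metric.ball_mem_nhds (0 : ℝ) (show (0 : ℝ) < 1 / 2 by norm_num)] with t ht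
  have ht' : |t| < 1 / 2 := by simpa using ht
  rw [abs_lt] at ht'
  have h0 : 0 < 1 + t := by linarith
  have e : (1 + t)⁻¹ - (1 + (-1) * t + 1 * t ^ 2 + (-1) * t ^ 3) = t ^ 4 * (1 + t)⁻¹ := by
    field_simp
    ring
  have h1 : (1 + t)⁻¹ ≤ 2 := by
    rw [inv_le_comm₀ h0 two_pos]
    linarith
  rw [e, norm_mul, mul_comm, norm_of_nonneg (inv_nonneg.2 h0.le)]
  gcongr

lemma exp_taylor : (fun t : ℝ => exp (0 + t) - (1 + 1 * t + (1 / 2) * t ^ 2 + (1 / 6) * t ^ 3))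
    =O[𝓝 0] (fun t => t ^ 4) := by
  have h := Real.exp_sub_sum_range_isBigO_pow 4
  refine h.congr_left fun t => ?_
  simp only [Finset.sum_range_succ, Finset.sum_range_zero, Nat.factorial, zero_add t]
  push_cast
  ring

/-! ### Expansion of the maximum likelihood estimator -/

/-- The coefficients of the cubic approximation to the profile score equation. -/
def profileCoeff (θ : Fin 2 → ℝ) (i : Fin 4) (ω : Sample) : ℝ :=
  ![tilt θ 1 0 ω - (1 + wbar θ ω) * tilt θ 0 0 ω,
    tilt θ 2 0 ω - wbar θ ω * tilt θ 1 0 ω - wbar θ ω * tilt θ 0 0 ω,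
    1 / 2 * tilt θ 3 0 ω + 1 / 2 * tilt θ 2 0 ω - 1 / 2 * (wbar θ ω * tilt θ 2 0 ω)
      - wbar θ ω * tilt θ 1 0 ω,
    1 / 6 * tilt θ 4 0 ω + 1 / 2 * tilt θ 3 0 ω - 1 / 6 * ((1 + wbar θ ω) * tilt θ 3 0 ω)
      - 1 / 2 * (wbar θ ω * tilt θ 2 0 ω)] i

/-- The linear part of the maximum likelihood estimator of the shape. -/
def mleShapeLin : Fin 7 → ℝ := (-(π ^ 2 / 6)⁻¹) • (Pi.single 2 1 -
  ((1 + gmom 0 1) • Pi.single 1 1 + gmom 1 0 • Pi.single 0 1))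

section

variable {θ : Fin 2 → ℝ} {T : Sample → Fin 2 → ℝ}

/-- Only the data that enter `HasExpansion.implicit` are made explicit: everything but the cubic
part for the constant coefficient, value and linear part for the slope, the value alone for the
quadratic one. -/
lemma expansion_profileCoeff (θ : Fin 2 → ℝ) :
    WExpansion θ 4 (profileCoeff θ 0) 0 (Pi.single 2 1 - ((1 + gmom 0 1) • Pi.single 1 1 +
      gmom 1 0 • Pi.single 0 1)) (-covMatrix (obsLaw weibullPDF θ) (wScore θ) 0 1) ∧
    (∃ B, WExpansion θ 4 (profileCoeff θ 1) (π ^ 2 / 6) (Pi.single 3 1 - (gmom 0 1 • Pi.single 2 1 +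
      gmom 1 1 • Pi.single 0 1) - (gmom 0 1 • Pi.single 1 1 + gmom 1 0 • Pi.single 0 1)) B) ∧
    (∃ L B, WExpansion θ 4 (profileCoeff θ 2) (1 / 2 * gmom 1 3 + 1 / 2 * gmom 1 2 -
      1 / 2 * (gmom 0 1 * gmom 1 2) - gmom 0 1 * gmom 1 1) L B) ∧
    (∃ c L B, WExpansion θ 4 (profileCoeff θ 3) c L B) := by
  obtain ⟨h0, h1, h2, h3, h4⟩ := expansion_tilt (θ := θ) 4
  have hz := expansion_wbar (θ := θ) 4
  have hξ : Tendsto (avgs (wScore θ)) (wFilter θ) (𝓝 0) := tendsto_avgs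
  have hz1 := (HasExpansion.const 1).add hz
  have k0 := h1.sub (hz1.mul hξ le_rfl h0)
  have k1 := (h2.sub (hz.mul hξ le_rfl h1)).sub (hz.mul hξ le_rfl h0)
  have k2 := (((h3.const_mul (1 / 2)).add (h2.const_mul (1 / 2))).sub
    ((hz.mul hξ le_rfl h2).const_mul (1 / 2))).sub (hz.mul hξ le_rfl h1)
  have k3 := (((h4.const_mul (1 / 6)).add (h3.const_mul (1 / 2))).sub
    ((hz1.mul hξ le_rfl h3).const_mul (1 / 6))).sub ((hz.mul hξ le_rfl h2).const_mul (1 / 2))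
  obtain ⟨-, g01, -, g10, g11, g12, -⟩ := gmom_table
  refine ⟨k0.of_eq ?_ ?_ ?_, ⟨_, k1.of_eq ?_ rfl rfl⟩, ⟨_, _, k2⟩, ⟨_, _, _, k3⟩⟩
  · rw [g01, g10, g11]
    ring
  · rw [zero_add]
  · simp [contract_single_single]
  · rw [g01, g10, g11, g12]
    ring

lemma profile_isBigO (hθ : θ ∈ weibullParams) (h : ∀ ω ∈ validSamples, IsCritMin 0 ω.2 (T ω)) :
    (fun ω => profileCoeff θ 0 ω + profileCoeff θ 1 ω * shapeDev θ (T ω) +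
      profileCoeff θ 2 ω * shapeDev θ (T ω) ^ 2 + profileCoeff θ 3 ω * shapeDev θ (T ω) ^ 3)
      =O[wFilter θ] (fun ω => shapeDev θ (T ω) ^ 4) := by
  have hδ := tendsto_shapeDev hθ le_rfl h
  have hz := tendsto_wbar (θ := θ)
  have r1 := tilt_isBigO hδ (j := 1) (N := 4) (by norm_num)
  have r0 := tilt_isBigO hδ (j := 0) (N := 4) (by norm_num)
  have b1 : (fun ω => -(1 + shapeDev θ (T ω))) =O[wFilter θ] (fun _ => (1 : ℝ)) :=
    ((hδ.const_add 1).neg).isBigO_one ℝ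
  have b0 : (fun ω => 1 + (1 + shapeDev θ (T ω)) * wbar θ ω) =O[wFilter θ] (fun _ => (1 : ℝ)) :=
    (((hδ.const_add 1).mul hz).const_add 1).isBigO_one ℝ
  -- The `δ⁴` term created when the factor `1 + δ` multiplies the cubic Taylor polynomials.
  have b2 : (fun ω => -(1 / 6 * tilt θ 4 0 ω - 1 / 6 * (wbar θ ω * tilt θ 3 0 ω)))
      =O[wFilter θ] (fun _ => (1 : ℝ)) :=
    ((((tendsto_tilt_zero 4 le_rfl).const_mul (1 / 6)).sub
      ((hz.mul (tendsto_tilt_zero 3 (by norm_num))).const_mul (1 / 6))).neg).isBigO_one ℝ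
  have hsum := ((b1.mul r1).add (b0.mul r0)).add
    (b2.mul (isBigO_refl (fun ω => shapeDev θ (T ω) ^ 4) (wFilter θ)))
  simp only [one_mul] at hsum
  refine hsum.congr' ?_ EventuallyEq.rfl
  filter_upwards [eventually_isCritMin h] with ω ⟨hn, hx, hc⟩
  have he := hc.profile_eq hθ hn hx
  simp only [scaleBias, shapeBias, zero_div, zero_mul, mul_zero, sub_zero] at he
  simp only [Finset.sum_range_succ, Finset.sum_range_zero, Nat.factorial, profileCoeff,
    Matrix.cons_val]
  norm_num
  linear_combination -he

lemma expansion_mle_shapeDev (hθ : θ ∈ weibullParams)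
    (h : ∀ ω ∈ validSamples, IsCritMin 0 ω.2 (T ω)) :
    WExpansion θ 4 (fun ω => shapeDev θ (T ω)) 0 mleShapeLin
      (18 * (π ^ 2 - 2 * apery) / π ^ 4) := by
  obtain ⟨h0, ⟨_, h1⟩, ⟨_, _, h2⟩, ⟨_, _, _, h3⟩⟩ := expansion_profileCoeff θ
  have hπ : π ^ 2 / 6 ≠ 0 := by positivity
  refine (HasExpansion.implicit tendsto_avgs hπ h0 h1 h2 h3 (tendsto_shapeDev hθ le_rfl h)
    (profile_isBigO hθ h) (L := mleShapeLin) rfl).of_eq rfl rfl ?_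
  obtain ⟨s00, s01, s02, s03, s11, s12, s13, s22, s23⟩ := covMatrix_wScore_table hθ
  have sc := fun i j => covMatrix_comm (obsLaw weibullPDF θ) (wScore θ) i j
  obtain ⟨g00, g01, g02, g10, g11, g12, g13, g20, g21, g22, g23⟩ := gmom_table
  have hπ0 := pi_pos.ne'
  simp only [mleShapeLin, contract_add_left, contract_add_right, contract_sub_left,
    contract_sub_right, contract_smul_left, contract_smul_right, contract_single_single]
  rw [sc 1 0, sc 2 0, sc 2 1, sc 3 0, sc 3 1, sc 3 2, s00, s01, s02, s03, s11, s12, s13, s22, s23]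
  simp only [g01, g02, g10, g11, g12, g13, g20, g21, g22, g23]
  field_simp
  ring

end

section

variable {θ : Fin 2 → ℝ} {T : Sample → Fin 2 → ℝ}

lemma shape_eq_mul (hθ : θ ∈ weibullParams) (τ : Fin 2 → ℝ) : τ 0 = θ 0 * (1 + shapeDev θ τ) := by
  have := hθ.1.ne'
  rw [shapeDev]
  field_simp
  ring

lemma scale_eq_mul_exp (hθ : θ ∈ weibullParams) {τ : Fin 2 → ℝ} (hτ : τ ∈ weibullParams) :
    τ 1 = θ 1 * exp ((θ 0)⁻¹ * (scaleDev θ τ * (1 + shapeDev θ τ)⁻¹)) := by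
  have h1 := hθ.1.ne'
  have h2 := hτ.1.ne'
  have e : (θ 0)⁻¹ * (scaleDev θ τ * (1 + shapeDev θ τ)⁻¹) = log (τ 1) - log (θ 1) := by
    rw [shapeDev, scaleDev, add_sub_cancel]
    field_simp
  rw [e, exp_sub, exp_log hτ.2, exp_log hθ.2, mul_div_cancel₀ _ hθ.2.ne']

theorem expansion_mle_shape (hθ : θ ∈ weibullParams)
    (h : ∀ ω ∈ validSamples, IsCritMin 0 ω.2 (T ω)) :
    ∃ L, WExpansion θ 4 (fun ω => T ω 0) (θ 0) L (weibullMLECoeff (θ 0) (θ 1) 0) := by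
  have h1 := ((HasExpansion.const 1).add (expansion_mle_shapeDev hθ h)).const_mul (θ 0)
  refine ⟨_, (h1.congr (Eventually.of_forall fun ω =>
    (shape_eq_mul hθ (T ω)).symm)).of_eq (by ring) rfl ?_⟩
  simp only [weibullMLECoeff, Matrix.cons_val_zero]
  ring

/-- The linear part of the logarithm of the tilted mass at the estimated shape. -/
def mleScaleLin : Fin 7 → ℝ := Pi.single 1 1 + gmom 1 1 • mleShapeLin

lemma expansion_mle_tilt (hθ : θ ∈ weibullParams)
    (h : ∀ ω ∈ validSamples, IsCritMin 0 ω.2 (T ω)) :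
    WExpansion θ 4 (fun ω => tilt θ 0 (shapeDev θ (T ω)) ω) 1 mleScaleLin
      (gmom 1 1 * (18 * (π ^ 2 - 2 * apery) / π ^ 4) +
        contract (covMatrix (obsLaw weibullPDF θ) (wScore θ)) mleShapeLin (Pi.single 2 1) +
        1 / 2 * gmom 1 2 *
          contract (covMatrix (obsLaw weibullPDF θ) (wScore θ)) mleShapeLin mleShapeLin) := by
  obtain ⟨h0, h1, h2, h3, -⟩ := expansion_tilt (θ := θ) 4
  have hξ : Tendsto (avgs (wScore θ)) (wFilter θ) (𝓝 0) := tendsto_avgs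
  have hδ := expansion_mle_shapeDev hθ h
  have hδ2 := hδ.mul hξ le_rfl hδ
  have hδ3 := hδ2.mul hξ le_rfl hδ
  have hs := ((h0.add (hδ.mul hξ le_rfl h1)).add ((hδ2.mul hξ le_rfl h2).const_mul (1 / 2))).add
    ((hδ3.mul hξ le_rfl h3).const_mul (1 / 6))
  obtain ⟨-, -, -, g10, -⟩ := gmom_table
  refine (hs.congr_isBigO ?_).of_eq (by rw [g10]; ring) ?_ ?_
  · have r := tilt_isBigO (tendsto_shapeDev hθ le_rfl h) (j := 0) (N := 4) (by norm_num)
    have hO := (hδ.isBigO_zero_const hξ (by norm_num)).pow 4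
    refine ((r.trans hO).congr_left fun ω => ?_).congr_right fun ω => by rw [pow_one]
    simp only [Finset.sum_range_succ, Finset.sum_range_zero, Nat.factorial]
    norm_num
    ring
  · simp [mleScaleLin]
  · simp [HasExpansion.contract_zero_left]
    ring

/-- The scale is `λ exp (m / (k (1 + δ)))`, where without penalty `m` is the logarithm of the tilted
mass. Taylor expansions of `log`, the inverse and `exp` are composed. -/
theorem expansion_mle_scale (hθ : θ ∈ weibullParams)
    (h : ∀ ω ∈ validSamples, IsCritMin 0 ω.2 (T ω)) :
    ∃ L, WExpansion θ 4 (fun ω => T ω 1) (θ 1) L (weibullMLECoeff (θ 0) (θ 1) 1) := by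
  have hξ : Tendsto (avgs (wScore θ)) (wFilter θ) (𝓝 0) := tendsto_avgs
  have hm := (expansion_mle_tilt hθ h).comp hξ log_taylor
  have hδ1 : WExpansion θ 4 (fun ω => 1 + shapeDev θ (T ω)) 1 mleShapeLin
      (18 * (π ^ 2 - 2 * apery) / π ^ 4) :=
    ((HasExpansion.const 1).add (expansion_mle_shapeDev hθ h)).of_eq (by simp) (by simp) (by simp)
  have hi := hδ1.comp hξ (φ := fun t => t⁻¹) inv_taylor
  have hr := ((hm.mul hξ le_rfl hi).const_mul (θ 0)⁻¹).of_eq (c' := 0) (by simp) rfl rfl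
  have he := (hr.comp hξ exp_taylor).const_mul (θ 1)
  refine ⟨_, (he.congr ?_).of_eq (mul_one _) rfl ?_⟩
  · filter_upwards [eventually_isCritMin h] with ω ⟨hn, hx, hc⟩
    rw [scale_eq_mul_exp hθ hc.1, hc.tilt_zero_eq hθ hn hx]
    simp [scaleBias]
  · obtain ⟨s00, s01, s02, s03, s11, s12, s13, s22, s23⟩ := covMatrix_wScore_table hθ
    have sc := fun i j => covMatrix_comm (obsLaw weibullPDF θ) (wScore θ) i j
    obtain ⟨g00, g01, g02, g10, g11, g12, g13, g20, g21, g22, g23⟩ := gmom_table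
    have hπ0 := pi_pos.ne'
    have hk := hθ.1.ne'
    simp only [mleScaleLin, mleShapeLin, contract_add_left, contract_add_right, contract_sub_left,
      contract_sub_right, contract_smul_left, contract_smul_right, contract_single_single,
      zero_smul, zero_add]
    rw [sc 1 0, sc 2 0, sc 2 1, s00, s01, s02, s11, s12, s22]
    simp only [g01, g02, g10, g11, g12, g20, g21, g22, weibullMLECoeff, Matrix.cons_val_one,
      Matrix.cons_val_fin_one]
    field_simp
    ring

end

/-! ### The difference between the two estimators -/

section General

variable {Ω : Type*} {l : Filter Ω} {N X Y : Ω → ℝ} {c d : ℝ}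

/-- The delta method for two moving arguments, which is why strict differentiability is required. -/
lemma tendsto_mul_comp_sub {f : ℝ → ℝ} {f' : ℝ} (hf : HasStrictDerivAt f f' c)
    (hX : Tendsto X l (𝓝 c)) (hY : Tendsto Y l (𝓝 c))
    (h : Tendsto (fun ω => N ω * (X ω - Y ω)) l (𝓝 d)) :
    Tendsto (fun ω => N ω * (f (X ω) - f (Y ω))) l (𝓝 (f' * d)) := by
  have h1 := hf.isLittleO.comp_tendsto (hX.prodMk_nhds hY)
  have h2 := (isBigO_refl N l).mul_isLittleO h1
  have h3 := (isLittleO_one_iff ℝ).1 (h2.trans_isBigO (h.isBigO_one ℝ))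
  have h4 := h3.add (h.const_mul f')
  rw [zero_add] at h4
  refine h4.congr fun ω => ?_
  simp
  ring

lemma tendsto_mul_of_isLittleO {D G : Ω → ℝ} (hc : c ≠ 0)
    (h : (fun ω => G ω - c * D ω) =o[l] D) (hG : Tendsto (fun ω => N ω * G ω) l (𝓝 d)) :
    Tendsto (fun ω => N ω * D ω) l (𝓝 (c⁻¹ * d)) := by
  have h1 : (fun ω => N ω * (c⁻¹ * G ω)) ~[l] (fun ω => N ω * D ω) := by
    refine (IsEquivalent.refl (u := N)).mul ?_
    refine (h.const_mul_left c⁻¹).congr_left fun ω => ?_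
    simp only [Pi.sub_apply]
    field_simp
  refine h1.tendsto_nhds ((hG.const_mul c⁻¹).congr fun ω => ?_)
  ring

end General

variable {θ : Fin 2 → ℝ} {t : ℝ} {T T' : Sample → Fin 2 → ℝ}

lemma tendsto_scale (hθ : θ ∈ weibullParams) (ht : 0 ≤ t)
    (h : ∀ ω ∈ validSamples, IsCritMin t ω.2 (T ω)) :
    Tendsto (fun ω => T ω 1) (wFilter θ) (𝓝 (θ 1)) := by
  have hδ := tendsto_shapeDev hθ ht h
  have hm := tendsto_scaleDev hθ h hδ
  have hi := (hδ.const_add 1).inv₀ (by norm_num)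
  have := ((((hm.mul hi).const_mul (θ 0)⁻¹).rexp).const_mul (θ 1))
  simp only [zero_mul, mul_zero, exp_zero, mul_one] at this
  refine this.congr' ?_
  filter_upwards [eventually_isCritMin h] with ω ⟨hn, hx, hc⟩
  rw [scale_eq_mul_exp hθ hc.1]

lemma tendsto_size_mul_scaleBias (hθ : θ ∈ weibullParams) (ht : 0 ≤ t)
    (h : ∀ ω ∈ validSamples, IsCritMin t ω.2 (T ω)) :
    Tendsto (fun ω => (ω.1 : ℝ) * scaleBias t (T ω) ω.1) (wFilter θ)
      (𝓝 (t * ((2 * θ 1 ^ 2 / (1 + θ 1 ^ 2) - 1) / θ 0))) := by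
  have hk := tendsto_shape hθ (tendsto_shapeDev hθ ht h)
  have hl := tendsto_scale hθ ht h
  have := (((((hl.pow 2).const_mul 2).div ((hl.pow 2).const_add 1) (by positivity)).sub_const
    1).div hk hθ.1.ne').const_mul t
  refine this.congr' ?_
  filter_upwards [eventually_size_pos] with ω hn
  have : (ω.1 : ℝ) ≠ 0 := by positivity
  simp only [scaleBias, Pi.div_apply]
  field_simp

lemma tendsto_size_mul_shapeBias (hθ : θ ∈ weibullParams) (ht : 0 ≤ t)
    (h : ∀ ω ∈ validSamples, IsCritMin t ω.2 (T ω)) :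
    Tendsto (fun ω => (ω.1 : ℝ) * shapeBias t (T ω) ω.1) (wFilter θ)
      (𝓝 (t * (2 * θ 0 ^ 2 / (1 + θ 0 ^ 2)))) := by
  have hk := tendsto_shape hθ (tendsto_shapeDev hθ ht h)
  have := (((hk.pow 2).const_mul 2).div ((hk.pow 2).const_add 1) (by positivity)).const_mul t
  refine this.congr' ?_
  filter_upwards [eventually_size_pos] with ω hn
  have : (ω.1 : ℝ) ≠ 0 := by positivity
  simp only [shapeBias, Pi.div_apply]
  field_simp

/-- The limit of `n` times the difference of the relative errors in the shape. -/
def shapeShift (θ : Fin 2 → ℝ) : ℝ :=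
  (π ^ 2 / 6)⁻¹ * (-(2 * θ 0 ^ 2 / (1 + θ 0 ^ 2)) -
    (2 * θ 1 ^ 2 / (1 + θ 1 ^ 2) - 1) / θ 0 * gmom 1 1)

/-- Both estimators satisfy the profile equation of the same sample; the penalised one has the extra
right-hand side `G`. The difference of the left-hand sides is `(π²/6 + o(1))` times the difference
of the shape errors, and `n G` converges. -/
lemma tendsto_size_mul_shapeDev_sub (hθ : θ ∈ weibullParams)
    (h : ∀ ω ∈ validSamples, IsCritMin 0 ω.2 (T ω))
    (h' : ∀ ω ∈ validSamples, IsCritMin 1 ω.2 (T' ω)) :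
    Tendsto (fun ω => (ω.1 : ℝ) * (shapeDev θ (T' ω) - shapeDev θ (T ω))) (wFilter θ)
      (𝓝 (shapeShift θ)) := by
  obtain ⟨-, g01, -, g10, g11, g12, -⟩ := gmom_table
  have hδ := tendsto_shapeDev hθ le_rfl h
  have hδ' := tendsto_shapeDev hθ zero_le_one h'
  have hm' := tendsto_scaleDev hθ h' hδ'
  have hz := tendsto_wbar (θ := θ)
  have hV0 := tendsto_tilt hδ' (j := 0) (by norm_num)
  have hV1 := tendsto_tilt hδ' (j := 1) (by norm_num)
  rw [g10] at hV0
  have hq0 := tendsto_size_mul_scaleBias hθ zero_le_one h'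
  have hq1 := tendsto_size_mul_shapeBias hθ zero_le_one h'
  set D : Sample → ℝ := fun ω => shapeDev θ (T' ω) - shapeDev θ (T ω) with hD
  set G : Sample → ℝ := fun ω => tilt θ 0 (shapeDev θ (T' ω)) ω *
    (scaleDev θ (T' ω) * scaleBias 1 (T' ω) ω.1 - shapeBias 1 (T' ω) ω.1) -
      scaleBias 1 (T' ω) ω.1 * ((1 + shapeDev θ (T' ω)) * tilt θ 1 (shapeDev θ (T' ω)) ω) with hG
  have hnG : Tendsto (fun ω => (ω.1 : ℝ) * G ω) (wFilter θ)
      (𝓝 (-(2 * θ 0 ^ 2 / (1 + θ 0 ^ 2)) - (2 * θ 1 ^ 2 / (1 + θ 1 ^ 2) - 1) / θ 0 * gmom 1 1)) := by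
    have := (hV0.mul ((hm'.mul hq0).sub hq1)).sub (hq0.mul ((hδ'.const_add 1).mul hV1))
    simp only [zero_mul, one_mul, add_zero, zero_sub] at this
    refine this.congr fun ω => ?_
    rw [hG]
    ring
  refine tendsto_mul_of_isLittleO (c := π ^ 2 / 6) (by positivity) ?_ hnG
  have o0 := tilt_sub_tilt_isLittleO hδ' hδ (j := 0) (by norm_num)
  have o1 := tilt_sub_tilt_isLittleO hδ' hδ (j := 1) (by norm_num)
  have b0 : (fun ω => -(1 + (1 + shapeDev θ (T ω)) * wbar θ ω)) =O[wFilter θ]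
      (fun _ => (1 : ℝ)) := (((((hδ.const_add 1).mul hz).const_add 1).neg).isBigO_one ℝ)
  have b1 : (fun ω => 1 + shapeDev θ (T ω)) =O[wFilter θ] (fun _ => (1 : ℝ)) :=
    (hδ.const_add 1).isBigO_one ℝ
  -- The coefficient of the difference of the shape errors, after the differences of tilted moments
  -- have been linearised; by the moment table it tends to `π²/6`.
  have o2 : (fun ω => tilt θ 1 (shapeDev θ (T' ω)) ω + (1 + shapeDev θ (T ω)) * gmom 1 2 -
      wbar θ ω * tilt θ 0 (shapeDev θ (T' ω)) ω - (1 + (1 + shapeDev θ (T ω)) * wbar θ ω) * gmom 1 1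
      - π ^ 2 / 6) =o[wFilter θ] (fun _ => (1 : ℝ)) := by
    rw [isLittleO_one_iff]
    have := (((hV1.add ((hδ.const_add 1).mul_const (gmom 1 2))).sub (hz.mul hV0)).sub
      ((((hδ.const_add 1).mul hz).const_add 1).mul_const (gmom 1 1))).sub_const (π ^ 2 / 6)
    rw [g01, g11, g12] at this
    rw [g11, g12]
    convert this using 2
    ring
  have hs := ((b1.mul_isLittleO o1).add (b0.mul_isLittleO o0)).add
    (o2.mul_isBigO (isBigO_refl D (wFilter θ)))
  simp only [one_mul] at hs
  refine hs.congr' ?_ EventuallyEq.rfl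
  filter_upwards [eventually_isCritMin h, eventually_isCritMin h'] with ω ⟨hn, hx, hc⟩ ⟨_, _, hc'⟩
  have he := hc.profile_eq hθ hn hx
  have he' := hc'.profile_eq hθ hn hx
  simp only [scaleBias, shapeBias, zero_div, zero_mul, mul_zero, sub_zero] at he
  simp only [hG, hD]
  rw [← he']
  linear_combination -he

theorem tendsto_size_mul_shape_sub (hθ : θ ∈ weibullParams)
    (h : ∀ ω ∈ validSamples, IsCritMin 0 ω.2 (T ω))
    (h' : ∀ ω ∈ validSamples, IsCritMin 1 ω.2 (T' ω)) :
    Tendsto (fun ω => (ω.1 : ℝ) * (T' ω 0 - T ω 0)) (wFilter θ)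
      (𝓝 (weibullWFCorrection (θ 0) (θ 1) 0)) := by
  have := (tendsto_size_mul_shapeDev_sub hθ h h').const_mul (θ 0)
  obtain ⟨-, -, -, -, g11, -⟩ := gmom_table
  have e : θ 0 * shapeShift θ = weibullWFCorrection (θ 0) (θ 1) 0 := by
    have hk := hθ.1.ne'
    have hπ := pi_pos.ne'
    have h1 : 1 + θ 0 ^ 2 ≠ 0 := by positivity
    have h2 : 1 + θ 1 ^ 2 ≠ 0 := by positivity
    simp only [shapeShift, weibullWFCorrection, Matrix.cons_val_zero, g11, add_comm (_ ^ 2) (1 : ℝ)]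
    field_simp
    ring
  rw [e] at this
  refine this.congr fun ω => ?_
  rw [shape_eq_mul hθ (T' ω), shape_eq_mul hθ (T ω)]
  ring

theorem tendsto_size_mul_scale_sub (hθ : θ ∈ weibullParams)
    (h : ∀ ω ∈ validSamples, IsCritMin 0 ω.2 (T ω))
    (h' : ∀ ω ∈ validSamples, IsCritMin 1 ω.2 (T' ω)) :
    Tendsto (fun ω => (ω.1 : ℝ) * (T' ω 1 - T ω 1)) (wFilter θ)
      (𝓝 (weibullWFCorrection (θ 0) (θ 1) 1)) := by
  obtain ⟨-, -, -, g10, g11, -⟩ := gmom_table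
  have hδ := tendsto_shapeDev hθ le_rfl h
  have hδ' := tendsto_shapeDev hθ zero_le_one h'
  have hm := tendsto_scaleDev hθ h hδ
  have hm' := tendsto_scaleDev hθ h' hδ'
  have hd := tendsto_size_mul_shapeDev_sub hθ h h'
  have hV0 := tendsto_tilt hδ (j := 0) (by norm_num)
  have hV0' := tendsto_tilt hδ' (j := 0) (by norm_num)
  rw [g10] at hV0 hV0'
  have hV : Tendsto (fun ω => (ω.1 : ℝ) * (tilt θ 0 (shapeDev θ (T' ω)) ω -
      tilt θ 0 (shapeDev θ (T ω)) ω)) (wFilter θ) (𝓝 (shapeShift θ * gmom 1 1)) := by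
    have o := tilt_sub_tilt_isLittleO hδ' hδ (j := 0) (by norm_num)
    have o1 := (isBigO_refl (fun ω : Sample => (ω.1 : ℝ)) (wFilter θ)).mul_isLittleO o
    have o2 := ((isLittleO_one_iff ℝ).1 (o1.trans_isBigO (hd.isBigO_one ℝ))).add
      (hd.mul_const (gmom 1 1))
    simp only [zero_add] at o2
    refine o2.congr fun ω => ?_
    ring
  have hq0 := tendsto_size_mul_scaleBias hθ zero_le_one h'
  have hq := tendsto_scaleBias_zero (t := 1) hθ hδ'
  have hlogV := tendsto_mul_comp_sub (hasStrictDerivAt_log one_ne_zero) hV0' hV0 hV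
  have hlogq := tendsto_mul_comp_sub (N := fun ω : Sample => (ω.1 : ℝ))
    (hasStrictDerivAt_log one_ne_zero) (X := fun ω => 1 + scaleBias 1 (T' ω) ω.1)
    (Y := fun _ => 1) (by simpa using hq.const_add 1) tendsto_const_nhds (by simpa using hq0)
  have hM : Tendsto (fun ω => (ω.1 : ℝ) * (scaleDev θ (T' ω) - scaleDev θ (T ω))) (wFilter θ)
      (𝓝 (shapeShift θ * gmom 1 1 - (2 * θ 1 ^ 2 / (1 + θ 1 ^ 2) - 1) / θ 0)) := by
    have := hlogV.sub hlogq
    simp only [inv_one, one_mul] at this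
    refine this.congr' ?_
    filter_upwards [eventually_isCritMin h, eventually_isCritMin h',
      (hq.const_add 1).eventually (lt_mem_nhds (by norm_num : (0 : ℝ) < 1 + 0))]
      with ω ⟨hn, hx, hc⟩ ⟨_, _, hc'⟩ hpos
    rw [hc.tilt_zero_eq hθ hn hx, hc'.tilt_zero_eq hθ hn hx,
      log_mul (exp_pos _).ne' hpos.ne', log_exp]
    simp only [scaleBias, zero_div, zero_mul, add_zero, mul_one, log_exp, log_one]
    ring
  have h1 : Tendsto (fun ω => 1 + shapeDev θ (T ω)) (wFilter θ) (𝓝 1) := by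
    simpa using hδ.const_add 1
  have h1' : Tendsto (fun ω => 1 + shapeDev θ (T' ω)) (wFilter θ) (𝓝 1) := by
    simpa using hδ'.const_add 1
  have hinv := tendsto_mul_comp_sub (hasStrictDerivAt_inv one_ne_zero) h1' h1
    (by simpa using hd)
  have hR : Tendsto (fun ω => (ω.1 : ℝ) * ((θ 0)⁻¹ * (scaleDev θ (T' ω) * (1 + shapeDev θ (T' ω))⁻¹)
      - (θ 0)⁻¹ * (scaleDev θ (T ω) * (1 + shapeDev θ (T ω))⁻¹))) (wFilter θ)
      (𝓝 ((θ 0)⁻¹ * (shapeShift θ * gmom 1 1 -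
        (2 * θ 1 ^ 2 / (1 + θ 1 ^ 2) - 1) / θ 0))) := by
    have := ((hM.mul (h1'.inv₀ one_ne_zero)).add (hm.mul hinv)).const_mul (θ 0)⁻¹
    simp only [inv_one, mul_one, zero_mul, add_zero] at this
    refine this.congr fun ω => ?_
    ring
  have hX : ∀ {τ : Sample → Fin 2 → ℝ}, Tendsto (fun ω => scaleDev θ (τ ω)) (wFilter θ) (𝓝 0) →
      Tendsto (fun ω => 1 + shapeDev θ (τ ω)) (wFilter θ) (𝓝 1) →
      Tendsto (fun ω => (θ 0)⁻¹ * (scaleDev θ (τ ω) * (1 + shapeDev θ (τ ω))⁻¹)) (wFilter θ)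
        (𝓝 0) := by
    intro τ a b
    simpa using (a.mul (b.inv₀ one_ne_zero)).const_mul (θ 0)⁻¹
  have hE := (tendsto_mul_comp_sub (Real.hasStrictDerivAt_exp 0) (hX hm' h1') (hX hm h1)
    hR).const_mul (θ 1)
  have e : θ 1 * (exp 0 * ((θ 0)⁻¹ * (shapeShift θ * gmom 1 1 -
      (2 * θ 1 ^ 2 / (1 + θ 1 ^ 2) - 1) / θ 0))) = weibullWFCorrection (θ 0) (θ 1) 1 := by
    have hk := hθ.1.ne'
    have hπ := pi_pos.ne'
    have h1 : 1 + θ 0 ^ 2 ≠ 0 := by positivity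
    have h2 : 1 + θ 1 ^ 2 ≠ 0 := by positivity
    simp only [shapeShift, weibullWFCorrection, Matrix.cons_val_one, Matrix.cons_val_fin_one, g11,
      add_comm (_ ^ 2) (1 : ℝ), exp_zero]
    field_simp
    ring
  rw [e] at hE
  refine hE.congr' ?_
  filter_upwards [eventually_isCritMin h, eventually_isCritMin h'] with ω ⟨_, _, hc⟩ ⟨_, _, hc'⟩
  rw [scale_eq_mul_exp hθ hc.1, scale_eq_mul_exp hθ hc'.1]
  ring

/-! ### Moment bounds for the estimators -/

/-- A negative power of the gap between two logarithms. -/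
def logGap (p : ℝ × ℝ) : ℝ := |log p.1 - log p.2| ^ (-(3 / 4) : ℝ)

/-- A negative power, cut off to the unit interval. -/
def cutPow : ℝ → ℝ := indicator (Ioo 0 1) (fun t => t ^ (-(3 / 4) : ℝ))

lemma integrable_cutPow : Integrable cutPow := by
  rw [cutPow, integrable_indicator_iff measurableSet_Ioo,
    intervalIntegral.integrableOn_Ioo_rpow_iff one_pos]
  norm_num

lemma cutPow_nonneg (t : ℝ) : 0 ≤ cutPow t :=
  indicator_nonneg (fun _ ht => rpow_nonneg ht.1.le _) t

lemma abs_rpow_le_cutPow (t : ℝ) : |t| ^ (-(3 / 4) : ℝ) ≤ 1 + cutPow t + cutPow (-t) := by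
  have h1 := cutPow_nonneg t
  have h2 := cutPow_nonneg (-t)
  rcases eq_or_ne t 0 with rfl | h0
  · rw [abs_zero, zero_rpow (by norm_num)]
    linarith
  rcases le_or_gt 1 |t| with h | h
  · have := rpow_le_one_of_one_le_of_nonpos h (by norm_num : (-(3 / 4) : ℝ) ≤ 0)
    linarith
  rcases lt_or_gt_of_ne h0 with ht | ht
  · rw [abs_of_neg ht] at h ⊢
    have : cutPow (-t) = (-t) ^ (-(3 / 4) : ℝ) := indicator_of_mem (show -t ∈ Ioo (0 : ℝ) 1 from ⟨by linarith, h⟩) _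
    linarith
  · rw [abs_of_pos ht] at h ⊢
    have : cutPow t = t ^ (-(3 / 4) : ℝ) := indicator_of_mem (show t ∈ Ioo (0 : ℝ) 1 from ⟨ht, h⟩) _
    linarith

/-- The kernel that dominates `logGap` on pairs of positive numbers. -/
def gapKernel (x y : ℝ) : ℝ := |1 + x| * (|1 + y| * |x - y| ^ (-(3 / 4) : ℝ))

/-- `|log x - log y| ≥ |x - y|/(x + y)`, and `(x + y)^{3/4} ≤ (1 + x)(1 + y)`. At `x = y` the
convention `0 ^ (-3/4) = 0` keeps the bound true. -/
lemma logGap_le_gapKernel {x y : ℝ} (hx : 0 < x) (hy : 0 < y) : logGap (x, y) ≤ gapKernel x y := by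
  rcases eq_or_ne x y with rfl | hne
  · rw [logGap, sub_self, abs_zero, zero_rpow (by norm_num)]
    unfold gapKernel
    positivity
  have hlog : |x - y| / (x + y) ≤ |log x - log y| := by
    have key : ∀ {a b : ℝ}, 0 < a → 0 < b → a ≤ b → (b - a) / (a + b) ≤ log b - log a := by
      intro a b ha hb hab
      have h1 := one_sub_inv_le_log_of_pos (div_pos hb ha)
      rw [log_div hb.ne' ha.ne', inv_div] at h1
      have h2 : (b - a) / (a + b) ≤ (b - a) / b := by
        gcongr
        linarith
      have h3 : 1 - a / b = (b - a) / b := by field_simp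
      linarith
    rcases le_total x y with h | h
    · rw [abs_of_nonpos (by linarith : x - y ≤ 0),
        abs_of_nonpos (by linarith [log_le_log hx h] : log x - log y ≤ 0)]
      have := key hx hy h
      rw [neg_sub, neg_sub]
      exact this
    · rw [abs_of_nonneg (by linarith : 0 ≤ x - y),
        abs_of_nonneg (by linarith [log_le_log hy h] : 0 ≤ log x - log y)]
      have := key hy hx h
      rwa [add_comm y x] at this
  have hxy : 0 < |x - y| := abs_pos.2 (sub_ne_zero.2 hne)
  have hs : 0 < x + y := by linarith
  have h1 : logGap (x, y) ≤ (|x - y| / (x + y)) ^ (-(3 / 4) : ℝ) :=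
    rpow_le_rpow_of_nonpos (by positivity) hlog (by norm_num)
  rw [div_eq_mul_inv, mul_rpow hxy.le (by positivity), inv_rpow hs.le, rpow_neg hs.le,
    inv_inv] at h1
  have h2 : (x + y) ^ (3 / 4 : ℝ) ≤ |1 + x| * |1 + y| := by
    rw [abs_of_pos (by linarith), abs_of_pos (by linarith)]
    calc (x + y) ^ (3 / 4 : ℝ) ≤ (1 + (x + y)) ^ (3 / 4 : ℝ) :=
          rpow_le_rpow hs.le (by linarith) (by norm_num)
      _ ≤ (1 + (x + y)) ^ (1 : ℝ) := rpow_le_rpow_of_exponent_le (by linarith) (by norm_num)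
      _ = 1 + (x + y) := rpow_one _
      _ ≤ _ := by nlinarith [mul_pos hx hy]
  calc logGap (x, y) ≤ |x - y| ^ (-(3 / 4) : ℝ) * (x + y) ^ (3 / 4 : ℝ) := h1
    _ ≤ |x - y| ^ (-(3 / 4) : ℝ) * (|1 + x| * |1 + y|) := by gcongr
    _ = _ := by rw [gapKernel]; ring

/-- Since `e^{-y}(1 + y) ≤ 1`, the singular part can be integrated against Lebesgue measure. By
translation invariance the bound does not depend on `x`, which makes the double integral finite. -/
lemma integrable_gapKernel_right (x : ℝ) :
    Integrable (fun y => |1 + y| * |x - y| ^ (-(3 / 4) : ℝ)) stdExp ∧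
      ∫ y, |1 + y| * |x - y| ^ (-(3 / 4) : ℝ) ∂stdExp ≤ 2 + 2 * ∫ t, cutPow t := by
  have i1 : IntegrableOn (fun y => exp (-y) * (1 + y)) (Ioi 0) := by
    rw [← integrable_stdExp_iff]
    exact (integrable_const 1).add (by simpa using integrable_pow_stdExp 1)
  have i2 : Integrable (fun y => cutPow (x - y)) := integrable_cutPow.comp_sub_left x
  have i3 : Integrable (fun y => cutPow (y - x)) := integrable_cutPow.comp_sub_right x
  have i4 : Integrable (fun y => cutPow (x - y) + cutPow (y - x)) := i2.add i3
  have e1 : ∫ y in Ioi 0, exp (-y) * (1 + y) = 2 := by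
    rw [← integral_stdExp, integral_add (integrable_const _)
      (by simpa using integrable_pow_stdExp 1)]
    have := integral_pow_stdExp 1
    simp only [pow_one] at this
    rw [this]
    norm_num
  have hb : ∀ y ∈ Ioi (0 : ℝ), exp (-y) * (|1 + y| * |x - y| ^ (-(3 / 4) : ℝ)) ≤
      exp (-y) * (1 + y) + (cutPow (x - y) + cutPow (y - x)) := by
    intro y hy
    have hy' : (0 : ℝ) < y := hy
    have h1 := abs_rpow_le_cutPow (x - y)
    rw [neg_sub] at h1
    have h2 : exp (-y) * (1 + y) ≤ 1 := by
      have := add_one_le_exp y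
      rw [exp_neg, inv_mul_le_iff₀ (exp_pos y)]
      linarith
    have h3 := cutPow_nonneg (x - y)
    have h4 := cutPow_nonneg (y - x)
    rw [abs_of_pos (by linarith : 0 < 1 + y)]
    have h5 : 0 ≤ exp (-y) * (1 + y) := by positivity
    calc exp (-y) * ((1 + y) * |x - y| ^ (-(3 / 4) : ℝ))
        = exp (-y) * (1 + y) * |x - y| ^ (-(3 / 4) : ℝ) := by ring
      _ ≤ exp (-y) * (1 + y) * (1 + cutPow (x - y) + cutPow (y - x)) := by gcongr
      _ ≤ _ := by nlinarith
  have hbi : IntegrableOn (fun y => exp (-y) * (1 + y) + (cutPow (x - y) + cutPow (y - x)))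
      (Ioi 0) := i1.add i4.integrableOn
  have hi : IntegrableOn (fun y => exp (-y) * (|1 + y| * |x - y| ^ (-(3 / 4) : ℝ))) (Ioi 0) := by
    refine Integrable.mono' hbi (by fun_prop) ?_
    filter_upwards [ae_restrict_mem measurableSet_Ioi] with y hy
    rw [norm_of_nonneg (by positivity)]
    exact hb y hy
  refine ⟨(integrable_stdExp_iff _).2 hi, ?_⟩
  rw [integral_stdExp]
  refine (setIntegral_mono_on hi hbi measurableSet_Ioi hb).trans ?_
  rw [integral_add i1 i4.integrableOn, e1]
  have h1 : ∫ y in Ioi 0, cutPow (x - y) + cutPow (y - x) ≤ ∫ y, cutPow (x - y) + cutPow (y - x) :=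
    setIntegral_le_integral i4
      (Eventually.of_forall fun y => add_nonneg (cutPow_nonneg _) (cutPow_nonneg _))
  rw [integral_add i2 i3, integral_sub_left_eq_self, integral_sub_right_eq_self] at h1
  linarith

lemma measurable_gapKernel : Measurable (fun p : ℝ × ℝ => gapKernel p.1 p.2) := by
  unfold gapKernel
  fun_prop

lemma gapKernel_nonneg (x y : ℝ) : 0 ≤ gapKernel x y := by
  unfold gapKernel
  positivity

lemma integral_gapKernel_le (x : ℝ) :
    ∫ y, gapKernel x y ∂stdExp ≤ |1 + x| * (2 + 2 * ∫ t, cutPow t) := by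
  unfold gapKernel
  rw [integral_const_mul]
  exact mul_le_mul_of_nonneg_left (integrable_gapKernel_right x).2 (abs_nonneg _)

lemma integrable_gapKernel :
    Integrable (fun p : ℝ × ℝ => gapKernel p.1 p.2) (stdExp.prod stdExp) := by
  have hm := measurable_gapKernel.aestronglyMeasurable (μ := stdExp.prod stdExp)
  have h1 : Integrable (fun x : ℝ => x) stdExp := by simpa using integrable_pow_stdExp 1
  have h2 : Integrable (fun x : ℝ => 1 + x) stdExp := (integrable_const 1).add h1
  have hb : Integrable (fun x => |1 + x| * (2 + 2 * ∫ t, cutPow t)) stdExp := h2.abs.mul_const _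
  have hi : ∀ x, Integrable (fun y => gapKernel x y) stdExp := fun x =>
    (integrable_gapKernel_right x).1.const_mul |1 + x|
  have hint : Integrable (fun x => ∫ y, ‖gapKernel x y‖ ∂stdExp) stdExp := by
    refine hb.mono' hm.norm.integral_prod_right' (Eventually.of_forall fun x => ?_)
    simp only [norm_of_nonneg (gapKernel_nonneg _ _)]
    rw [norm_of_nonneg (integral_nonneg fun y => gapKernel_nonneg _ _)]
    exact integral_gapKernel_le x
  exact (integrable_prod_iff hm).2 ⟨Eventually.of_forall hi, hint⟩

lemma ae_prod_stdExp_pos : ∀ᵐ p ∂(stdExp.prod stdExp), 0 < p.1 ∧ 0 < p.2 :=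
  (Measure.quasiMeasurePreserving_fst.ae ae_stdExp_pos).and
    (Measure.quasiMeasurePreserving_snd.ae ae_stdExp_pos)

lemma measurable_logGap : Measurable logGap := by
  unfold logGap
  fun_prop

lemma integrable_logGap : Integrable logGap (stdExp.prod stdExp) := by
  refine integrable_gapKernel.mono' measurable_logGap.aestronglyMeasurable ?_
  filter_upwards [ae_prod_stdExp_pos] with p ⟨h1, h2⟩
  rw [norm_of_nonneg (by unfold logGap; positivity)]
  exact logGap_le_gapKernel h1 h2

lemma ae_prod_stdExp_ne : ∀ᵐ p ∂(stdExp.prod stdExp), p.1 ≠ p.2 := by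
  have hn : NullSingletonClass stdExp := by
    unfold stdExp
    infer_instance
  have hs : MeasurableSet {p : ℝ × ℝ | p.1 = p.2} := measurableSet_eq_fun measurable_fst measurable_snd
  rw [ae_iff]
  simp only [ne_eq, not_not]
  rw [Measure.measure_prod_null hs]
  refine Eventually.of_forall fun x => ?_
  have : Prod.mk x ⁻¹' {p : ℝ × ℝ | p.1 = p.2} = {x} := by
    ext y
    simp [eq_comm]
  show stdExp _ = 0
  rw [this, measure_singleton]

/-! ### Disjoint pairs of observations -/

section Samples

variable {θ : Fin 2 → ℝ} {n : ℕ}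

lemma iIndepFun_weibullStd (hθ : θ ∈ weibullParams) :
    iIndepFun (fun (a : Fin n) (x : Fin n → ℝ) => weibullStd θ (x a))
      (Measure.pi fun _ => obsLaw weibullPDF θ) := by
  have := isProbabilityMeasure_weibull hθ
  exact iIndepFun_coord.comp (fun _ => weibullStd θ) fun _ => measurable_weibullStd θ

lemma measurePreserving_pair (hθ : θ ∈ weibullParams) {a b : Fin n} (hab : a ≠ b) :
    MeasurePreserving (fun x : Fin n → ℝ => (weibullStd θ (x a), weibullStd θ (x b)))
      (Measure.pi fun _ => obsLaw weibullPDF θ) (stdExp.prod stdExp) := by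
  have := isProbabilityMeasure_weibull hθ
  have hm := measurable_weibullStd θ
  have hv := fun a : Fin n => (measurePreserving_weibullStd hθ).comp
    (measurePreserving_eval (fun _ : Fin n => obsLaw weibullPDF θ) a)
  have h := ((iIndepFun_weibullStd (n := n) hθ).indepFun hab).map_prod_eq_prod_map_map
    (hm.comp (measurable_pi_apply a)).aemeasurable (hm.comp (measurable_pi_apply b)).aemeasurable
  refine ⟨(hm.comp (measurable_pi_apply a)).prodMk (hm.comp (measurable_pi_apply b)), ?_⟩
  refine h.trans ?_
  congr 1
  · exact (hv a).map_eq
  · exact (hv b).map_eq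

lemma ae_weibullStd_ne (hθ : θ ∈ weibullParams) {a b : Fin n} (hab : a ≠ b) :
    ∀ᵐ x ∂(Measure.pi fun _ : Fin n => obsLaw weibullPDF θ),
      weibullStd θ (x a) ≠ weibullStd θ (x b) :=
  (measurePreserving_pair hθ hab).quasiMeasurePreserving.ae ae_prod_stdExp_ne

theorem eventually_ae_validSamples (hθ : θ ∈ weibullParams) : ∀ᶠ n : ℕ in atTop,
    ∀ᵐ x ∂(Measure.pi fun _ : Fin n => obsLaw weibullPDF θ), (⟨n, x⟩ : Sample) ∈ validSamples := by
  filter_upwards [eventually_ge_atTop 2] with n hn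
  have hab : (⟨0, by omega⟩ : Fin n) ≠ ⟨1, by omega⟩ := by simp
  filter_upwards [ae_sample_pos hθ n, ae_weibullStd_ne hθ hab] with x h1 h2
  exact ⟨h1, _, _, fun h => h2 (congrArg (weibullStd θ) h)⟩

/-- The gaps of two disjoint pairs are independent, so only the integrability of a single power
`-3/4` is used, although the product has total order `-3/2`. -/
lemma integrable_logGap_mul (hθ : θ ∈ weibullParams) {a b c d : Fin n} (hab : a ≠ b) (hcd : c ≠ d)
    (hac : a ≠ c) (had : a ≠ d) (hbc : b ≠ c) (hbd : b ≠ d) :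
    Integrable (fun x : Fin n → ℝ => logGap (weibullStd θ (x a), weibullStd θ (x b)) *
      logGap (weibullStd θ (x c), weibullStd θ (x d))) (Measure.pi fun _ => obsLaw weibullPDF θ) ∧
    ∫ x : Fin n → ℝ, logGap (weibullStd θ (x a), weibullStd θ (x b)) *
      logGap (weibullStd θ (x c), weibullStd θ (x d)) ∂(Measure.pi fun _ => obsLaw weibullPDF θ) =
      (∫ p, logGap p ∂(stdExp.prod stdExp)) ^ 2 := by
  have h1 := measurePreserving_pair hθ hab
  have h2 := measurePreserving_pair hθ hcd
  have hind := ((iIndepFun_weibullStd (n := n) hθ).indepFun_prodMk_prodMk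
    (fun i => (measurable_weibullStd θ).comp (measurable_pi_apply i)) a b c d hac had hbc hbd).comp
    measurable_logGap measurable_logGap
  have hi := fun {a b : Fin n} (hab : a ≠ b) =>
    (measurePreserving_pair hθ hab).integrable_comp_of_integrable integrable_logGap
  have he : ∀ {a b : Fin n}, a ≠ b → ∫ x : Fin n → ℝ, logGap (weibullStd θ (x a), weibullStd θ (x b))
      ∂(Measure.pi fun _ => obsLaw weibullPDF θ) = ∫ p, logGap p ∂(stdExp.prod stdExp) := by
    intro a b hab
    have h := measurePreserving_pair hθ hab
    rw [← h.map_eq, integral_map h.aemeasurable measurable_logGap.aestronglyMeasurable]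
  refine ⟨hind.integrable_mul (hi hab) (hi hcd), ?_⟩
  rw [sq]
  refine (hind.integral_fun_mul_eq_mul_integral (hi hab).1 (hi hcd).1).trans ?_
  congr 1
  exacts [he hab, he hcd]

end Samples

/-! ### Polynomial growth of the `3/2`-th moments -/

section Tame

variable {θ : Fin 2 → ℝ} {t : ℝ} {T : Sample → Fin 2 → ℝ}

/-- `k^{3/2}` is split into two factors `k^{3/4}`, each bounded through a different gap, so that
neither gap carries a power as singular as `-1`. -/
lemma rpow_three_halves_le {k c u v : ℝ} (hk : 0 ≤ k) (hc : 0 ≤ c) (hu : 0 < u) (hv : 0 < v)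
    (h1 : k * u ≤ c) (h2 : k * v ≤ c) :
    k ^ (3 / 2 : ℝ) ≤ (1 + c) ^ 2 * (u ^ (-(3 / 4) : ℝ) * v ^ (-(3 / 4) : ℝ)) := by
  have key : ∀ {u : ℝ}, 0 < u → k * u ≤ c → k ^ (3 / 4 : ℝ) ≤ (1 + c) * u ^ (-(3 / 4) : ℝ) := by
    intro u hu h
    have h3 : (k * u) ^ (3 / 4 : ℝ) ≤ 1 + c := by
      calc (k * u) ^ (3 / 4 : ℝ) ≤ (1 + c) ^ (3 / 4 : ℝ) := by gcongr; linarith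
        _ ≤ (1 + c) ^ (1 : ℝ) := rpow_le_rpow_of_exponent_le (by linarith) (by norm_num)
        _ = 1 + c := rpow_one _
    rw [mul_rpow hk hu.le] at h3
    rw [rpow_neg hu.le, ← div_eq_mul_inv, le_div_iff₀ (by positivity)]
    exact h3
  have e : k ^ (3 / 2 : ℝ) = k ^ (3 / 4 : ℝ) * k ^ (3 / 4 : ℝ) := by
    rw [← rpow_add_of_nonneg hk (by norm_num) (by norm_num)]
    norm_num
  rw [e]
  calc k ^ (3 / 4 : ℝ) * k ^ (3 / 4 : ℝ)
      ≤ ((1 + c) * u ^ (-(3 / 4) : ℝ)) * ((1 + c) * v ^ (-(3 / 4) : ℝ)) :=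
        mul_le_mul (key hu h1) (key hv h2) (by positivity) (by positivity)
    _ = _ := by ring

/-- `IsCritMin.shape_mul_le` is applied to the pairs among the first four observations, hence `n ≥
4`. Gaps of standardised logarithms carry an extra factor `θ 0`. -/
theorem tame_shape (hθ : θ ∈ weibullParams) (ht : 0 ≤ t)
    (hm : ∀ n : ℕ, Measurable fun x : Fin n → ℝ => T ⟨n, x⟩)
    (h : ∀ ω ∈ validSamples, IsCritMin t ω.2 (T ω)) :
    Tame (obsLaw weibullPDF θ) (fun ω => T ω 0) := by
  set K := ∫ p, logGap p ∂(stdExp.prod stdExp) with hK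
  refine ⟨(1 + 4 * θ 0) ^ 2 * K ^ 2, 2, by positivity, ?_⟩
  filter_upwards [eventually_ae_validSamples hθ, eventually_ge_atTop 4] with n hv hn
  have hn1 : (1 : ℝ) ≤ n := by exact_mod_cast (by omega : 1 ≤ n)
  have hT : Measurable fun x : Fin n → ℝ => T ⟨n, x⟩ 0 := (measurable_pi_apply 0).comp (hm n)
  have hθ0 := hθ.1
  let a : Fin n := ⟨0, by omega⟩
  let b : Fin n := ⟨1, by omega⟩
  let c : Fin n := ⟨2, by omega⟩
  let d : Fin n := ⟨3, by omega⟩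
  have hab : a ≠ b := by simp [a, b]
  have hcd : c ≠ d := by simp [c, d]
  obtain ⟨hi, he⟩ := integrable_logGap_mul hθ hab hcd (by simp [a, c]) (by simp [a, d])
    (by simp [b, c]) (by simp [b, d])
  have hb : ∀ᵐ x ∂(Measure.pi fun _ : Fin n => obsLaw weibullPDF θ),
      |T ⟨n, x⟩ 0| ^ (3 / 2 : ℝ) ≤ (1 + 4 * θ 0) ^ 2 * (n : ℝ) ^ 2 *
        (logGap (weibullStd θ (x a), weibullStd θ (x b)) *
          logGap (weibullStd θ (x c), weibullStd θ (x d))) := by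
    filter_upwards [hv, ae_weibullStd_ne hθ hab, ae_weibullStd_ne hθ hcd] with x hx h1 h2
    have hc := h _ hx
    have hpos : ∀ i, 0 < x i := hx.1
    have hgap : ∀ {i j : Fin n}, weibullStd θ (x i) ≠ weibullStd θ (x j) →
        0 < |log (weibullStd θ (x i)) - log (weibullStd θ (x j))| ∧
        T ⟨n, x⟩ 0 * |log (weibullStd θ (x i)) - log (weibullStd θ (x j))| ≤
          θ 0 * (2 * (n + 1)) := by
      intro i j hij
      refine ⟨abs_pos.2 (sub_ne_zero.2 fun hl => hij (log_injOn_pos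
        (weibullStd_pos hθ (hpos i)) (weibullStd_pos hθ (hpos j)) hl)), ?_⟩
      have := hc.shape_mul_le ht i j
      rw [log_weibullStd hθ (hpos i), log_weibullStd hθ (hpos j), ← mul_sub, abs_mul,
        abs_of_pos hθ.1, sub_sub_sub_cancel_right]
      calc _ = θ 0 * (T ⟨n, x⟩ 0 * |log (x i) - log (x j)|) := by ring
        _ ≤ _ := by gcongr
    have hp := rpow_three_halves_le hc.1.1.le (by positivity) (hgap h1).1 (hgap h2).1
      (hgap h1).2 (hgap h2).2
    rw [abs_of_pos hc.1.1]
    refine hp.trans ?_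
    rw [← mul_pow]
    -- For `n ≥ 1` one has `1 + 2 θ₀ (n + 1) ≤ (1 + 4 θ₀) n`.
    refine mul_le_mul_of_nonneg_right ?_ (by positivity)
    gcongr
    nlinarith
  have hbi := hi.const_mul ((1 + 4 * θ 0) ^ 2 * (n : ℝ) ^ 2)
  have hint : Integrable (fun x : Fin n → ℝ => |T ⟨n, x⟩ 0| ^ (3 / 2 : ℝ))
      (Measure.pi fun _ => obsLaw weibullPDF θ) := by
    refine hbi.mono' (hT.abs.pow_const _).aestronglyMeasurable ?_
    filter_upwards [hb] with x hx
    rwa [norm_of_nonneg (by positivity)]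
  refine ⟨hT.aestronglyMeasurable, hint, (integral_mono_ae hint hbi hb).trans_eq ?_⟩
  rw [integral_const_mul, he]
  ring

lemma integrable_sq_weibull (hθ : θ ∈ weibullParams) :
    Integrable (fun x => x ^ 2) (obsLaw weibullPDF θ) := by
  have h1 : Integrable (fun v => θ 1 ^ 2 * v ^ (2 * (θ 0)⁻¹)) stdExp := by
    have := inv_pos.2 hθ.1
    exact (integrable_rpow_stdExp (by linarith)).const_mul _
  refine ((measurePreserving_weibullStd hθ).integrable_comp_of_integrable h1).congr ?_
  filter_upwards [ae_weibull_pos] with x hx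
  have hxl := div_pos hx hθ.2
  simp only [Function.comp_apply, weibullStd]
  rw [← rpow_mul hxl.le, mul_comm 2, mul_inv_cancel_left₀ hθ.1.ne']
  have := hθ.2.ne'
  norm_cast
  field_simp

/-- By `IsCritMin.scale_le` with `M = 1 + ∑ xₐ` the estimated scale is at most `M`; since `M ≥ 1`,
`M^{3/2} ≤ M²`, and Cauchy–Schwarz reduces the bound to second moments. -/
theorem tame_scale (hθ : θ ∈ weibullParams) (ht : 0 ≤ t)
    (hm : ∀ n : ℕ, Measurable fun x : Fin n → ℝ => T ⟨n, x⟩)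
    (h : ∀ ω ∈ validSamples, IsCritMin t ω.2 (T ω)) :
    Tame (obsLaw weibullPDF θ) (fun ω => T ω 1) := by
  have := isProbabilityMeasure_weibull hθ
  set E := ∫ y, y ^ 2 ∂(obsLaw weibullPDF θ) with hE
  have hE0 : 0 ≤ E := integral_nonneg fun y => sq_nonneg y
  refine ⟨2 + 2 * E, 2, by positivity, ?_⟩
  filter_upwards [eventually_ae_validSamples hθ, eventually_ge_atTop 1] with n hv hn
  have hn1 : (1 : ℝ) ≤ n := by exact_mod_cast hn
  have hT : Measurable fun x : Fin n → ℝ => T ⟨n, x⟩ 1 := (measurable_pi_apply 1).comp (hm n)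
  have hi1 : ∀ a, Integrable (fun x : Fin n → ℝ => x a ^ 2)
      (Measure.pi fun _ => obsLaw weibullPDF θ) := fun a =>
    (measurePreserving_eval (fun _ : Fin n => obsLaw weibullPDF θ) a).integrable_comp_of_integrable
      (integrable_sq_weibull hθ)
  have hi2 := integrable_finsetSum Finset.univ fun a _ => hi1 a
  have hbi : Integrable (fun x : Fin n → ℝ => 2 + 2 * (n * ∑ a, x a ^ 2))
      (Measure.pi fun _ => obsLaw weibullPDF θ) :=
    (integrable_const _).add ((hi2.const_mul _).const_mul _)
  have hb : ∀ᵐ x ∂(Measure.pi fun _ : Fin n => obsLaw weibullPDF θ),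
      |T ⟨n, x⟩ 1| ^ (3 / 2 : ℝ) ≤ 2 + 2 * (n * ∑ a, x a ^ 2) := by
    filter_upwards [hv] with x hx
    have hc := h _ hx
    have hpos : ∀ i, 0 < x i := hx.1
    have hs : 0 ≤ ∑ a, x a := Finset.sum_nonneg fun a _ => (hpos a).le
    have hle : T ⟨n, x⟩ 1 ≤ 1 + ∑ a, x a := by
      refine hc.scale_le ht hn hpos (by linarith) fun a => ?_
      have := Finset.single_le_sum (f := x) (fun i _ => (hpos i).le) (Finset.mem_univ a)
      linarith
    have hcs := sq_sum_le_card_mul_sum_sq (s := Finset.univ) (f := x)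
    rw [Finset.card_univ, Fintype.card_fin] at hcs
    rw [abs_of_pos hc.1.2]
    have hM : 1 ≤ 1 + ∑ a, x a := by linarith
    calc T ⟨n, x⟩ 1 ^ (3 / 2 : ℝ) ≤ (1 + ∑ a, x a) ^ (3 / 2 : ℝ) := by
          gcongr
          exact hc.1.2.le
      _ ≤ (1 + ∑ a, x a) ^ (2 : ℝ) := rpow_le_rpow_of_exponent_le hM (by norm_num)
      _ = (1 + ∑ a, x a) ^ 2 := by norm_cast
      _ ≤ 2 + 2 * (∑ a, x a) ^ 2 := by nlinarith [sq_nonneg (1 - ∑ a, x a)]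
      _ ≤ _ := by gcongr
  have hint : Integrable (fun x : Fin n → ℝ => |T ⟨n, x⟩ 1| ^ (3 / 2 : ℝ))
      (Measure.pi fun _ => obsLaw weibullPDF θ) := by
    refine hbi.mono' (hT.abs.pow_const _).aestronglyMeasurable ?_
    filter_upwards [hb] with x hx
    rwa [norm_of_nonneg (by positivity)]
  refine ⟨hT.aestronglyMeasurable, hint, (integral_mono_ae hint hbi hb).trans ?_⟩
  rw [integral_add (integrable_const _) ((hi2.const_mul _).const_mul _), integral_const_mul,
    integral_const_mul, integral_finsetSum _ fun a _ => hi1 a]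
  have he : ∀ a, ∫ x : Fin n → ℝ, x a ^ 2 ∂(Measure.pi fun _ => obsLaw weibullPDF θ) = E :=
    fun a => integral_coord (integrable_sq_weibull hθ).1 a
  simp only [he]
  simp
  nlinarith

end Tame

/-! ### Bias of the estimators -/

section Bias

variable {θ : Fin 2 → ℝ} {mle wf : (n : ℕ) → (Fin n → ℝ) → Fin 2 → ℝ}

lemma isCritMin_mle_sample (h : ∀ n, IsMLE weibullPDF (Ioi 0) weibullParams (mle n)) :
    ∀ ω ∈ validSamples, IsCritMin 0 ω.2 (mle ω.1 ω.2) := fun ω hω => isCritMin_mle (h ω.1) hω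

lemma isCritMin_wf_sample
    (h : ∀ n, IsWFEstimator weibullPDF weibullPrior (Ioi 0) weibullParams (wf n)) :
    ∀ ω ∈ validSamples, IsCritMin 1 ω.2 (wf ω.1 ω.2) := fun ω hω => isCritMin_wf (h ω.1) hω

lemma eventually_hasMean (hθ : θ ∈ weibullParams) {t : ℝ} (ht : 0 ≤ t)
    (hm : ∀ n, Measurable (mle n))
    (h : ∀ ω ∈ validSamples, IsCritMin t ω.2 (mle ω.1 ω.2)) :
    ∀ᶠ n : ℕ in atTop, HasMean weibullPDF (mle n) θ := by
  have := isProbabilityMeasure_weibull hθ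
  filter_upwards [(tame_shape hθ ht (T := fun ω => mle ω.1 ω.2) hm h).integrable,
    (tame_scale hθ ht (T := fun ω => mle ω.1 ω.2) hm h).integrable] with n h0 h1
  intro s
  fin_cases s
  exacts [h0, h1]

theorem bias_mle_isBigO (hθ : θ ∈ weibullParams)
    (hm : ∀ n, IsMLE weibullPDF (Ioi 0) weibullParams (mle n)) :
    (fun n : ℕ => bias weibullPDF (mle n) θ - (1 / (n : ℝ)) • weibullMLECoeff (θ 0) (θ 1))
      =O[atTop] (fun n : ℕ => 1 / (n : ℝ) ^ 2) := by
  have := isProbabilityMeasure_weibull hθ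
  have hc := isCritMin_mle_sample hm
  have hφ := centred_wScore hθ
  have hV := eventually_ae_validSamples hθ
  obtain ⟨L0, h0⟩ := expansion_mle_shape hθ hc
  obtain ⟨L1, h1⟩ := expansion_mle_scale hθ hc
  have k0 := integral_sub_isBigO hφ hV
    (tame_shape hθ le_rfl (T := fun ω => mle ω.1 ω.2) (fun n => (hm n).1) hc) h0
  have k1 := integral_sub_isBigO hφ hV
    (tame_scale hθ le_rfl (T := fun ω => mle ω.1 ω.2) (fun n => (hm n).1) hc) h1
  rw [isBigO_pi]
  intro s
  fin_cases s
  · refine k0.congr_left fun n => ?_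
    simp [bias, sampleLaw]
    ring
  · refine k1.congr_left fun n => ?_
    simp [bias, sampleLaw]
    ring

/-- The true parameter cancels from the difference of the two biases, so the limit of `n` times the
difference of the expectations is all that is needed. -/
theorem bias_wf_isLittleO (hθ : θ ∈ weibullParams)
    (hm : ∀ n, IsMLE weibullPDF (Ioi 0) weibullParams (mle n))
    (hw : ∀ n, IsWFEstimator weibullPDF weibullPrior (Ioi 0) weibullParams (wf n)) :
    (fun n : ℕ => bias weibullPDF (wf n) θ
        - (bias weibullPDF (mle n) θ + (1 / (n : ℝ)) • weibullWFCorrection (θ 0) (θ 1)))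
      =o[atTop] (fun n : ℕ => 1 / (n : ℝ)) := by
  have := isProbabilityMeasure_weibull hθ
  have hc := isCritMin_mle_sample hm
  have hc' := isCritMin_wf_sample hw
  have hφ := centred_wScore hθ
  have hV := eventually_ae_validSamples hθ
  have key : ∀ {f g : ℕ → ℝ} {d : ℝ}, Tendsto (fun n : ℕ => (n : ℝ) * (f n - g n)) atTop (𝓝 d) →
      (fun n : ℕ => f n - g n - d / n) =o[atTop] (fun n : ℕ => 1 / (n : ℝ)) := by
    intro f g d h
    have h1 : (fun n : ℕ => (n : ℝ) * (f n - g n) - d) =o[atTop] (fun _ => (1 : ℝ)) := by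
      rw [isLittleO_one_iff]
      simpa using h.sub_const d
    have h2 := (isBigO_refl (fun n : ℕ => 1 / (n : ℝ)) atTop).mul_isLittleO h1
    refine h2.congr' ?_ (Eventually.of_forall fun n => mul_one _)
    filter_upwards [eventually_gt_atTop 0] with n hn
    have : (n : ℝ) ≠ 0 := by positivity
    field_simp
  have k0 := key (tendsto_integral_sub hφ hV
    (tame_shape hθ zero_le_one (T := fun ω => wf ω.1 ω.2) (fun n => (hw n).1) hc')
    (tame_shape hθ le_rfl (T := fun ω => mle ω.1 ω.2) (fun n => (hm n).1) hc)
    (tendsto_size_mul_shape_sub hθ hc hc'))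
  have k1 := key (tendsto_integral_sub hφ hV
    (tame_scale hθ zero_le_one (T := fun ω => wf ω.1 ω.2) (fun n => (hw n).1) hc')
    (tame_scale hθ le_rfl (T := fun ω => mle ω.1 ω.2) (fun n => (hm n).1) hc)
    (tendsto_size_mul_scale_sub hθ hc hc'))
  rw [isLittleO_pi]
  intro s
  fin_cases s
  · refine k0.congr_left fun n => ?_
    simp [bias, sampleLaw]
    ring
  · refine k1.congr_left fun n => ?_
    simp [bias, sampleLaw]
    ring

end Bias

end WallaceFreeman

end

theorem mainTheorem5 (k lam : ℝ) (hk : 0 < k) (hlam : 0 < lam) :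
    -- the Fisher information and the negative penalty gradient
    fisherInfo weibullPDF ![k, lam] =
        !![(6 * (Real.eulerMascheroniConstant - 1) ^ 2 + Real.pi ^ 2) / (6 * k ^ 2),
            (Real.eulerMascheroniConstant - 1) / lam;
          (Real.eulerMascheroniConstant - 1) / lam, k ^ 2 / lam ^ 2] ∧
    (fisherInfo weibullPDF ![k, lam]).det = Real.pi ^ 2 / (6 * lam ^ 2) ∧
    wfGrad weibullPDF weibullPrior ![k, lam] =
        ![-(2 * k / (k ^ 2 + 1)), (1 - lam ^ 2) / (lam * (lam ^ 2 + 1))] ∧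
    -- the first-order terms in closed form
    (∀ n : ℕ, 1 ≤ n →
      coxSnell weibullPDF n ![k, lam] = (1 / (n : ℝ)) • weibullMLECoeff k lam) ∧
    (fisherInfo weibullPDF ![k, lam])⁻¹.mulVec (wfGrad weibullPDF weibullPrior ![k, lam]) =
        weibullWFCorrection k lam ∧
    -- bias of the maximum likelihood estimator
    (∀ mle : (n : ℕ) → (Fin n → ℝ) → Fin 2 → ℝ,
      (∀ n, IsMLE weibullPDF (Set.Ioi 0) weibullParams (mle n)) →
      (∀ᶠ n : ℕ in atTop, HasMean weibullPDF (mle n) ![k, lam]) ∧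
      (fun n : ℕ => bias weibullPDF (mle n) ![k, lam] - (1 / (n : ℝ)) • weibullMLECoeff k lam)
        =O[atTop] (fun n : ℕ => 1 / (n : ℝ) ^ 2)) ∧
    -- bias of the Wallace–Freeman estimator
    (∀ mle wf : (n : ℕ) → (Fin n → ℝ) → Fin 2 → ℝ,
      (∀ n, IsMLE weibullPDF (Set.Ioi 0) weibullParams (mle n)) →
      (∀ n, IsWFEstimator weibullPDF weibullPrior (Set.Ioi 0) weibullParams (wf n)) →
      (∀ᶠ n : ℕ in atTop, HasMean weibullPDF (wf n) ![k, lam]) ∧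
      (fun n : ℕ => bias weibullPDF (wf n) ![k, lam]
          - (bias weibullPDF (mle n) ![k, lam] + (1 / (n : ℝ)) • weibullWFCorrection k lam))
        =o[atTop] (fun n : ℕ => 1 / (n : ℝ))) ∧
    -- the ratio of the shape biases at scale one
    0 < weibullWFCoeff k 1 0 ∧
    shapeBiasRatio k 1 =
        3 * (k ^ 2 + 1) * (Real.pi ^ 2 - 2 * apery) /
          (Real.pi ^ 2 * (k ^ 2 + 3) - 6 * (k ^ 2 + 1) * apery) ∧
    1 < shapeBiasRatio k 1 := by
  have hθ : ![k, lam] ∈ weibullParams := ⟨by simpa using hk, by simpa using hlam⟩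
  have hfi := fisherInfo_weibull hθ
  refine ⟨by simpa [weibullInfo] using hfi, by simpa [hfi] using det_weibullInfo hθ,
    by simpa using wfGrad_weibull hθ, fun n hn => by simpa using coxSnell_weibull hθ hn,
    by simpa using inv_fisherInfo_mulVec_wfGrad hθ, fun mle hm => ⟨?_, ?_⟩,
    fun mle wf hm hw => ⟨?_, ?_⟩, weibullWFCoeff_one_pos hk, shapeBiasRatio_one hk,
    one_lt_shapeBiasRatio_one hk⟩
  · exact eventually_hasMean hθ le_rfl (fun n => (hm n).1) (isCritMin_mle_sample hm)
  · simpa using bias_mle_isBigO hθ hm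
  · exact eventually_hasMean hθ zero_le_one (fun n => (hw n).1) (isCritMin_wf_sample hw)
  · simpa using bias_wf_isLittleO hθ hm hw
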